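/- **Conventions.** All vector spaces are complex, matrix sizes $m,n,k$ written with $\mathcal M_k(\cdot)$, $k\in\mathbb N$, are finite, and cardinals and Hilbert spaces are taken in a fixed universe. For a nonzero cardinal $n$ let $H_n=\ell^2(n)$ and $\mathcal M_n=B(H_n)$. *Operator systems.* A matrix ordered operator space is an operator space $E$ (matrix norms satisfying Ruan's axioms) with a completely isometric conjugate linear involution and a matrix cone, i.e. norm closed convex cones $P_n\subseteq \mathcal M_n(E)_h$ with $P_n\cap -P_n=\{0\}$ and $AP_nA^*\subseteq P_m$ for all $A\in \mathcal M_{m,n}(\mathbb C)$. A ccp map is a linear, involution preserving, completely contractive and completely positive map. The partial unitization of $E$ is $E^\sharp=E\oplus\mathbb C$, where a self-adjoint $(x,\alpha)\in \mathcal M_n(E)_h\oplus(\mathcal M_n)_h$ is positive if $\alpha\ge 0$ and $\phi_n(\alpha_\varepsilon^{-1/2}x\alpha_\varepsilon^{-1/2})\ge -1$ for all $\varepsilon>0$ and all ccp maps $\phi:E\to \mathcal M_n$, with $\alpha_\varepsilon=\alpha+\varepsilon 1_n$; it carries the matrix norms $\|X\|=\inf\{t>0: \begin{pmatrix} t1_n\otimes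 e& X\\ X^*& t1_n\otimes e\end{pmatrix}\ge 0\}$ induced by its order unit $e=(0,1)$. A (generalized) operator system is a complete matrix ordered operator space $S$ for which the inclusion $S\to S^\sharp$, $x\mapsto(x,0)$, is completely isometric. $\mathrm{OpSys}$ is the category of operator systems with ccp maps as morphisms. *Compact nc convex sets.* Let $E$ be a dual operator space with distinguished (complete) predual $E_*$. For each nonzero cardinal $n$ identify $\mathcal M_n(E)$ with the completely bounded maps $E_*\to\mathcal M_n$, with the point-weak* topology. A compact nc convex set over $E$ is a family $K=\bigsqcup_n K_n$ of compact sets $K_n\subseteq\mathcal M_n(E)$, indexed by the nonzero cardinals $n$, such that $\sum_i\alpha_ix_i\alpha_i^*\in K_n$ for every bounded family $x_i\in K_{n_i}$ and all isometries $\alpha_i:H_{n_i}\to H_n$ with $\sum_i\alpha_i\alpha_i^*=1$, and $\beta^*x\beta\in K_m$ for every $x\in K_n$ and every isometry $\beta:H_m\to H_n$. A continuous affine nc map between compact nc convex sets, or from one into $\mathcal M=\bigsqcup_n\mathcal M_n$ (a continuous affine nc function), is a graded map that respects these direct sums and compressions and is continuous on each $K_n$ for the point-weak* topologies (the weak* topology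 on $\mathcal M_n$). For $z\in K_1$, $\mathrm A(K,z)$ is the space of continuous affine nc functions $a$ on $K$ with $a(z)=0$, with involution $a^*(x)=a(x)^*$, the uniform matrix norms, and the matrices with positive values at all points as positive elements. The pair $(K,z)$ is a pointed compact nc convex set if every ccp map $\mathrm A(K,z)\to\mathcal M_n$, for every $n$, is evaluation at a point of $K_n$. $\mathrm{PoNCConv}$ is the category of pointed compact nc convex sets with continuous affine nc maps that preserve the distinguished points as morphisms. **Theorem.** (1) For every operator system $S$ the nc quasistate space $(K,0)$ of $S$, where $K_n$ is the set of ccp maps $S\to\mathcal M_n$ (over the dual operator space $S^*$ with predual $S$), is a pointed compact nc convex set. For every pointed compact nc convex set $(K,z)$ the space $\mathrm A(K,z)$ is an operator system. (2) Let $F:\mathrm{OpSys}^{op}\to\mathrm{PoNCConv}$ map $S$ to its nc quasistate space and a ccp map $\phi:S\to T$ to $\phi^d:y\mapsto y\circ\phi$, and let $G:\mathrm{PoNCConv}^{op}\to\mathrm{OpSys}$ map $(K,z)$ to $\mathrm A(K,z)$ and a morphism $\psi:(L,w)\to(K,z)$ to $\psi^d:a\mapsto a\circ\psi$. These contravariant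 functors are mutually inverse up to natural isomorphism: the maps $S\to\mathrm A(K,0)$, $s\mapsto\hat s$, $\hat s(x)=x(s)$, where $(K,0)$ is the nc quasistate space of $S$, are a natural isomorphism of the identity of $\mathrm{OpSys}$ with $GF$, and the maps $x\mapsto(a\mapsto a(x))$ from $(K,z)$ to the nc quasistate space of $\mathrm A(K,z)$ are a natural isomorphism of the identity of $\mathrm{PoNCConv}$ with $FG$. Hence $F$ and $G$ form an equivalence of categories between $\mathrm{OpSys}^{op}$ and $\mathrm{PoNCConv}$, i.e. $\mathrm{OpSys}$ and $\mathrm{PoNCConv}$ are dually equivalent. -/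

import Mathlib

open CategoryTheory Opposite
open scoped ComplexOrder

universe u v w

/-! ## Matrix norms, matrix cones, completely contractive and completely positive maps -/

/-- The family of (finite) matrix norms of an operator space. -/
class MatrixNorm (E : Type w) where
  mnorm : ∀ n : ℕ, Matrix (Fin n) (Fin n) E → ℝ

/-- The family of sets of positive matrices of a matrix ordered space. -/
class MatrixCone (E : Type w) where
  cone : ∀ n : ℕ, Set (Matrix (Fin n) (Fin n) E)

/-- The product `α x β` of a matrix `x` over `E` with scalar matrices `α` and `β`. -/
def scalarConj {E : Type w} [AddCommGroup E] [Module ℂ E] {m n p q : ℕ}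
    (α : Matrix (Fin m) (Fin n) ℂ) (x : Matrix (Fin n) (Fin p) E)
    (β : Matrix (Fin p) (Fin q) ℂ) : Matrix (Fin m) (Fin q) E :=
  fun i j => ∑ k, ∑ l, (α i k * β l j) • x k l

/-- The block matrix `[[a, b], [c, d]]`, of size `m + n`. -/
def blockMatrix {E : Type w} {m n : ℕ} (a : Matrix (Fin m) (Fin m) E)
    (b : Matrix (Fin m) (Fin n) E) (c : Matrix (Fin n) (Fin m) E)
    (d : Matrix (Fin n) (Fin n) E) : Matrix (Fin (m + n)) (Fin (m + n)) E :=
  Matrix.reindex finSumFinEquiv finSumFinEquiv (Matrix.fromBlocks a b c d)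

open scoped Matrix.Norms.L2Operator in
/-- (Abstract) operator spaces: complex vector spaces with a norm on the space of `n × n` matrices
for every `n`, subject to Ruan's axioms. Scalar matrices carry the operator norm. -/
structure IsOperatorSpace (E : Type w) [AddCommGroup E] [Module ℂ E] [MatrixNorm E] : Prop where
  eq_zero : ∀ (n : ℕ) (x : Matrix (Fin n) (Fin n) E), MatrixNorm.mnorm n x = 0 → x = 0
  add_le : ∀ (n : ℕ) (x y : Matrix (Fin n) (Fin n) E),
    MatrixNorm.mnorm n (x + y) ≤ MatrixNorm.mnorm n x + MatrixNorm.mnorm n y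
  smul_eq : ∀ (n : ℕ) (c : ℂ) (x : Matrix (Fin n) (Fin n) E),
    MatrixNorm.mnorm n (c • x) = ‖c‖ * MatrixNorm.mnorm n x
  conj_le : ∀ (m n : ℕ) (α : Matrix (Fin m) (Fin n) ℂ) (x : Matrix (Fin n) (Fin n) E)
    (β : Matrix (Fin n) (Fin m) ℂ),
    MatrixNorm.mnorm m (scalarConj α x β) ≤ ‖α‖ * MatrixNorm.mnorm n x * ‖β‖
  block_eq : ∀ (m n : ℕ) (x : Matrix (Fin m) (Fin m) E) (y : Matrix (Fin n) (Fin n) E),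
    MatrixNorm.mnorm (m + n) (blockMatrix x 0 0 y) =
      max (MatrixNorm.mnorm m x) (MatrixNorm.mnorm n y)

/-- The norm of `x : E`, viewed as a `1 × 1` matrix. -/
def norm₁ {E : Type w} [MatrixNorm E] (x : E) : ℝ :=
  MatrixNorm.mnorm 1 (fun _ _ => x)

/-- Completeness of a matrix normed space: every Cauchy sequence of `E` converges. -/
def IsMatrixComplete (E : Type w) [AddCommGroup E] [MatrixNorm E] : Prop :=
  ∀ s : ℕ → E, (∀ ε > (0 : ℝ), ∃ N, ∀ i ≥ N, ∀ j ≥ N, norm₁ (s i - s j) < ε) →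
    ∃ x : E, Filter.Tendsto (fun i => norm₁ (s i - x)) Filter.atTop (nhds 0)

/-- Matrix ordered operator spaces: operator spaces with a completely isometric conjugate linear
involution and a matrix cone, that is a family of norm closed convex cones `P n` of self-adjoint
`n × n` matrices with `P n ∩ -P n = 0` and `A (P n) A* ⊆ P m` for scalar `m × n` matrices `A`. -/
structure IsMatrixOrderedOperatorSpace (E : Type w) [AddCommGroup E] [Module ℂ E]
    [StarAddMonoid E] [StarModule ℂ E] [MatrixNorm E] [MatrixCone E] : Prop extends
    IsOperatorSpace E where
  mnorm_star : ∀ (n : ℕ) (x : Matrix (Fin n) (Fin n) E),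
    MatrixNorm.mnorm n x.conjTranspose = MatrixNorm.mnorm n x
  cone_isHermitian : ∀ (n : ℕ), ∀ x ∈ MatrixCone.cone (E := E) n, x.IsHermitian
  cone_closed : ∀ (n : ℕ) (s : ℕ → Matrix (Fin n) (Fin n) E) (x : Matrix (Fin n) (Fin n) E),
    (∀ i, s i ∈ MatrixCone.cone (E := E) n) →
    Filter.Tendsto (fun i => MatrixNorm.mnorm n (s i - x)) Filter.atTop (nhds 0) →
    x ∈ MatrixCone.cone (E := E) n
  zero_mem_cone : ∀ n : ℕ, 0 ∈ MatrixCone.cone (E := E) n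
  add_mem_cone : ∀ (n : ℕ), ∀ x ∈ MatrixCone.cone (E := E) n,
    ∀ y ∈ MatrixCone.cone (E := E) n, x + y ∈ MatrixCone.cone (E := E) n
  cone_pointed : ∀ (n : ℕ), ∀ x ∈ MatrixCone.cone (E := E) n,
    -x ∈ MatrixCone.cone (E := E) n → x = 0
  conj_mem_cone : ∀ (m n : ℕ) (A : Matrix (Fin m) (Fin n) ℂ), ∀ x ∈ MatrixCone.cone (E := E) n,
    scalarConj A x A.conjTranspose ∈ MatrixCone.cone (E := E) m

/-- Complete boundedness with constant `C`. -/
def IsCompletelyBoundedBy {E : Type u} {F : Type w} [AddCommGroup E] [Module ℂ E] [MatrixNorm E]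
    [AddCommGroup F] [Module ℂ F] [MatrixNorm F] (C : ℝ) (φ : E →ₗ[ℂ] F) : Prop :=
  ∀ (n : ℕ) (x : Matrix (Fin n) (Fin n) E),
    MatrixNorm.mnorm n (x.map φ) ≤ C * MatrixNorm.mnorm n x

/-- Completely contractive and completely positive (ccp) maps. Such a map is understood to be
self-adjoint, i.e. to preserve the involution (this is not automatic, because the positive
elements need not span). -/
structure IsCCP {E : Type u} {F : Type w}
    [AddCommGroup E] [Module ℂ E] [Star E] [MatrixNorm E] [MatrixCone E]
    [AddCommGroup F] [Module ℂ F] [Star F] [MatrixNorm F] [MatrixCone F]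
    (φ : E →ₗ[ℂ] F) : Prop where
  map_star : ∀ x, φ (star x) = star (φ x)
  contractive : ∀ (n : ℕ) (x : Matrix (Fin n) (Fin n) E),
    MatrixNorm.mnorm n (x.map φ) ≤ MatrixNorm.mnorm n x
  positive : ∀ (n : ℕ), ∀ x ∈ MatrixCone.cone (E := E) n, x.map φ ∈ MatrixCone.cone (E := F) n

/-! ## Bounded operators on a Hilbert space as a matrix ordered operator space -/

section Operators

variable {H : Type w} [NormedAddCommGroup H] [InnerProductSpace ℂ H]

/-- A `k × k` matrix of operators on `H`, as an operator on the Hilbert space `H ⊕ ⋯ ⊕ H`. -/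
noncomputable def opMatrix {k : ℕ} (A : Matrix (Fin k) (Fin k) (H →L[ℂ] H)) :
    PiLp 2 (fun _ : Fin k => H) →L[ℂ] PiLp 2 (fun _ : Fin k => H) :=
  (PiLp.continuousLinearEquiv 2 ℂ (fun _ : Fin k => H)).symm.toContinuousLinearMap ∘L
    (ContinuousLinearMap.pi fun i =>
      ∑ j, A i j ∘L (ContinuousLinearMap.proj (R := ℂ) (φ := fun _ : Fin k => H) j)) ∘L
    (PiLp.continuousLinearEquiv 2 ℂ (fun _ : Fin k => H)).toContinuousLinearMap

theorem opMatrix_apply {k : ℕ} (A : Matrix (Fin k) (Fin k) (H →L[ℂ] H))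
    (ξ : PiLp 2 (fun _ : Fin k => H)) (i : Fin k) :
    opMatrix A ξ i = ∑ j, A i j (ξ j) := by
  simp [opMatrix]

theorem norm_opMatrix_le {k : ℕ} (A : Matrix (Fin k) (Fin k) (H →L[ℂ] H)) :
    ‖opMatrix A‖ ≤ ∑ i, ∑ j, ‖A i j‖ := by
  refine ContinuousLinearMap.opNorm_le_bound _ (by positivity) fun ξ => ?_
  have h1 : opMatrix A ξ = ∑ i, PiLp.single 2 i (opMatrix A ξ i) := by
    ext i
    simp
  rw [h1, Finset.sum_mul]
  refine (norm_sum_le _ _).trans (Finset.sum_le_sum fun i _ => ?_)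
  rw [PiLp.norm_single, opMatrix_apply, Finset.sum_mul]
  refine (norm_sum_le _ _).trans (Finset.sum_le_sum fun j _ => ?_)
  exact ((A i j).le_opNorm _).trans
    (mul_le_mul_of_nonneg_left (PiLp.norm_apply_le ξ j) (norm_nonneg _))

noncomputable instance : MatrixNorm (H →L[ℂ] H) where
  mnorm _ A := ‖opMatrix A‖

instance : MatrixCone (H →L[ℂ] H) where
  cone _ := {A | (opMatrix A).IsPositive}

end Operators

/-! ## Operator systems -/

/-- The cones of the partial unitization `E ⊕ ℂ` of `E`: a self-adjoint matrix `(x, α)` is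
positive when `α ≥ 0` and `φ(α_ε^{-1/2} x α_ε^{-1/2}) ≥ -1` for all `ε > 0` and all ccp maps
`φ : E → M_n`, where `α_ε = α + ε 1`. The matrix `β = α_ε^{-1/2}` is the unique positive definite
matrix with `β α_ε β = 1`, and `M_n` is the algebra of operators on `n`-dimensional Hilbert
space. -/
def sharpCone (E : Type w) [AddCommGroup E] [Module ℂ E] [Star E] [MatrixNorm E] [MatrixCone E]
    (n : ℕ) : Set (Matrix (Fin n) (Fin n) (E × ℂ)) :=
  {X | X.IsHermitian ∧ (X.map Prod.snd).PosSemidef ∧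
    ∀ ε : ℝ, 0 < ε → ∀ β : Matrix (Fin n) (Fin n) ℂ, β.PosDef →
      β * (X.map Prod.snd + (ε : ℂ) • (1 : Matrix (Fin n) (Fin n) ℂ)) * β = 1 →
      ∀ φ : E →ₗ[ℂ] (EuclideanSpace ℂ (Fin n) →L[ℂ] EuclideanSpace ℂ (Fin n)), IsCCP φ →
        (opMatrix ((scalarConj β (X.map Prod.fst) β).map φ) + 1).IsPositive}

/-- The norm of the partial unitization `E ⊕ ℂ`, induced by its order unit `e = (0, 1)`: the
infimum of all `t > 0` such that the block matrix `[[t 1 ⊗ e, X], [X*, t 1 ⊗ e]]` is positive. -/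
noncomputable def sharpNorm (E : Type w) [AddCommGroup E] [Module ℂ E] [Star E] [MatrixNorm E]
    [MatrixCone E] (n : ℕ) (X : Matrix (Fin n) (Fin n) (E × ℂ)) : ℝ :=
  sInf {t : ℝ | 0 < t ∧
    blockMatrix (Matrix.diagonal fun _ => ((0 : E), (t : ℂ))) X X.conjTranspose
      (Matrix.diagonal fun _ => ((0 : E), (t : ℂ))) ∈ sharpCone E (n + n)}

/-- (Generalized) operator systems: complete matrix ordered operator spaces for which the
canonical inclusion `x ↦ (x, 0)` into the partial unitization is completely isometric. -/
structure IsOperatorSystem (E : Type w) [AddCommGroup E] [Module ℂ E]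
    [StarAddMonoid E] [StarModule ℂ E] [MatrixNorm E] [MatrixCone E] : Prop extends
    IsMatrixOrderedOperatorSpace E where
  complete : IsMatrixComplete E
  inclusion_isometric : ∀ (n : ℕ) (x : Matrix (Fin n) (Fin n) E),
    sharpNorm E n (x.map fun a => (a, (0 : ℂ))) = MatrixNorm.mnorm n x

/-- Bundled (generalized) operator systems. -/
structure OpSys : Type (u + 1) where
  carrier : Type u
  [addCommGroup : AddCommGroup carrier]
  [module : Module ℂ carrier]
  [starAddMonoid : StarAddMonoid carrier]
  [starModule : StarModule ℂ carrier]
  [matrixNorm : MatrixNorm carrier]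
  [matrixCone : MatrixCone carrier]
  isOperatorSystem : IsOperatorSystem carrier

namespace OpSys

attribute [instance] addCommGroup module starAddMonoid starModule matrixNorm matrixCone

/-- Morphisms of operator systems: completely contractive and completely positive maps. -/
@[ext]
structure Hom (S T : OpSys.{u}) : Type u where
  toLinearMap : S.carrier →ₗ[ℂ] T.carrier
  isCCP : IsCCP toLinearMap

instance : Category OpSys.{u} where
  Hom S T := Hom S T
  id S := ⟨LinearMap.id, ⟨fun _ => rfl, fun _ _ => le_rfl, fun _ _ h => h⟩⟩
  comp φ ψ := ⟨ψ.toLinearMap ∘ₗ φ.toLinearMap,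
    ⟨fun x => by simp [φ.isCCP.map_star, ψ.isCCP.map_star],
      fun n x => (ψ.isCCP.contractive n (x.map φ.toLinearMap)).trans (φ.isCCP.contractive n x),
      fun n x hx => ψ.isCCP.positive n _ (φ.isCCP.positive n x hx)⟩⟩

end OpSys

/-! ## Compact nc convex sets -/

/-- Nonzero cardinal numbers, the index set of the grading. -/
abbrev NZCard : Type (v + 1) := {n : Cardinal.{v} // n ≠ 0}

instance : One NZCard.{v} := ⟨⟨1, one_ne_zero⟩⟩

/-- A set of cardinality `n`. -/
noncomputable def NZCard.Index (n : NZCard.{v}) : Type v := Quotient.out n.1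

theorem NZCard.mk_index (n : NZCard.{v}) : Cardinal.mk n.Index = n.1 := Cardinal.mk_out n.1

/-- The Hilbert space `H_n = ℓ²(n)` of dimension `n`. -/
abbrev Hil (n : NZCard.{v}) : Type v := lp (fun _ : n.Index => ℂ) 2

/-- `M_n`, the algebra of bounded operators on `H_n`. -/
abbrev Op (n : NZCard.{v}) : Type v := Hil n →L[ℂ] Hil n

/-- The weak* (ultraweak) topology on the bounded operators on `H`, induced by the normal
functionals `T ↦ ∑ k, ⟪ξ k, T (η k)⟫` for square summable sequences `ξ` and `η` in `H`. -/
@[reducible]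
noncomputable def weakStarTopology (H : Type w) [NormedAddCommGroup H] [InnerProductSpace ℂ H] :
    TopologicalSpace (H →L[ℂ] H) :=
  TopologicalSpace.induced
    (fun (T : H →L[ℂ] H) (p : lp (fun _ : ℕ => H) 2 × lp (fun _ : ℕ => H) 2) =>
      ∑' k, inner ℂ (p.1 k) (T (p.2 k))) inferInstance

/-- The point-weak* topology on linear maps from `E` to the bounded operators on `H`. -/
@[reducible]
noncomputable def pointWeakStarTopology (E : Type u) [AddCommGroup E] [Module ℂ E] (H : Type w)
    [NormedAddCommGroup H] [InnerProductSpace ℂ H] : TopologicalSpace (E →ₗ[ℂ] (H →L[ℂ] H)) :=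
  TopologicalSpace.induced (fun (x : E →ₗ[ℂ] (H →L[ℂ] H)) (e : E) => x e)
    (@Pi.topologicalSpace E (fun _ => H →L[ℂ] H) (fun _ => weakStarTopology H))

/-- The compression `β* T β` of an operator by an isometry. -/
noncomputable def compressOp {m n : NZCard.{v}} (β : Hil m →ₗᵢ[ℂ] Hil n) (T : Op n) : Op m :=
  β.toContinuousLinearMap.adjoint ∘L T ∘L β.toContinuousLinearMap

/-- `S = ∑ i, α i (T i) (α i)*`, with weak convergence of the sum. -/
def IsOpSum {I : Type v} {n : NZCard.{v}} {m : I → NZCard.{v}}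
    (α : ∀ i, Hil (m i) →ₗᵢ[ℂ] Hil n) (T : ∀ i, Op (m i)) (S : Op n) : Prop :=
  ∀ ξ η : Hil n, HasSum (fun i => inner ℂ ξ
    (α i (T i ((α i).toContinuousLinearMap.adjoint η)))) (inner ℂ ξ (S η))

section NCSets

variable (E : Type u) [AddCommGroup E] [Module ℂ E]

/-- Graded sets over the dual of `E`. Here `M_n(E^*)` is identified with the space of completely
bounded maps from `E` to `M_n`; the points of an nc convex set are required below to be completely
bounded. -/
abbrev NCSet : Type (max u (v + 1)) := ∀ n : NZCard.{v}, Set (E →ₗ[ℂ] Op n)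

variable {E}

/-- The compression `β* x β` of a point by an isometry. -/
noncomputable def compressPoint {m n : NZCard.{v}} (β : Hil m →ₗᵢ[ℂ] Hil n) (x : E →ₗ[ℂ] Op n) :
    E →ₗ[ℂ] Op m where
  toFun e := compressOp β (x e)
  map_add' a b := by ext; simp [compressOp]
  map_smul' c a := by ext; simp [compressOp]

/-- `y = ∑ i, α i (x i) (α i)*` is the direct sum of the family of points `x i`, along isometries
`α i` with `∑ i, (α i) (α i)* = 1`. Since `x i = (α i)* y (α i)`, the family `x i` is automatically
(uniformly completely) bounded when `y` is completely bounded. -/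
structure IsDirectSum {I : Type v} {n : NZCard.{v}} {m : I → NZCard.{v}}
    (α : ∀ i, Hil (m i) →ₗᵢ[ℂ] Hil n) (x : ∀ i, E →ₗ[ℂ] Op (m i)) (y : E →ₗ[ℂ] Op n) : Prop where
  sum_eq_one : IsOpSum α (fun _ => 1) 1
  sum_eq : ∀ e : E, IsOpSum α (fun i => x i e) (y e)

/-- Compact nc convex sets over the dual of `E`: the points are completely bounded, `K` is closed
under direct sums of bounded families and under compressions, and every `K n` is compact in the point-weak* topology. -/
structure IsCompactNCConvex [MatrixNorm E] (K : NCSet.{u, v} E) : Prop where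
  completelyBounded : ∀ n, ∀ x ∈ K n, ∃ C : ℝ, IsCompletelyBoundedBy C x
  directSum_mem : ∀ (I : Type v) (n : NZCard.{v}) (m : I → NZCard.{v})
    (α : ∀ i, Hil (m i) →ₗᵢ[ℂ] Hil n) (x : ∀ i, E →ₗ[ℂ] Op (m i)) (y : E →ₗ[ℂ] Op n),
    (∀ i, x i ∈ K (m i)) → (∃ C : ℝ, ∀ i, IsCompletelyBoundedBy C (x i)) →
      IsDirectSum α x y → y ∈ K n
  compress_mem : ∀ (m n : NZCard.{v}) (β : Hil m →ₗᵢ[ℂ] Hil n),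
    ∀ x ∈ K n, compressPoint β x ∈ K m
  compact : ∀ n, @IsCompact _ (pointWeakStarTopology E (Hil n)) (K n)

/-- The point-weak* topology on the component `K n`. -/
@[reducible]
noncomputable def componentTopology (K : NCSet.{u, v} E) (n : NZCard.{v}) :
    TopologicalSpace (K n) :=
  TopologicalSpace.induced Subtype.val (pointWeakStarTopology E (Hil n))

/-- Continuous affine nc functions from `K` to `M = ⊔ M_n`: graded maps that respect direct sums,
are equivariant for isometries (in particular for unitaries), and are continuous on each `K n`. -/
structure IsContAffineNCFun (K : NCSet.{u, v} E) (f : ∀ n : NZCard.{v}, K n → Op n) : Prop where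
  map_directSum : ∀ (I : Type v) (n : NZCard.{v}) (m : I → NZCard.{v})
    (α : ∀ i, Hil (m i) →ₗᵢ[ℂ] Hil n) (x : ∀ i, K (m i)) (y : K n),
    IsDirectSum α (fun i => (x i).1) y.1 → IsOpSum α (fun i => f (m i) (x i)) (f n y)
  map_compress : ∀ (m n : NZCard.{v}) (β : Hil m →ₗᵢ[ℂ] Hil n) (x : K n) (y : K m),
    y.1 = compressPoint β x.1 → f m y = compressOp β (f n x)
  continuous : ∀ n, @Continuous _ _ (componentTopology K n) (weakStarTopology (Hil n)) (f n)

/-- Continuous affine nc maps between nc convex sets. -/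
structure IsContAffineNCMap {F : Type w} [AddCommGroup F] [Module ℂ F]
    (K : NCSet.{u, v} E) (L : NCSet.{w, v} F) (θ : ∀ n : NZCard.{v}, K n → L n) : Prop where
  map_directSum : ∀ (I : Type v) (n : NZCard.{v}) (m : I → NZCard.{v})
    (α : ∀ i, Hil (m i) →ₗᵢ[ℂ] Hil n) (x : ∀ i, K (m i)) (y : K n),
    IsDirectSum α (fun i => (x i).1) y.1 →
      ∀ e : F, IsOpSum α (fun i => (θ (m i) (x i)).1 e) ((θ n y).1 e)
  map_compress : ∀ (m n : NZCard.{v}) (β : Hil m →ₗᵢ[ℂ] Hil n) (x : K n) (y : K m),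
    y.1 = compressPoint β x.1 → (θ m y).1 = compressPoint β (θ n x).1
  continuous : ∀ n, @Continuous _ _ (componentTopology K n) (componentTopology L n) (θ n)

end NCSets

/-! ## Basic facts on the weak* topology, direct sums and compressions -/

section Basic

variable {H : Type w} [NormedAddCommGroup H] [InnerProductSpace ℂ H]

theorem summable_inner_apply (ξ η : lp (fun _ : ℕ => H) 2) (T : H →L[ℂ] H) :
    Summable fun k => inner ℂ (ξ k) (T (η k)) := by
  have h1 : Summable fun k => ‖ξ k‖ ^ (2 : ℕ) := by
    simpa using (lp.memℓp ξ).summable (by norm_num)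
  have h2 : Summable fun k => ‖η k‖ ^ (2 : ℕ) := by
    simpa using (lp.memℓp η).summable (by norm_num)
  refine Summable.of_norm_bounded ((h1.add h2).mul_left ‖T‖) fun k => ?_
  calc ‖inner ℂ (ξ k) (T (η k))‖ ≤ ‖ξ k‖ * (‖T‖ * ‖η k‖) :=
        (norm_inner_le_norm _ _).trans
          (mul_le_mul_of_nonneg_left (T.le_opNorm _) (norm_nonneg _))
    _ = ‖T‖ * (‖ξ k‖ * ‖η k‖) := by ring
    _ ≤ ‖T‖ * (‖ξ k‖ ^ 2 + ‖η k‖ ^ 2) := by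
        refine mul_le_mul_of_nonneg_left ?_ (norm_nonneg _)
        nlinarith [sq_nonneg (‖ξ k‖ - ‖η k‖), sq_nonneg (‖ξ k‖), sq_nonneg (‖η k‖)]

theorem continuous_weakStar_iff {X : Type v} [TopologicalSpace X] (f : X → H →L[ℂ] H) :
    @Continuous X _ _ (weakStarTopology H) f ↔ ∀ ξ η : lp (fun _ : ℕ => H) 2,
      Continuous fun x => ∑' k, inner ℂ (ξ k) (f x (η k)) := by
  rw [continuous_induced_rng, continuous_pi_iff]
  exact ⟨fun h ξ η => h (ξ, η), fun h p => h p.1 p.2⟩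

theorem continuous_inner_of_weakStar {X : Type v} [TopologicalSpace X] {f : X → H →L[ℂ] H}
    (hf : @Continuous X _ _ (weakStarTopology H) f) (ξ η : H) :
    Continuous fun x => inner ℂ ξ (f x η) := by
  have h := (continuous_weakStar_iff f).1 hf (lp.single 2 0 ξ) (lp.single 2 0 η)
  convert h using 2 with x
  rw [tsum_eq_single 0]
  · simp
  · intro k hk
    simp [lp.single_apply, hk]

theorem continuous_weakStar_add {X : Type v} [TopologicalSpace X] {f g : X → H →L[ℂ] H}
    (hf : @Continuous X _ _ (weakStarTopology H) f)
    (hg : @Continuous X _ _ (weakStarTopology H) g) :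
    @Continuous X _ _ (weakStarTopology H) (fun x => f x + g x) := by
  refine (continuous_weakStar_iff _).2 fun ξ η => ?_
  have h := ((continuous_weakStar_iff _).1 hf ξ η).add ((continuous_weakStar_iff _).1 hg ξ η)
  have e : ∀ x, ∑' k, inner ℂ (ξ k) ((f x + g x) (η k)) =
      ∑' k, inner ℂ (ξ k) (f x (η k)) + ∑' k, inner ℂ (ξ k) (g x (η k)) := fun x => by
    rw [← (summable_inner_apply ξ η (f x)).tsum_add (summable_inner_apply ξ η (g x))]
    simp
  exact (continuous_congr e).2 h

theorem continuous_weakStar_smul {X : Type v} [TopologicalSpace X] {f : X → H →L[ℂ] H} (c : ℂ)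
    (hf : @Continuous X _ _ (weakStarTopology H) f) :
    @Continuous X _ _ (weakStarTopology H) (fun x => c • f x) := by
  refine (continuous_weakStar_iff _).2 fun ξ η => ?_
  have h := ((continuous_weakStar_iff _).1 hf ξ η).const_mul c
  have e : ∀ x, ∑' k, inner ℂ (ξ k) ((c • f x) (η k)) =
      c * ∑' k, inner ℂ (ξ k) (f x (η k)) := fun x => by
    rw [← tsum_mul_left]
    simp
  exact (continuous_congr e).2 h

theorem continuous_weakStar_star [CompleteSpace H] {X : Type v} [TopologicalSpace X]
    {f : X → H →L[ℂ] H} (hf : @Continuous X _ _ (weakStarTopology H) f) :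
    @Continuous X _ _ (weakStarTopology H) (fun x => star (f x)) := by
  refine (continuous_weakStar_iff _).2 fun ξ η => ?_
  have h := ((continuous_weakStar_iff _).1 hf η ξ).star
  have e : ∀ x, ∑' k, inner ℂ (ξ k) ((star (f x)) (η k)) =
      star (∑' k, inner ℂ (η k) (f x (ξ k))) := fun x => by
    rw [tsum_star]
    congr 1
    ext k
    rw [ContinuousLinearMap.star_eq_adjoint, ContinuousLinearMap.adjoint_inner_right]
    exact (inner_conj_symm _ _).symm
  exact (continuous_congr e).2 h

variable {n m : NZCard.{v}}

theorem isOpSum_zero {I : Type v} {n : NZCard.{v}} {m : I → NZCard.{v}}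
    {α : ∀ i, Hil (m i) →ₗᵢ[ℂ] Hil n} : IsOpSum α (fun _ => 0) 0 := by
  intro ξ η
  simp

theorem isOpSum_add {I : Type v} {n : NZCard.{v}} {m : I → NZCard.{v}}
    {α : ∀ i, Hil (m i) →ₗᵢ[ℂ] Hil n} {T T' : ∀ i, Op (m i)} {S S' : Op n}
    (h : IsOpSum α T S) (h' : IsOpSum α T' S') : IsOpSum α (fun i => T i + T' i) (S + S') := by
  intro ξ η
  simpa using (h ξ η).add (h' ξ η)

theorem isOpSum_smul {I : Type v} {n : NZCard.{v}} {m : I → NZCard.{v}}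
    {α : ∀ i, Hil (m i) →ₗᵢ[ℂ] Hil n} {T : ∀ i, Op (m i)} {S : Op n} (c : ℂ)
    (h : IsOpSum α T S) : IsOpSum α (fun i => c • T i) (c • S) := by
  intro ξ η
  simpa using (h ξ η).mul_left c

theorem isOpSum_star {I : Type v} {n : NZCard.{v}} {m : I → NZCard.{v}}
    {α : ∀ i, Hil (m i) →ₗᵢ[ℂ] Hil n} {T : ∀ i, Op (m i)} {S : Op n}
    (h : IsOpSum α T S) : IsOpSum α (fun i => star (T i)) (star S) := by
  intro ξ η
  have h1 := (h η ξ).star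
  have e1 : star (inner ℂ η (S ξ)) = inner ℂ ξ ((star S) η) := by
    rw [ContinuousLinearMap.star_eq_adjoint, ContinuousLinearMap.adjoint_inner_right]
    exact inner_conj_symm _ _
  rw [e1] at h1
  convert h1 using 2 with i
  have e2 : ∀ (ζ : Hil n) (v : Hil (m i)), inner ℂ ζ (α i v) =
      inner ℂ ((α i).toContinuousLinearMap.adjoint ζ) v := fun ζ v =>
    (ContinuousLinearMap.adjoint_inner_left (α i).toContinuousLinearMap v ζ).symm
  rw [e2, e2]
  change inner ℂ _ ((T i).adjoint _) = _
  rw [ContinuousLinearMap.adjoint_inner_right]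
  exact (inner_conj_symm _ _).symm

theorem compressOp_add (β : Hil m →ₗᵢ[ℂ] Hil n) (S T : Op n) :
    compressOp β (S + T) = compressOp β S + compressOp β T := by
  ext; simp [compressOp]

theorem compressOp_smul (β : Hil m →ₗᵢ[ℂ] Hil n) (c : ℂ) (T : Op n) :
    compressOp β (c • T) = c • compressOp β T := by
  ext; simp [compressOp]

theorem compressOp_star (β : Hil m →ₗᵢ[ℂ] Hil n) (T : Op n) :
    compressOp β (star T) = star (compressOp β T) := by
  simp only [compressOp, ContinuousLinearMap.star_eq_adjoint, ContinuousLinearMap.adjoint_comp,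
    ContinuousLinearMap.adjoint_adjoint]
  rfl

theorem opNorm_le_of_numericalRadius {H : Type w} [NormedAddCommGroup H] [InnerProductSpace ℂ H]
    (T : H →L[ℂ] H) {C : ℝ} (hC : ∀ η : H, ‖η‖ = 1 → ‖inner ℂ η (T η)‖ ≤ C) (hC0 : 0 ≤ C) :
    ‖T‖ ≤ 2 * C := by
  have hq : ∀ ζ : H, ‖inner ℂ (T ζ) ζ‖ ≤ C * ‖ζ‖ ^ 2 := by
    intro ζ
    rw [norm_inner_symm]
    by_cases h0 : ζ = 0
    · simp [h0]
    have hn : ‖ζ‖ ≠ 0 := norm_ne_zero_iff.2 h0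
    have h1 := hC (((‖ζ‖⁻¹ : ℝ) : ℂ) • ζ) (by simp [norm_smul, hn])
    rw [map_smul, inner_smul_left, inner_smul_right, norm_mul, norm_mul] at h1
    simp only [RCLike.norm_conj, Complex.norm_real, norm_inv, norm_norm] at h1
    rw [← mul_assoc, ← mul_inv, inv_mul_le_iff₀ (by positivity)] at h1
    nlinarith [h1]
  refine T.opNorm_le_bound (by positivity) fun y => ?_
  have key : ∀ x y : H, ‖x‖ = 1 → ‖y‖ = 1 → ‖inner ℂ (T y) x‖ ≤ 2 * C := by
    intro x y hx hy
    have hp := inner_map_polarization T.toLinearMap x y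
    simp only [ContinuousLinearMap.coe_coe] at hp
    have p1 := parallelogram_law_with_norm ℂ x y
    have p2 := parallelogram_law_with_norm ℂ x (Complex.I • y)
    simp only [norm_smul, Complex.norm_I, one_mul, hx, hy] at p1 p2
    have q1 := hq (x + y)
    have q2 := hq (x - y)
    have q3 := hq (x + Complex.I • y)
    have q4 := hq (x - Complex.I • y)
    rw [hp, norm_div]
    have h4 : ‖(4 : ℂ)‖ = 4 := by simp
    rw [h4, div_le_iff₀ (by norm_num)]
    refine (norm_sub_le _ _).trans ?_
    refine (add_le_add ((norm_add_le _ _).trans (add_le_add (norm_sub_le _ _) le_rfl))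
      le_rfl).trans ?_
    simp only [norm_mul, Complex.norm_I, one_mul]
    nlinarith [q1, q2, q3, q4, p1, p2]
  by_cases hy : y = 0
  · simp [hy]
  by_cases hTy : T y = 0
  · rw [hTy, norm_zero]; positivity
  have hn : ‖y‖ ≠ 0 := norm_ne_zero_iff.2 hy
  have hm : ‖T y‖ ≠ 0 := norm_ne_zero_iff.2 hTy
  have h := key (((‖T y‖⁻¹ : ℝ) : ℂ) • T y) (((‖y‖⁻¹ : ℝ) : ℂ) • y) (by simp [norm_smul, hm])
    (by simp [norm_smul, hn])
  rw [map_smul, inner_smul_left, inner_smul_right, inner_self_eq_norm_sq_to_K] at h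
  simp only [norm_mul, RCLike.norm_conj, Complex.norm_real, norm_inv, norm_norm, norm_pow,
    Complex.coe_algebraMap] at h
  have e : ‖y‖⁻¹ * (‖T y‖⁻¹ * ‖T y‖ ^ 2) = ‖y‖⁻¹ * ‖T y‖ := by field_simp
  rw [e, inv_mul_le_iff₀ (by positivity)] at h
  linarith

/-- A unit vector in the one-dimensional Hilbert space. -/
theorem exists_unit_hil_one : ∃ e : Hil (1 : NZCard.{v}), ‖e‖ = 1 ∧
    ∀ w : Hil (1 : NZCard.{v}), ‖(inner ℂ e w : ℂ)‖ = ‖w‖ := by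
  classical
  have hc : Cardinal.mk (1 : NZCard.{v}).Index = 1 := NZCard.mk_index 1
  obtain ⟨⟨hs⟩, ⟨i⟩⟩ := Cardinal.eq_one_iff_unique.1 hc
  have hsingle : ∀ w : Hil (1 : NZCard.{v}), w = lp.single 2 i (w i) := by
    intro w
    ext j
    obtain rfl := hs i j
    simp
  refine ⟨lp.single 2 i 1, by rw [lp.norm_single (by norm_num)]; simp, fun w => ?_⟩
  rw [lp.inner_single_left]
  conv_rhs => rw [hsingle w]
  rw [lp.norm_single (by norm_num)]
  simp

/-- The isometry from the one-dimensional Hilbert space with a given unit vector in its range. -/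
noncomputable def unitIsometry {n : NZCard.{v}} (e : Hil (1 : NZCard.{v}))
    (he : ∀ w : Hil (1 : NZCard.{v}), ‖(inner ℂ e w : ℂ)‖ = ‖w‖) (η : Hil n) (hη : ‖η‖ = 1) :
    Hil (1 : NZCard.{v}) →ₗᵢ[ℂ] Hil n where
  toFun w := (inner ℂ e w : ℂ) • η
  map_add' a b := by rw [inner_add_right, add_smul]
  map_smul' c a := by rw [inner_smul_right, mul_smul]; rfl
  norm_map' w := by
    change ‖(inner ℂ e w : ℂ) • η‖ = ‖w‖
    rw [norm_smul, he, hη, mul_one]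

theorem bounded_of_isContAffineNCFun {E : Type u} [AddCommGroup E] [Module ℂ E] [MatrixNorm E]
    {K : NCSet.{u, v} E} (hK : IsCompactNCConvex K) {f : ∀ n : NZCard.{v}, K n → Op n}
    (hf : IsContAffineNCFun K f) : ∃ C : ℝ, ∀ n x, ‖f n x‖ ≤ C := by
  obtain ⟨e, he1, he⟩ := exists_unit_hil_one.{v}
  let _ : TopologicalSpace (E →ₗ[ℂ] Op (1 : NZCard.{v})) := pointWeakStarTopology E (Hil 1)
  have : CompactSpace (K 1) := isCompact_iff_compactSpace.1 (hK.compact 1)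
  have hc : Continuous fun x : K 1 => (inner ℂ e (f 1 x e) : ℂ) :=
    continuous_inner_of_weakStar (hf.continuous 1) e e
  obtain ⟨C, hC⟩ := isCompact_univ.exists_bound_of_continuousOn hc.continuousOn
  refine ⟨2 * max C 0, fun n x => opNorm_le_of_numericalRadius _ (fun η hη => ?_)
    (le_max_right _ _)⟩
  let β := unitIsometry e he η hη
  let y : K 1 := ⟨compressPoint β x.1, hK.compress_mem _ _ β _ x.2⟩
  have h := hC y (Set.mem_univ _)
  rw [hf.map_compress _ _ β x y rfl] at h
  have hβ : β e = η := by
    change (inner ℂ e e : ℂ) • η = η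
    rw [inner_self_eq_norm_sq_to_K, he1]
    simp
  have h2 : (inner ℂ e (compressOp β (f n x) e) : ℂ) = inner ℂ η (f n x η) := by
    simp only [compressOp, ContinuousLinearMap.comp_apply]
    rw [ContinuousLinearMap.adjoint_inner_right]
    change inner ℂ (β e) (f n x (β e)) = _
    rw [hβ]
  rw [h2] at h
  exact h.trans (le_max_left _ _)

end Basic

/-! ## Pointed continuous affine nc functions -/

section Functions

variable {E : Type u} [AddCommGroup E] [Module ℂ E]

/-- The space `A(K, z)` of continuous affine nc functions on `K` that vanish at `z`. -/
def PointedAff (K : NCSet.{u, v} E) (z : K 1) : Submodule ℂ (∀ n : NZCard.{v}, K n → Op n) where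
  carrier := {f | IsContAffineNCFun K f ∧ f 1 z = 0}
  zero_mem' := by
    refine ⟨⟨fun I n m α x y _ => isOpSum_zero, fun m n β x y _ => by ext; simp [compressOp],
      fun n => ?_⟩, rfl⟩
    let _ := componentTopology K n
    exact @continuous_const _ _ _ (weakStarTopology (Hil n)) 0
  add_mem' := by
    rintro f g ⟨hf, hfz⟩ ⟨hg, hgz⟩
    refine ⟨⟨fun I n m α x y h => isOpSum_add (hf.map_directSum I n m α x y h)
      (hg.map_directSum I n m α x y h), fun m n β x y h => ?_, fun n => ?_⟩, ?_⟩
    · change f m y + g m y = compressOp β (f n x + g n x)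
      rw [hf.map_compress m n β x y h, hg.map_compress m n β x y h, compressOp_add]
    · let _ := componentTopology K n
      exact continuous_weakStar_add (hf.continuous n) (hg.continuous n)
    · change f 1 z + g 1 z = 0
      rw [hfz, hgz, add_zero]
  smul_mem' := by
    rintro c f ⟨hf, hfz⟩
    refine ⟨⟨fun I n m α x y h => isOpSum_smul c (hf.map_directSum I n m α x y h),
      fun m n β x y h => ?_, fun n => ?_⟩, ?_⟩
    · change c • f m y = compressOp β (c • f n x)
      rw [hf.map_compress m n β x y h, compressOp_smul]
    · let _ := componentTopology K n
      exact continuous_weakStar_smul c (hf.continuous n)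
    · change c • f 1 z = 0
      rw [hfz, smul_zero]

variable {K : NCSet.{u, v} E} {z : K 1}

theorem star_mem_pointedAff {f : ∀ n : NZCard.{v}, K n → Op n} (h : f ∈ PointedAff K z) :
    (fun n x => star (f n x)) ∈ PointedAff K z := by
  obtain ⟨hf, hfz⟩ := h
  refine ⟨⟨fun I n m α x y h => isOpSum_star (hf.map_directSum I n m α x y h),
    fun m n β x y h => ?_, fun n => ?_⟩, ?_⟩
  · rw [hf.map_compress m n β x y h, compressOp_star]
  · let _ := componentTopology K n
    exact continuous_weakStar_star (hf.continuous n)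
  · change star (f 1 z) = 0
    rw [hfz, star_zero]

/-- The involution of `A(K, z)`: `f*(x) = f(x)*`. -/
noncomputable instance : StarAddMonoid (PointedAff K z) where
  star f := ⟨fun n x => star (f.1 n x), star_mem_pointedAff f.2⟩
  star_involutive f := by ext1; funext n x; exact star_star _
  star_add f g := by ext1; funext n x; exact star_add _ _

instance : StarModule ℂ (PointedAff K z) where
  star_smul c f := Subtype.ext (funext fun n => funext fun x => star_smul c (f.1 n x))

/-- The value `a(x)` of a matrix of functions, as a matrix of operators. -/
def evalMatrix {k : ℕ} (a : Matrix (Fin k) (Fin k) (PointedAff K z)) {n : NZCard.{v}} (x : K n) :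
    Matrix (Fin k) (Fin k) (Op n) :=
  fun i j => (a i j).1 n x

/-- The matrix norms of `A(K, z)` are the uniform norms. -/
noncomputable instance : MatrixNorm (PointedAff K z) where
  mnorm _ a := ⨆ p : Σ n : NZCard.{v}, K n, ‖opMatrix (evalMatrix a p.2)‖

/-- The positive matrices over `A(K, z)` are those with positive values. -/
instance : MatrixCone (PointedAff K z) where
  cone _ := {a | ∀ (n : NZCard.{v}) (x : K n), (opMatrix (evalMatrix a x)).IsPositive}

/-- The pair `(K, z)` is pointed if every nc quasistate on `A(K, z)` (that is, every ccp map into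
some `M_n`) is evaluation at a point of `K`. -/
def IsPointed (K : NCSet.{u, v} E) (z : K 1) : Prop :=
  ∀ (n : NZCard.{v}) (φ : PointedAff K z →ₗ[ℂ] Op n), IsCCP φ →
    ∃ x : K n, ∀ a : PointedAff K z, φ a = a.1 n x

end Functions

/-- Bundled pointed compact nc convex sets `(K, z)`, over a dual operator space whose distinguished
predual is `E`. -/
structure PoNCConv : Type (max (u + 1) (v + 1)) where
  E : Type u
  [addCommGroup : AddCommGroup E]
  [module : Module ℂ E]
  [matrixNorm : MatrixNorm E]
  isOperatorSpace : IsOperatorSpace E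
  complete : IsMatrixComplete E
  K : NCSet.{u, v} E
  isCompactNCConvex : IsCompactNCConvex K
  z : K 1
  isPointed : IsPointed K z

namespace PoNCConv

attribute [instance] addCommGroup module matrixNorm

/-- Morphisms: pointed continuous affine nc maps. -/
@[ext]
structure Hom (X Y : PoNCConv.{u, v}) : Type (max u (v + 1)) where
  toFun : ∀ n : NZCard.{v}, X.K n → Y.K n
  isContAffineNCMap : IsContAffineNCMap X.K Y.K toFun
  map_point : toFun 1 X.z = Y.z

instance : Category PoNCConv.{u, v} where
  Hom X Y := Hom X Y
  id X := ⟨fun _ x => x, ⟨fun _ _ _ _ _ _ h e => h.sum_eq e, fun _ _ _ _ _ h => h,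
    fun n => @continuous_id _ (componentTopology X.K n)⟩, rfl⟩
  comp {X Y Z} θ ρ := ⟨fun n x => ρ.toFun n (θ.toFun n x), by
    refine ⟨fun I n m α x y h => ?_, fun m n β x y h => ?_, fun n => ?_⟩
    · refine ρ.isContAffineNCMap.map_directSum I n m α (fun i => θ.toFun (m i) (x i))
        (θ.toFun n y) ⟨h.sum_eq_one, θ.isContAffineNCMap.map_directSum I n m α x y h⟩
    · exact ρ.isContAffineNCMap.map_compress m n β _ _
        (θ.isContAffineNCMap.map_compress m n β x y h)
    · exact @Continuous.comp _ _ _ (componentTopology X.K n) (componentTopology Y.K n)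
        (componentTopology Z.K n) _ _ (ρ.isContAffineNCMap.continuous n)
        (θ.isContAffineNCMap.continuous n), by rw [θ.map_point, ρ.map_point]⟩

end PoNCConv

/-! ## The two contravariant functors -/

theorem mnorm_nonneg {E : Type u} [AddCommGroup E] [Module ℂ E] [MatrixNorm E]
    (hE : IsOperatorSpace E) (n : ℕ) (x : Matrix (Fin n) (Fin n) E) :
    0 ≤ MatrixNorm.mnorm n x := by
  have h0 : MatrixNorm.mnorm n (0 : Matrix (Fin n) (Fin n) E) = 0 := by
    simpa using hE.smul_eq n 0 0
  have h1 : MatrixNorm.mnorm n (-x) = MatrixNorm.mnorm n x := by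
    simpa using hE.smul_eq n (-1) x
  have h2 := hE.add_le n x (-x)
  rw [add_neg_cancel, h0, h1] at h2
  linarith

/-- The nc quasistates of `S` (without the base point): the ccp maps from `S` to `M_n`. -/
def quasistates (S : OpSys.{u}) : NCSet.{u, v} S.carrier := fun _ => {φ | IsCCP φ}

/-- The zero map, as a point of the nc quasistate space. -/
noncomputable def zeroQuasistate (S : OpSys.{u}) : quasistates.{u, v} S 1 :=
  ⟨0, by
    have h : ∀ (n : ℕ) (x : Matrix (Fin n) (Fin n) S.carrier),
        opMatrix (x.map (0 : S.carrier →ₗ[ℂ] Op (1 : NZCard.{v}))) = 0 := fun n x => by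
      ext ξ i
      simp [opMatrix_apply]
    refine ⟨fun x => (star_zero _).symm, fun n x => ?_, fun n x _ => ?_⟩
    · change ‖opMatrix (x.map (0 : S.carrier →ₗ[ℂ] Op (1 : NZCard.{v})))‖ ≤ _
      rw [h, norm_zero]
      exact mnorm_nonneg S.isOperatorSystem.toIsOperatorSpace n x
    · change (opMatrix (x.map (0 : S.carrier →ₗ[ℂ] Op (1 : NZCard.{v})))).IsPositive
      rw [h]
      exact ContinuousLinearMap.isPositive_zero⟩

/-- The nc quasistate space `(K, z)` of `S`, as a pointed compact nc convex set. -/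
noncomputable def quasistateSpace (S : OpSys.{u}) (h : IsCompactNCConvex (quasistates.{u, v} S) ∧
    IsPointed (quasistates.{u, v} S) (zeroQuasistate S)) : PoNCConv.{u, v} where
  E := S.carrier
  isOperatorSpace := S.isOperatorSystem.toIsOperatorSpace
  complete := S.isOperatorSystem.complete
  K := quasistates S
  isCompactNCConvex := h.1
  z := zeroQuasistate S
  isPointed := h.2

/-- The space `A(K, z)`, as an operator system. -/
noncomputable def affSystem (X : PoNCConv.{u, v}) (h : IsOperatorSystem (PointedAff X.K X.z)) :
    OpSys.{max u (v + 1)} where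
  carrier := PointedAff X.K X.z
  isOperatorSystem := h

/-- The dual `φ^d : y ↦ y ∘ φ` of a morphism `φ : S ⟶ T` of operator systems. -/
noncomputable def dualQuasistate {S T : OpSys.{u}} (φ : S ⟶ T) (n : NZCard.{v}) (y : quasistates.{u, v} T n) :
    quasistates.{u, v} S n :=
  ⟨y.1 ∘ₗ φ.toLinearMap,
    ⟨fun x => (congrArg y.1 (φ.isCCP.map_star x)).trans (y.2.map_star _),
      fun k x => (y.2.contractive k (x.map φ.toLinearMap)).trans (φ.isCCP.contractive k x),
      fun k x hx => y.2.positive k _ (φ.isCCP.positive k x hx)⟩⟩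

theorem isContAffineNCMap_dualQuasistate {S T : OpSys.{u}} (φ : S ⟶ T) :
    IsContAffineNCMap (quasistates.{u, v} T) (quasistates.{u, v} S) (dualQuasistate φ) := by
  refine ⟨fun I n m α x y h e => h.sum_eq _, fun m n β x y h => ?_, fun n => ?_⟩
  · ext1 e
    exact LinearMap.congr_fun h (φ.toLinearMap e)
  · let t := weakStarTopology (Hil n)
    let _ := pointWeakStarTopology T.carrier (Hil n)
    refine continuous_induced_rng.2 (continuous_induced_rng.2 (continuous_pi fun e => ?_))
    have h : Continuous fun x : T.carrier →ₗ[ℂ] Op n => x (φ.toLinearMap e) :=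
      (continuous_apply (φ.toLinearMap e)).comp continuous_induced_dom
    exact h.comp continuous_subtype_val

/-- The contravariant functor that maps an operator system to its nc quasistate space and a
morphism `φ : S ⟶ T` to `φ^d : y ↦ y ∘ φ`. -/
noncomputable def quasistateFunctor (h : ∀ S : OpSys.{u},
    IsCompactNCConvex (quasistates.{u, v} S) ∧
      IsPointed (quasistates.{u, v} S) (zeroQuasistate S)) :
    OpSys.{u}ᵒᵖ ⥤ PoNCConv.{u, v} where
  obj S := quasistateSpace S.unop (h S.unop)
  map φ := ⟨dualQuasistate φ.unop, isContAffineNCMap_dualQuasistate φ.unop, rfl⟩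

/-- The dual `ψ^d : a ↦ a ∘ ψ` of a morphism `ψ : Y ⟶ X` of pointed compact nc convex sets. -/
noncomputable def dualAff {X Y : PoNCConv.{u, v}} (ψ : Y ⟶ X) :
    PointedAff X.K X.z →ₗ[ℂ] PointedAff Y.K Y.z where
  toFun a := ⟨fun n y => a.1 n (ψ.toFun n y),
    ⟨⟨fun I n m α x y h => a.2.1.map_directSum I n m α (fun i => ψ.toFun (m i) (x i)) _
        ⟨h.sum_eq_one, ψ.isContAffineNCMap.map_directSum I n m α x y h⟩,
      fun m n β x y h => a.2.1.map_compress m n β _ _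
        (ψ.isContAffineNCMap.map_compress m n β x y h),
      fun n => @Continuous.comp _ _ _ (componentTopology Y.K n) (componentTopology X.K n)
        (weakStarTopology (Hil n)) _ _ (a.2.1.continuous n) (ψ.isContAffineNCMap.continuous n)⟩,
      (congrArg (a.1 1) ψ.map_point).trans a.2.2⟩⟩
  map_add' _ _ := rfl
  map_smul' _ _ := rfl

theorem isCCP_dualAff {X Y : PoNCConv.{u, v}} (ψ : Y ⟶ X) : IsCCP (dualAff ψ) := by
  refine ⟨fun _ => rfl, fun k a => ?_, fun k a ha n y => ha n (ψ.toFun n y)⟩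
  refine Real.iSup_le (fun p => ?_) (Real.iSup_nonneg fun _ => norm_nonneg _)
  choose C hC using fun i j => bounded_of_isContAffineNCFun X.isCompactNCConvex (a i j).2.1
  have hb : BddAbove (Set.range fun q : Σ n : NZCard.{v}, X.K n =>
      ‖opMatrix (evalMatrix a q.2)‖) := by
    refine ⟨∑ i, ∑ j, C i j, ?_⟩
    rintro _ ⟨q, rfl⟩
    exact (norm_opMatrix_le _).trans
      (Finset.sum_le_sum fun i _ => Finset.sum_le_sum fun j _ => hC i j q.1 q.2)
  exact le_ciSup hb ⟨p.1, ψ.toFun p.1 p.2⟩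

/-- The contravariant functor that maps a pointed compact nc convex set `(K, z)` to `A(K, z)` and
a morphism `ψ` to `ψ^d : a ↦ a ∘ ψ`. -/
noncomputable def affFunctor
    (h : ∀ X : PoNCConv.{u, v}, IsOperatorSystem (PointedAff X.K X.z)) :
    PoNCConv.{u, v}ᵒᵖ ⥤ OpSys.{max u (v + 1)} where
  obj X := affSystem X.unop (h X.unop)
  map ψ := ⟨dualAff ψ.unop, isCCP_dualAff ψ.unop⟩

/-! An operator system has enough quasistates to recover its norm and order, and the only continuous
affine nc functions on them vanishing at `0` are the elements of the system.

Enough quasistates. Unravelling the partial unitization, the inclusion of `S` is completely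
isometric exactly when the ccp maps into `M_{2n}` determine the norm of `M_n(S)`
(`block_mem_sharpCone_iff`). Ccp maps also detect the order. Hahn–Banach separates a self-adjoint
matrix from the closed cone (`exists_positive_functional`), and the map `S → M_k` attached to the
separating functional on `M_k(S)` is ccp by Ruan's axioms (`isCCP_mapOfFunctional`). Hence `s ↦ ŝ`
is completely isometric and a complete order embedding.

No other functions (`hatMap_surjective`). Compressions to dimension one turn vector states into
points of `K_1`, so a function in `A(K, 0)` is determined by `K_1`. Over this compact convex set,
the graph of the real part of the function and its translate by `ε` can be separated. The separating
functional is, up to scaling, a function `Re ŝ` with error at most `ε`, and no constant appears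
because both sides vanish at `0` (`exists_approx_re`). The numerical radius controls the norm up to
a factor 2, so the approximants form a Cauchy sequence in `S`, and completeness yields an exact
representative. Surjectivity also makes the quasistate space pointed, since a ccp map on `A(K, 0)`
pulls back to a quasistate of `S`. Compactness of each level is a Banach–Alaoglu argument
(`isCompact_setOf_isCCP`).

For `A(K, z)` the algebraic and order axioms hold pointwise. The inclusion into the partial
unitization is isometric because a matrix coefficient of `a(x)` between two columns of length `k`
involves only `2k` vectors, so compressions of evaluations to dimension `2k` already give the norm
(`norm_opMatrix_le_of_compressions`). The map from `K` to the quasistates of `A(K, z)` is onto by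
pointedness. It is injective, with affine continuous inverse, because every coordinate `x ↦ x(e)`
lies in `A(K, z)` up to a scalar (`exists_coordinate_function`). -/

set_option linter.unusedSectionVars false

/-! ### Positivity and norms read off from inner products -/

section InnerProduct

variable {H : Type w} [NormedAddCommGroup H] [InnerProductSpace ℂ H]

theorem isPositive_iff_inner_nonneg (T : H →L[ℂ] H) :
    T.IsPositive ↔ ∀ ξ, 0 ≤ (inner ℂ ξ (T ξ) : ℂ) := by
  refine ⟨fun h ξ => h.inner_nonneg_right ξ, fun h => ?_⟩
  rw [ContinuousLinearMap.isPositive_iff_complex]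
  intro ξ
  have h1 := h ξ
  rw [← inner_conj_symm, Complex.nonneg_iff] at h1
  simp only [Complex.conj_re, Complex.conj_im] at h1
  refine ⟨?_, h1.1⟩
  apply Complex.ext
  · simp
  · simp only [RCLike.re_eq_complex_re, Complex.ofReal_im]
    linarith [h1.2]

theorem opNorm_le_of_inner_le (T : H →L[ℂ] H) {C : ℝ} (hC : 0 ≤ C)
    (h : ∀ ξ η, ‖(inner ℂ ξ (T η) : ℂ)‖ ≤ C * ‖ξ‖ * ‖η‖) : ‖T‖ ≤ C := by
  refine ContinuousLinearMap.opNorm_le_of_re_inner_le hC fun x y hx hy => ?_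
  have h1 := h y x
  rw [hx, hy, norm_inner_symm] at h1
  refine (RCLike.re_le_norm _).trans (by simpa using h1)

theorem norm_inner_apply_le (T : H →L[ℂ] H) (ξ η : H) :
    ‖(inner ℂ ξ (T η) : ℂ)‖ ≤ ‖T‖ * ‖ξ‖ * ‖η‖ := by
  refine (norm_inner_le_norm _ _).trans ?_
  have := mul_le_mul_of_nonneg_left (T.le_opNorm η) (norm_nonneg ξ)
  linarith

end InnerProduct

/-! ### Matrices of operators and the action of scalar matrices on columns -/

section OpMatrix

variable {H : Type w} [NormedAddCommGroup H] [InnerProductSpace ℂ H]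
variable {k m n : ℕ}

theorem inner_opMatrix (A : Matrix (Fin k) (Fin k) (H →L[ℂ] H))
    (ξ η : PiLp 2 (fun _ : Fin k => H)) :
    (inner ℂ ξ (opMatrix A η) : ℂ) = ∑ i, ∑ j, inner ℂ (ξ i) (A i j (η j)) := by
  simp [PiLp.inner_apply, opMatrix_apply, inner_sum]

theorem opMatrix_add (A B : Matrix (Fin k) (Fin k) (H →L[ℂ] H)) :
    opMatrix (A + B) = opMatrix A + opMatrix B := by
  ext ξ i
  simp [opMatrix_apply, Finset.sum_add_distrib]

theorem opMatrix_smul (c : ℂ) (A : Matrix (Fin k) (Fin k) (H →L[ℂ] H)) :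
    opMatrix (c • A) = c • opMatrix A := by
  ext ξ i
  simp [opMatrix_apply, Finset.smul_sum]

theorem opMatrix_zero : opMatrix (0 : Matrix (Fin k) (Fin k) (H →L[ℂ] H)) = 0 := by
  ext ξ i
  simp [opMatrix_apply]

theorem opMatrix_neg (A : Matrix (Fin k) (Fin k) (H →L[ℂ] H)) :
    opMatrix (-A) = -opMatrix A := by
  ext ξ i
  simp [opMatrix_apply]

theorem opMatrix_sub (A B : Matrix (Fin k) (Fin k) (H →L[ℂ] H)) :
    opMatrix (A - B) = opMatrix A - opMatrix B := by
  rw [sub_eq_add_neg, opMatrix_add, opMatrix_neg, sub_eq_add_neg]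

theorem opMatrix_single_apply (A : Matrix (Fin k) (Fin k) (H →L[ℂ] H)) (i j : Fin k) (η : H) :
    opMatrix A (PiLp.single 2 j η) i = A i j η := by
  rw [opMatrix_apply, Finset.sum_eq_single j]
  · simp
  · intro b _ hb
    simp [hb]
  · simp

theorem opMatrix_injective {A B : Matrix (Fin k) (Fin k) (H →L[ℂ] H)}
    (h : opMatrix A = opMatrix B) : A = B := by
  ext i j η
  rw [← opMatrix_single_apply, h, opMatrix_single_apply]

theorem norm_apply_le_norm_opMatrix (A : Matrix (Fin k) (Fin k) (H →L[ℂ] H)) (i j : Fin k) :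
    ‖A i j‖ ≤ ‖opMatrix A‖ := by
  refine ContinuousLinearMap.opNorm_le_bound _ (ContinuousLinearMap.opNorm_nonneg _) fun η => ?_
  rw [← opMatrix_single_apply]
  refine (PiLp.norm_apply_le _ i).trans (((opMatrix A).le_opNorm _).trans ?_)
  rw [PiLp.norm_single]

theorem norm_opMatrix_one (T : H →L[ℂ] H) :
    ‖opMatrix (fun _ _ => T : Matrix (Fin 1) (Fin 1) (H →L[ℂ] H))‖ = ‖T‖ := by
  refine le_antisymm ?_ (norm_apply_le_norm_opMatrix
    (fun _ _ => T : Matrix (Fin 1) (Fin 1) (H →L[ℂ] H)) 0 0)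
  exact (norm_opMatrix_le _).trans (by simp)

theorem opMatrix_conjTranspose [CompleteSpace H] (A : Matrix (Fin k) (Fin k) (H →L[ℂ] H)) :
    opMatrix A.conjTranspose = (opMatrix A).adjoint := by
  rw [ContinuousLinearMap.eq_adjoint_iff]
  intro ξ η
  rw [inner_opMatrix, PiLp.inner_apply]
  simp only [opMatrix_apply, sum_inner, Matrix.conjTranspose_apply,
    ContinuousLinearMap.star_eq_adjoint, ContinuousLinearMap.adjoint_inner_left]
  exact Finset.sum_comm

/-- The action of a scalar matrix on columns of vectors. -/
noncomputable def ampl (H : Type w) [NormedAddCommGroup H] [InnerProductSpace ℂ H]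
    (α : Matrix (Fin m) (Fin n) ℂ) :
    PiLp 2 (fun _ : Fin n => H) →L[ℂ] PiLp 2 (fun _ : Fin m => H) :=
  (PiLp.continuousLinearEquiv 2 ℂ (fun _ : Fin m => H)).symm.toContinuousLinearMap ∘L
    (ContinuousLinearMap.pi fun i =>
      ∑ j, α i j • (ContinuousLinearMap.proj (R := ℂ) (φ := fun _ : Fin n => H) j)) ∘L
    (PiLp.continuousLinearEquiv 2 ℂ (fun _ : Fin n => H)).toContinuousLinearMap

theorem ampl_apply (α : Matrix (Fin m) (Fin n) ℂ) (ξ : PiLp 2 (fun _ : Fin n => H)) (i : Fin m) :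
    ampl H α ξ i = ∑ j, α i j • ξ j := by
  simp [ampl]

theorem inner_ampl_left (α : Matrix (Fin m) (Fin n) ℂ) (ξ : PiLp 2 (fun _ : Fin n => H))
    (η : PiLp 2 (fun _ : Fin m => H)) :
    (inner ℂ (ampl H α ξ) η : ℂ) = inner ℂ ξ (ampl H α.conjTranspose η) := by
  simp only [PiLp.inner_apply, ampl_apply, sum_inner, inner_sum, inner_smul_left, inner_smul_right,
    Matrix.conjTranspose_apply]
  exact Finset.sum_comm

theorem ampl_mul {p : ℕ} (α : Matrix (Fin m) (Fin n) ℂ) (β : Matrix (Fin n) (Fin p) ℂ)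
    (ξ : PiLp 2 (fun _ : Fin p => H)) : ampl H (α * β) ξ = ampl H α (ampl H β ξ) := by
  ext i
  simp only [ampl_apply, Matrix.mul_apply, Finset.sum_smul, Finset.smul_sum, mul_smul]
  exact Finset.sum_comm

theorem opMatrix_scalarConj (α : Matrix (Fin m) (Fin n) ℂ)
    (A : Matrix (Fin n) (Fin n) (H →L[ℂ] H)) (β : Matrix (Fin n) (Fin m) ℂ)
    (ξ : PiLp 2 (fun _ : Fin m => H)) :
    opMatrix (scalarConj α A β) ξ = ampl H α (opMatrix A (ampl H β ξ)) := by
  ext i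
  simp only [ampl_apply, opMatrix_apply, scalarConj, _root_.sum_apply,
    _root_.smul_apply, map_sum, map_smul, Finset.smul_sum, mul_smul]
  rw [Finset.sum_comm]
  refine Finset.sum_congr rfl fun k _ => ?_
  rw [Finset.sum_comm]

open scoped Matrix.Norms.L2Operator MatrixOrder in
-- Positivity of the scalar matrix `‖α‖² - α* α` is an algebraic certificate that survives the
-- passage from scalar columns to columns over `H`: a factorization `B* B` of it writes `‖α‖² ‖ξ‖² -
-- ‖α ξ‖²` as `‖B ξ‖²`.
theorem norm_ampl_apply_le (α : Matrix (Fin m) (Fin n) ℂ) (ξ : PiLp 2 (fun _ : Fin n => H)) :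
    ‖ampl H α ξ‖ ≤ ‖α‖ * ‖ξ‖ := by
  have hpos : (((‖α‖ ^ 2 : ℝ) : ℂ) • (1 : Matrix (Fin n) (Fin n) ℂ) -
      α.conjTranspose * α).PosSemidef := by
    refine Matrix.PosSemidef.of_dotProduct_mulVec_nonneg ?_ fun x => ?_
    · refine Matrix.IsHermitian.sub ?_ (Matrix.isHermitian_conjTranspose_mul_self α)
      rw [Matrix.IsHermitian, Matrix.conjTranspose_smul]
      simp
    · have h := Matrix.l2_opNorm_mulVec α (WithLp.toLp 2 x)
      have e1 : star x ⬝ᵥ x = ((‖WithLp.toLp 2 x‖ ^ 2 : ℝ) : ℂ) := by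
        rw [EuclideanSpace.norm_sq_eq]
        simp [dotProduct, Complex.conj_mul']
      have e2 : star x ⬝ᵥ (α.conjTranspose * α).mulVec x =
          ((‖WithLp.toLp 2 (α.mulVec x)‖ ^ 2 : ℝ) : ℂ) := by
        rw [← Matrix.mulVec_mulVec, Matrix.dotProduct_mulVec, ← Matrix.star_mulVec,
          EuclideanSpace.norm_sq_eq]
        simp [dotProduct, Complex.conj_mul']
      rw [Matrix.sub_mulVec, Matrix.smul_mulVec, Matrix.one_mulVec, dotProduct_sub,
        dotProduct_smul, e1, e2, smul_eq_mul, ← Complex.ofReal_mul, ← Complex.ofReal_sub,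
        Complex.zero_le_real, sub_nonneg, ← mul_pow]
      exact pow_le_pow_left₀ (norm_nonneg _) h 2
  obtain ⟨B, hB⟩ := CStarAlgebra.nonneg_iff_eq_star_mul_self.1 hpos.nonneg
  have key : (inner ℂ (ampl H B ξ) (ampl H B ξ) : ℂ) =
      ((‖α‖ ^ 2 : ℝ) : ℂ) * inner ℂ ξ ξ - inner ℂ (ampl H α ξ) (ampl H α ξ) := by
    rw [inner_ampl_left, inner_ampl_left, ← ampl_mul, ← ampl_mul]
    change inner ℂ ξ (ampl H (star B * B) ξ) = _
    rw [← hB, ← inner_smul_right, ← inner_sub_right]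
    congr 1
    ext i
    simp only [ampl_apply, PiLp.sub_apply, PiLp.smul_apply, Matrix.sub_apply, Matrix.smul_apply, sub_smul,
      Finset.sum_sub_distrib, smul_assoc, ← Finset.smul_sum]
    simp [Matrix.one_apply]
  simp only [inner_self_eq_norm_sq_to_K] at key
  have key2 : ‖ampl H B ξ‖ ^ 2 = ‖α‖ ^ 2 * ‖ξ‖ ^ 2 - ‖ampl H α ξ‖ ^ 2 := by
    refine Complex.ofReal_injective ?_
    push_cast
    simpa using key
  have h3 := sq_nonneg ‖ampl H B ξ‖
  refine le_of_sq_le_sq ?_ (by positivity)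
  rw [mul_pow]; linarith

open scoped Matrix.Norms.L2Operator in
theorem norm_opMatrix_scalarConj_le (α : Matrix (Fin m) (Fin n) ℂ)
    (A : Matrix (Fin n) (Fin n) (H →L[ℂ] H)) (β : Matrix (Fin n) (Fin m) ℂ) :
    ‖opMatrix (scalarConj α A β)‖ ≤ ‖α‖ * ‖opMatrix A‖ * ‖β‖ := by
  refine ContinuousLinearMap.opNorm_le_bound _ (by positivity) fun ξ => ?_
  rw [opMatrix_scalarConj]
  refine (norm_ampl_apply_le _ _).trans ?_
  rw [mul_assoc, mul_assoc]
  refine mul_le_mul_of_nonneg_left (((opMatrix A).le_opNorm _).trans ?_) (norm_nonneg _)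
  exact mul_le_mul_of_nonneg_left (norm_ampl_apply_le _ _) (norm_nonneg _)

theorem inner_opMatrix_scalarConj (α : Matrix (Fin m) (Fin n) ℂ)
    (A : Matrix (Fin n) (Fin n) (H →L[ℂ] H)) (ξ η : PiLp 2 (fun _ : Fin m => H)) :
    (inner ℂ ξ (opMatrix (scalarConj α A α.conjTranspose) η) : ℂ) =
      inner ℂ (ampl H α.conjTranspose ξ) (opMatrix A (ampl H α.conjTranspose η)) := by
  rw [opMatrix_scalarConj, inner_ampl_left, Matrix.conjTranspose_conjTranspose]

theorem isPositive_opMatrix_scalarConj (α : Matrix (Fin m) (Fin n) ℂ)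
    {A : Matrix (Fin n) (Fin n) (H →L[ℂ] H)} (hA : (opMatrix A).IsPositive) :
    (opMatrix (scalarConj α A α.conjTranspose)).IsPositive := by
  rw [isPositive_iff_inner_nonneg] at hA ⊢
  intro ξ
  rw [inner_opMatrix_scalarConj]
  exact hA _

/-! ### Block vectors -/

/-- The upper part of a column. -/
noncomputable def upperPart (ζ : PiLp 2 (fun _ : Fin (m + n) => H)) : PiLp 2 (fun _ : Fin m => H) :=
  WithLp.toLp 2 fun i => ζ (Fin.castAdd n i)

/-- The lower part of a column. -/
noncomputable def lowerPart (ζ : PiLp 2 (fun _ : Fin (m + n) => H)) : PiLp 2 (fun _ : Fin n => H) :=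
  WithLp.toLp 2 fun i => ζ (Fin.natAdd m i)

/-- The column with given upper and lower part. -/
noncomputable def stack (ξ : PiLp 2 (fun _ : Fin m => H)) (η : PiLp 2 (fun _ : Fin n => H)) :
    PiLp 2 (fun _ : Fin (m + n) => H) :=
  WithLp.toLp 2 (Fin.append (fun i => ξ i) (fun i => η i))

@[simp] theorem upperPart_apply (ζ : PiLp 2 (fun _ : Fin (m + n) => H)) (i : Fin m) :
    upperPart ζ i = ζ (Fin.castAdd n i) := rfl

@[simp] theorem lowerPart_apply (ζ : PiLp 2 (fun _ : Fin (m + n) => H)) (i : Fin n) :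
    lowerPart ζ i = ζ (Fin.natAdd m i) := rfl

@[simp] theorem upperPart_stack (ξ : PiLp 2 (fun _ : Fin m => H))
    (η : PiLp 2 (fun _ : Fin n => H)) : upperPart (stack ξ η) = ξ := by
  ext i; simp [stack]

@[simp] theorem lowerPart_stack (ξ : PiLp 2 (fun _ : Fin m => H))
    (η : PiLp 2 (fun _ : Fin n => H)) : lowerPart (stack ξ η) = η := by
  ext i; simp [stack]

theorem norm_sq_eq_upper_add_lower (ζ : PiLp 2 (fun _ : Fin (m + n) => H)) :
    ‖ζ‖ ^ 2 = ‖upperPart ζ‖ ^ 2 + ‖lowerPart ζ‖ ^ 2 := by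
  simp [PiLp.norm_sq_eq_of_L2, Fin.sum_univ_add]

section Block

variable {E : Type w} (a : Matrix (Fin m) (Fin m) E) (b : Matrix (Fin m) (Fin n) E)
  (c : Matrix (Fin n) (Fin m) E) (d : Matrix (Fin n) (Fin n) E)

@[simp] theorem blockMatrix_upper_upper (i j : Fin m) :
    blockMatrix a b c d (Fin.castAdd n i) (Fin.castAdd n j) = a i j := by
  simp [blockMatrix]

@[simp] theorem blockMatrix_upper_lower (i : Fin m) (j : Fin n) :
    blockMatrix a b c d (Fin.castAdd n i) (Fin.natAdd m j) = b i j := by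
  simp [blockMatrix]

@[simp] theorem blockMatrix_lower_upper (i : Fin n) (j : Fin m) :
    blockMatrix a b c d (Fin.natAdd m i) (Fin.castAdd n j) = c i j := by
  simp [blockMatrix]

@[simp] theorem blockMatrix_lower_lower (i j : Fin n) :
    blockMatrix a b c d (Fin.natAdd m i) (Fin.natAdd m j) = d i j := by
  simp [blockMatrix]

theorem blockMatrix_map {F : Type*} (f : E → F) :
    (blockMatrix a b c d).map f = blockMatrix (a.map f) (b.map f) (c.map f) (d.map f) := by
  simp only [blockMatrix, Matrix.reindex_apply, ← Matrix.submatrix_map, Matrix.fromBlocks_map]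

end Block

theorem inner_opMatrix_blockMatrix (a b c d : Matrix (Fin n) (Fin n) (H →L[ℂ] H))
    (ζ ω : PiLp 2 (fun _ : Fin (n + n) => H)) :
    (inner ℂ ζ (opMatrix (blockMatrix a b c d) ω) : ℂ) =
      inner ℂ (upperPart ζ) (opMatrix a (upperPart ω)) +
      inner ℂ (upperPart ζ) (opMatrix b (lowerPart ω)) +
      inner ℂ (lowerPart ζ) (opMatrix c (upperPart ω)) +
      inner ℂ (lowerPart ζ) (opMatrix d (lowerPart ω)) := by
  simp only [inner_opMatrix, Fin.sum_univ_add, blockMatrix_upper_upper, blockMatrix_upper_lower,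
    blockMatrix_lower_upper, blockMatrix_lower_lower, upperPart_apply, lowerPart_apply,
    Finset.sum_add_distrib]
  ring

theorem norm_opMatrix_blockDiagonal (a : Matrix (Fin m) (Fin m) (H →L[ℂ] H))
    (d : Matrix (Fin n) (Fin n) (H →L[ℂ] H)) :
    ‖opMatrix (blockMatrix a 0 0 d)‖ = max ‖opMatrix a‖ ‖opMatrix d‖ := by
  have hu : ∀ ζ, upperPart (opMatrix (blockMatrix a 0 0 d) ζ) = opMatrix a (upperPart ζ) := by
    intro ζ
    ext i
    simp [opMatrix_apply, Fin.sum_univ_add]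
  have hl : ∀ ζ, lowerPart (opMatrix (blockMatrix a 0 0 d) ζ) = opMatrix d (lowerPart ζ) := by
    intro ζ
    ext i
    simp [opMatrix_apply, Fin.sum_univ_add]
  refine le_antisymm ?_ (max_le ?_ ?_)
  · refine ContinuousLinearMap.opNorm_le_bound _ (le_max_of_le_left (ContinuousLinearMap.opNorm_nonneg _)) fun ζ => ?_
    refine le_of_sq_le_sq ?_ (mul_nonneg
      (le_max_of_le_left (ContinuousLinearMap.opNorm_nonneg _)) (norm_nonneg _))
    rw [mul_pow, norm_sq_eq_upper_add_lower, hu, hl, norm_sq_eq_upper_add_lower ζ, mul_add,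
      ← mul_pow, ← mul_pow]
    gcongr
    · exact ((opMatrix a).le_opNorm _).trans
        (mul_le_mul_of_nonneg_right (le_max_left _ _) (norm_nonneg _))
    · exact ((opMatrix d).le_opNorm _).trans
        (mul_le_mul_of_nonneg_right (le_max_right _ _) (norm_nonneg _))
  · refine ContinuousLinearMap.opNorm_le_bound _ (ContinuousLinearMap.opNorm_nonneg _) fun ξ => ?_
    have h := (opMatrix (blockMatrix a 0 0 d)).le_opNorm (stack ξ 0)
    have h1 : ‖stack ξ (0 : PiLp 2 (fun _ : Fin n => H))‖ = ‖ξ‖ := by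
      rw [← sq_eq_sq₀ (norm_nonneg _) (norm_nonneg _), norm_sq_eq_upper_add_lower]
      simp
    have h2 : ‖opMatrix a ξ‖ ≤ ‖opMatrix (blockMatrix a 0 0 d) (stack ξ 0)‖ := by
      refine le_of_sq_le_sq ?_ (norm_nonneg _)
      rw [norm_sq_eq_upper_add_lower (opMatrix _ _), hu, hl]
      simp
    rw [h1] at h
    exact h2.trans h
  · refine ContinuousLinearMap.opNorm_le_bound _ (ContinuousLinearMap.opNorm_nonneg _) fun ξ => ?_
    have h := (opMatrix (blockMatrix a 0 0 d)).le_opNorm (stack 0 ξ)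
    have h1 : ‖stack (0 : PiLp 2 (fun _ : Fin m => H)) ξ‖ = ‖ξ‖ := by
      rw [← sq_eq_sq₀ (norm_nonneg _) (norm_nonneg _), norm_sq_eq_upper_add_lower]
      simp
    have h2 : ‖opMatrix d ξ‖ ≤ ‖opMatrix (blockMatrix a 0 0 d) (stack 0 ξ)‖ := by
      refine le_of_sq_le_sq ?_ (norm_nonneg _)
      rw [norm_sq_eq_upper_add_lower (opMatrix _ _), hu, hl]
      simp
    rw [h1] at h
    exact h2.trans h

end OpMatrix

/-! ### Compressions -/

section Compress

variable {H : Type w} [NormedAddCommGroup H] [InnerProductSpace ℂ H] [CompleteSpace H]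
variable {L : Type v} [NormedAddCommGroup L] [InnerProductSpace ℂ L] [CompleteSpace L]
variable {k : ℕ}

/-- The diagonal action of an operator on columns. -/
noncomputable def diagOp (k : ℕ) (V : L →L[ℂ] H) :
    PiLp 2 (fun _ : Fin k => L) → PiLp 2 (fun _ : Fin k => H) :=
  fun ξ => WithLp.toLp 2 fun i => V (ξ i)

@[simp] theorem diagOp_apply (V : L →L[ℂ] H) (ξ : PiLp 2 (fun _ : Fin k => L)) (i : Fin k) :
    diagOp k V ξ i = V (ξ i) := rfl

theorem norm_diagOp_le {V : L →L[ℂ] H} (hV : ‖V‖ ≤ 1) (ξ : PiLp 2 (fun _ : Fin k => L)) :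
    ‖diagOp k V ξ‖ ≤ ‖ξ‖ := by
  refine le_of_sq_le_sq ?_ (norm_nonneg _)
  rw [PiLp.norm_sq_eq_of_L2, PiLp.norm_sq_eq_of_L2]
  gcongr with i
  exact (V.le_opNorm _).trans (mul_le_of_le_one_left (norm_nonneg _) hV)

theorem inner_opMatrix_compress (V : L →L[ℂ] H) (A : Matrix (Fin k) (Fin k) (H →L[ℂ] H))
    (ξ η : PiLp 2 (fun _ : Fin k => L)) :
    (inner ℂ ξ (opMatrix (A.map fun T => V.adjoint ∘L T ∘L V) η) : ℂ) =
      inner ℂ (diagOp k V ξ) (opMatrix A (diagOp k V η)) := by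
  simp [inner_opMatrix, ContinuousLinearMap.adjoint_inner_right]

variable {E : Type u} [AddCommGroup E] [Module ℂ E]

/-- The compression `V* φ V` of an operator valued linear map. -/
noncomputable def compressMap (V : L →L[ℂ] H) (φ : E →ₗ[ℂ] (H →L[ℂ] H)) : E →ₗ[ℂ] (L →L[ℂ] L) where
  toFun e := V.adjoint ∘L φ e ∘L V
  map_add' a b := by ext; simp
  map_smul' c a := by ext; simp

theorem inner_compressMap (V : L →L[ℂ] H) (φ : E →ₗ[ℂ] (H →L[ℂ] H)) (e : E) (ξ η : L) :
    (inner ℂ ξ (compressMap V φ e η) : ℂ) = inner ℂ (V ξ) (φ e (V η)) := by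
  simp [compressMap, ContinuousLinearMap.adjoint_inner_right]

theorem inner_opMatrix_compressMap (V : L →L[ℂ] H) (φ : E →ₗ[ℂ] (H →L[ℂ] H))
    (x : Matrix (Fin k) (Fin k) E) (ξ η : PiLp 2 (fun _ : Fin k => L)) :
    (inner ℂ ξ (opMatrix (x.map (compressMap V φ)) η) : ℂ) =
      inner ℂ (diagOp k V ξ) (opMatrix (x.map φ) (diagOp k V η)) := by
  rw [← inner_opMatrix_compress]
  rfl

theorem norm_opMatrix_compressMap_le {V : L →L[ℂ] H} (hV : ‖V‖ ≤ 1) (φ : E →ₗ[ℂ] (H →L[ℂ] H))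
    (x : Matrix (Fin k) (Fin k) E) :
    ‖opMatrix (x.map (compressMap V φ))‖ ≤ ‖opMatrix (x.map φ)‖ := by
  refine opNorm_le_of_inner_le _ (norm_nonneg _) fun ξ η => ?_
  rw [inner_opMatrix_compressMap]
  refine (norm_inner_apply_le _ _ _).trans ?_
  gcongr <;> exact norm_diagOp_le hV _

/-- Quasistates need not be unital, so any contraction `V` is allowed here, not only an isometry.
This makes it possible to compress by adjoints of isometries, which is how maps into `M_k` are moved
to larger spaces. -/
theorem IsCCP.compressMap [Star E] [MatrixNorm E] [MatrixCone E] {V : L →L[ℂ] H} (hV : ‖V‖ ≤ 1)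
    {φ : E →ₗ[ℂ] (H →L[ℂ] H)} (hφ : IsCCP φ) : IsCCP (compressMap V φ) where
  map_star x := by
    change V.adjoint ∘L φ (star x) ∘L V = ContinuousLinearMap.adjoint (V.adjoint ∘L φ x ∘L V)
    rw [hφ.map_star, ContinuousLinearMap.adjoint_comp, ContinuousLinearMap.adjoint_comp,
      ContinuousLinearMap.adjoint_adjoint]
    rfl
  contractive n x := (norm_opMatrix_compressMap_le hV φ x).trans (hφ.contractive n x)
  positive n x hx := by
    have h := (isPositive_iff_inner_nonneg _).1 (hφ.positive n x hx)
    refine (isPositive_iff_inner_nonneg _).2 fun ξ => ?_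
    rw [inner_opMatrix_compressMap]
    exact h _

end Compress

theorem inner_self_eq_ofReal {H : Type w} [NormedAddCommGroup H] [InnerProductSpace ℂ H] (ξ : H) :
    (inner ℂ ξ ξ : ℂ) = ((‖ξ‖ ^ 2 : ℝ) : ℂ) := by
  rw [inner_self_eq_norm_sq_to_K]
  simp

/-! ### Isometries and contractions from finite dimensional spaces -/

section Isometries

variable {H : Type w} [NormedAddCommGroup H] [InnerProductSpace ℂ H] [CompleteSpace H]
variable {L : Type v} [NormedAddCommGroup L] [InnerProductSpace ℂ L] [CompleteSpace L]

theorem adjoint_isometry_apply (α : L →ₗᵢ[ℂ] H) (v : L) :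
    α.toContinuousLinearMap.adjoint (α v) = v := by
  refine ext_inner_left ℂ fun w => ?_
  rw [ContinuousLinearMap.adjoint_inner_right]
  exact α.inner_map_map w v

theorem norm_isometry_le (α : L →ₗᵢ[ℂ] H) : ‖α.toContinuousLinearMap‖ ≤ 1 :=
  α.norm_toContinuousLinearMap_le

theorem norm_adjoint_isometry_le (α : L →ₗᵢ[ℂ] H) : ‖α.toContinuousLinearMap.adjoint‖ ≤ 1 := by
  rw [LinearIsometryEquiv.norm_map]
  exact norm_isometry_le α

theorem exists_isometry_of_orthonormal {d : ℕ} {v : Fin d → H} (hv : Orthonormal ℂ v) :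
    ∃ J : EuclideanSpace ℂ (Fin d) →ₗᵢ[ℂ] H, ∀ x, J x = ∑ i, x i • v i := by
  let b := (EuclideanSpace.basisFun (Fin d) ℂ)
  let f : EuclideanSpace ℂ (Fin d) →ₗ[ℂ] H := b.toBasis.constr ℂ v
  refine ⟨f.isometryOfOrthonormal (v := b.toBasis) (by simp) ?_, fun x => ?_⟩
  · convert hv using 1
    funext i
    exact Module.Basis.constr_basis _ _ _ _
  · change f x = _
    rw [Module.Basis.constr_apply_fintype]
    simp [b]

/-- Finitely many vectors of a Hilbert space lie in the range of a contraction from a finite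
dimensional space. -/
theorem exists_contraction_covering {d : ℕ} (u : Fin d → H) :
    ∃ V : EuclideanSpace ℂ (Fin d) →L[ℂ] H, ‖V‖ ≤ 1 ∧ ∀ i, ∃ x, V x = u i ∧ ‖x‖ = ‖u i‖ := by
  let W := Submodule.span ℂ (Set.range u)
  have hfin : FiniteDimensional ℂ W := FiniteDimensional.span_of_finite ℂ (Set.finite_range u)
  have hr : Module.finrank ℂ W ≤ d := by
    have h := finrank_range_le_card (R := ℂ) u
    rwa [Fintype.card_fin] at h
  -- The span may have dimension `r < d`. With `U` mapping `ℂ^r` isometrically onto the span and `J`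
  -- embedding `ℂ^r` in `ℂ^d`, the contraction is `U J*`; preimages chosen in the range of `J` keep
  -- their norm.
  let b := stdOrthonormalBasis ℂ W
  have hv : Orthonormal ℂ (fun i : Fin (Module.finrank ℂ W) =>
      (EuclideanSpace.basisFun (Fin d) ℂ) (Fin.castLE hr i)) :=
    (EuclideanSpace.basisFun (Fin d) ℂ).orthonormal.comp _ (Fin.castLE_injective hr)
  obtain ⟨J, -⟩ := exists_isometry_of_orthonormal hv
  let U : EuclideanSpace ℂ (Fin (Module.finrank ℂ W)) →ₗᵢ[ℂ] H :=
    W.subtypeₗᵢ.comp b.repr.symm.toLinearIsometry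
  refine ⟨U.toContinuousLinearMap ∘L J.toContinuousLinearMap.adjoint, ?_, fun i => ?_⟩
  · refine (ContinuousLinearMap.opNorm_comp_le _ _).trans ?_
    exact mul_le_one₀ (norm_isometry_le U) (norm_nonneg _) (norm_adjoint_isometry_le J)
  · let w : W := ⟨u i, Submodule.subset_span ⟨i, rfl⟩⟩
    refine ⟨J (b.repr w), ?_, ?_⟩
    · rw [ContinuousLinearMap.comp_apply, adjoint_isometry_apply]
      simp [U, w]
    · rw [J.norm_map, LinearIsometryEquiv.norm_map]
      rfl

end Isometries

/-! ### Direct sums along isometries with orthogonal ranges -/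

section Sums

variable {I : Type v} {n : NZCard.{v}} {m : I → NZCard.{v}} {α : ∀ i, Hil (m i) →ₗᵢ[ℂ] Hil n}

/-- Testing the resolution of the identity on `α j v` gives `∑ i, ‖(α i)* α j v‖² = ‖v‖²`, and the
term `i = j` already exhausts the sum. -/
theorem adjoint_apply_eq_zero_of_isOpSum (h1 : IsOpSum α (fun _ => 1) 1) {i j : I} (hij : i ≠ j)
    (v : Hil (m j)) : (α i).toContinuousLinearMap.adjoint (α j v) = 0 := by
  classical
  have h := h1 (α j v) (α j v)
  have e : ∀ i, (inner ℂ (α j v) (α i ((1 : Op (m i))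
      ((α i).toContinuousLinearMap.adjoint (α j v)))) : ℂ) =
      ((‖(α i).toContinuousLinearMap.adjoint (α j v)‖ ^ 2 : ℝ) : ℂ) := by
    intro i
    have := ContinuousLinearMap.adjoint_inner_left (α i).toContinuousLinearMap
      ((α i).toContinuousLinearMap.adjoint (α j v)) (α j v)
    rw [inner_self_eq_norm_sq_to_K] at this
    rw [Complex.ofReal_pow]
    exact this.symm
  have e2 : (inner ℂ (α j v) ((1 : Op n) (α j v)) : ℂ) = ((‖v‖ ^ 2 : ℝ) : ℂ) := by
    rw [one_apply_eq_self, inner_self_eq_norm_sq_to_K, LinearIsometry.norm_map]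
    simp
  simp only [e, e2] at h
  have h2 : HasSum (fun i => ‖(α i).toContinuousLinearMap.adjoint (α j v)‖ ^ 2) (‖v‖ ^ 2) := by
    exact_mod_cast h
  have h3 := sum_le_hasSum {i, j} (fun _ _ => by positivity) h2
  rw [Finset.sum_pair hij, adjoint_isometry_apply] at h3
  have h4 : ‖(α i).toContinuousLinearMap.adjoint (α j v)‖ ^ 2 ≤ 0 := by linarith
  exact norm_eq_zero.1 (pow_eq_zero_iff two_ne_zero |>.1 (le_antisymm h4 (by positivity)))

/-- Orthogonality of the ranges collapses the weakly convergent sum to an intertwining relation for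
each index separately. In this form the condition passes to pointwise limits with no exchange of
limit and sum. -/
theorem isOpSum_iff (h1 : IsOpSum α (fun _ => 1) 1) (T : ∀ i, Op (m i)) (S : Op n) :
    IsOpSum α T S ↔ ∀ i v, S (α i v) = α i (T i v) := by
  classical
  constructor
  · intro h i v
    refine ext_inner_left ℂ fun ξ => ?_
    refine (h ξ (α i v)).unique ?_
    convert hasSum_single i fun j hj => ?_ using 1
    · rw [adjoint_isometry_apply]
    · rw [adjoint_apply_eq_zero_of_isOpSum h1 hj]
      simp
  · intro h ξ η
    have h2 := h1 (ContinuousLinearMap.adjoint S ξ) η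
    simp only [ContinuousLinearMap.adjoint_inner_left, one_apply_eq_self, h] at h2
    exact h2

end Sums

/-! ### The cone of the partial unitization -/

section Sharp

variable {E : Type u} [AddCommGroup E] [Module ℂ E]

theorem map_scalarConj {F : Type w} [AddCommGroup F] [Module ℂ F] {m n : ℕ}
    (α : Matrix (Fin m) (Fin n) ℂ) (x : Matrix (Fin n) (Fin n) E) (β : Matrix (Fin n) (Fin m) ℂ)
    (φ : E →ₗ[ℂ] F) : (scalarConj α x β).map φ = scalarConj α (x.map φ) β := by
  ext i j
  simp [scalarConj]

/-- The relation `β s β = 1` replaces `ζ` by `s β² ζ`, so the normalized form of `β A β + 1` at `ζ`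
is the form of `A + s` at `β ζ`. The square root in the definition of the cone never has to be
computed. -/
theorem inner_opMatrix_scalarConj_add_one {H : Type w} [NormedAddCommGroup H]
    [InnerProductSpace ℂ H] {n : ℕ} {β : Matrix (Fin n) (Fin n) ℂ} (hβ : β.IsHermitian) {s : ℝ}
    (h : β * ((s : ℂ) • (1 : Matrix (Fin n) (Fin n) ℂ)) * β = 1)
    (A : Matrix (Fin n) (Fin n) (H →L[ℂ] H)) (ζ : PiLp 2 (fun _ : Fin n => H)) :
    (inner ℂ ζ ((opMatrix (scalarConj β A β) + 1) ζ) : ℂ) =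
      inner ℂ (ampl H β ζ) (opMatrix A (ampl H β ζ)) + s * inner ℂ (ampl H β ζ) (ampl H β ζ) := by
  have h1 : (inner ℂ ζ (opMatrix (scalarConj β A β) ζ) : ℂ) =
      inner ℂ (ampl H β ζ) (opMatrix A (ampl H β ζ)) := by
    rw [opMatrix_scalarConj, inner_ampl_left, hβ.eq]
  have h2 : ζ = (s : ℂ) • ampl H β (ampl H β ζ) := by
    have : ζ = ampl H (1 : Matrix (Fin n) (Fin n) ℂ) ζ := by
      ext i
      simp [ampl_apply, Matrix.one_apply]
    rw [← ampl_mul]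
    nth_rw 1 [this, ← h]
    ext i
    simp only [ampl_apply, PiLp.smul_apply, Finset.smul_sum, smul_smul]
    simp
  have h3 : (inner ℂ ζ ζ : ℂ) = s * inner ℂ (ampl H β ζ) (ampl H β ζ) := by
    nth_rw 2 [h2]
    rw [inner_smul_right, inner_ampl_left, hβ.eq]
  rw [_root_.add_apply, one_apply_eq_self, inner_add_right, h1, h3]

theorem inner_opMatrix_offDiagonal {H : Type w} [NormedAddCommGroup H] [InnerProductSpace ℂ H]
    [CompleteSpace H] {n : ℕ} (A : Matrix (Fin n) (Fin n) (H →L[ℂ] H))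
    (ζ : PiLp 2 (fun _ : Fin (n + n) => H)) :
    (inner ℂ ζ (opMatrix (blockMatrix 0 A A.conjTranspose 0) ζ) : ℂ) =
      ((2 * (inner ℂ (upperPart ζ) (opMatrix A (lowerPart ζ)) : ℂ).re : ℝ) : ℂ) := by
  rw [inner_opMatrix_blockMatrix, opMatrix_zero, opMatrix_conjTranspose,
    ContinuousLinearMap.adjoint_inner_right, ← inner_conj_symm (opMatrix A (lowerPart ζ))]
  simp only [_root_.zero_apply, inner_zero_right, zero_add, add_zero]
  rw [Complex.add_conj]

variable [StarAddMonoid E] [MatrixNorm E] [MatrixCone E]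

/-- The scalar part of the block matrix is `t 1`, so the cone condition says that the self-adjoint
block matrix with corners `φ(x)` and `φ(x)*` is at least `-(t + ε)` for every `ε > 0`, which amounts
to `‖φ(x)‖ ≤ t`. The target `M_{2n}` comes from the doubled size of the block matrix. -/
theorem block_mem_sharpCone_iff {n : ℕ} (x : Matrix (Fin n) (Fin n) E) {t : ℝ} (ht : 0 < t) :
    blockMatrix (Matrix.diagonal fun _ => ((0 : E), (t : ℂ))) (x.map fun a => (a, (0 : ℂ)))
      (x.map fun a => (a, (0 : ℂ))).conjTranspose
      (Matrix.diagonal fun _ => ((0 : E), (t : ℂ))) ∈ sharpCone E (n + n) ↔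
    ∀ φ : E →ₗ[ℂ] (EuclideanSpace ℂ (Fin (n + n)) →L[ℂ] EuclideanSpace ℂ (Fin (n + n))),
      IsCCP φ → ‖opMatrix (x.map φ)‖ ≤ t := by
  set X := blockMatrix (Matrix.diagonal fun _ => ((0 : E), (t : ℂ))) (x.map fun a => (a, (0 : ℂ)))
      (x.map fun a => (a, (0 : ℂ))).conjTranspose
      (Matrix.diagonal fun _ => ((0 : E), (t : ℂ))) with hX
  have hsnd : X.map Prod.snd = (t : ℂ) • (1 : Matrix (Fin (n + n)) (Fin (n + n)) ℂ) := by
    ext i j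
    induction i using Fin.addCases <;> induction j using Fin.addCases <;>
      simp [hX, Matrix.diagonal_apply, Matrix.one_apply, apply_ite Prod.snd, -Fin.natAdd_eq_addNat]
    · intro h; exact absurd (congrArg Fin.val h) (by simp; omega)
    · intro h; exact absurd (congrArg Fin.val h) (by simp; omega)
  have hfst : X.map Prod.fst = blockMatrix 0 x x.conjTranspose 0 := by
    ext i j
    induction i using Fin.addCases <;> induction j using Fin.addCases <;>
      simp [hX, Matrix.diagonal_apply, apply_ite Prod.fst, -Fin.natAdd_eq_addNat]
  have hherm : X.IsHermitian := by
    ext i j : 1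
    rw [Matrix.conjTranspose_apply]
    induction i using Fin.addCases with
    | left i =>
      induction j using Fin.addCases with
      | left j =>
        by_cases h : i = j
        · subst h; ext <;> simp [hX, -Fin.natAdd_eq_addNat]
        · simp [hX, h, Ne.symm h, -Fin.natAdd_eq_addNat]
      | right j => simp [hX, -Fin.natAdd_eq_addNat]
    | right i =>
      induction j using Fin.addCases with
      | left j => simp [hX, -Fin.natAdd_eq_addNat]
      | right j =>
        by_cases h : i = j
        · subst h; ext <;> simp [hX, -Fin.natAdd_eq_addNat]
        · simp [hX, h, Ne.symm h, -Fin.natAdd_eq_addNat]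
  have hone : ∀ ε : ℝ, X.map Prod.snd + (ε : ℂ) • (1 : Matrix (Fin (n + n)) (Fin (n + n)) ℂ) =
      ((t + ε : ℝ) : ℂ) • (1 : Matrix (Fin (n + n)) (Fin (n + n)) ℂ) := by
    intro ε
    rw [hsnd, ← add_smul, Complex.ofReal_add]
  have hmap : ∀ φ : E →ₗ[ℂ] (EuclideanSpace ℂ (Fin (n + n)) →L[ℂ]
      EuclideanSpace ℂ (Fin (n + n))), IsCCP φ → ∀ β : Matrix (Fin (n + n)) (Fin (n + n)) ℂ,
      (scalarConj β (X.map Prod.fst) β).map φ =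
        scalarConj β (blockMatrix 0 (x.map φ) (x.map φ).conjTranspose 0) β := by
    intro φ hφ β
    rw [map_scalarConj, hfst, blockMatrix_map]
    congr 2
    · ext; simp
    · ext i j : 1
      exact hφ.map_star _
    · ext; simp
  constructor
  · rintro ⟨-, -, h⟩ φ hφ
    refine le_of_forall_pos_le_add fun ε hε => ?_
    have hs : 0 < t + ε := by positivity
    -- `β = (t + ε)^{-1/2} 1` is the normalizing matrix for this scalar part.
    set c : ℝ := (Real.sqrt (t + ε))⁻¹ with hc
    have hc0 : 0 < c := inv_pos.2 (Real.sqrt_pos.2 hs)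
    have hcc : c * (t + ε) * c = 1 := by
      rw [hc]
      have := Real.mul_self_sqrt hs.le
      have h0 := (Real.sqrt_pos.2 hs).ne'
      field_simp
      nlinarith
    have hβ : ((c : ℂ) • (1 : Matrix (Fin (n + n)) (Fin (n + n)) ℂ)).PosDef :=
      Matrix.PosDef.one.smul (by exact_mod_cast hc0)
    have hβ1 : ((c : ℂ) • (1 : Matrix (Fin (n + n)) (Fin (n + n)) ℂ)) *
        (((t + ε : ℝ) : ℂ) • (1 : Matrix (Fin (n + n)) (Fin (n + n)) ℂ)) *
        ((c : ℂ) • (1 : Matrix (Fin (n + n)) (Fin (n + n)) ℂ)) = 1 := by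
      rw [Matrix.smul_mul, Matrix.one_mul, smul_smul, Matrix.smul_mul, Matrix.one_mul, smul_smul,
        ← Complex.ofReal_mul, ← Complex.ofReal_mul, hcc]
      simp
    have hpos := (isPositive_iff_inner_nonneg _).1
      (h ε hε _ hβ (by rw [hone]; exact hβ1) φ hφ)
    rw [hmap φ hφ] at hpos
    refine ContinuousLinearMap.opNorm_le_of_re_inner_le hs.le fun ξ η hξ hη => ?_
    -- The factor `c⁻¹` cancels the action of `β`. At the column `(-η, ξ)` the off-diagonal form is
    -- `-2 Re ⟨η, φ(x) ξ⟩`, and the squared norm is `2`.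
    have hp := hpos ((c : ℂ)⁻¹ • stack (-η) ξ)
    rw [inner_opMatrix_scalarConj_add_one hβ.isHermitian hβ1] at hp
    have ha : ampl (EuclideanSpace ℂ (Fin (n + n)))
        ((c : ℂ) • (1 : Matrix (Fin (n + n)) (Fin (n + n)) ℂ)) ((c : ℂ)⁻¹ • stack (-η) ξ) =
        stack (-η) ξ := by
      have hc' : (c : ℂ) ≠ 0 := by exact_mod_cast hc0.ne'
      ext i : 1
      rw [ampl_apply, Finset.sum_eq_single i]
      · simp [smul_smul, hc']
      · intro j _ hj
        simp [Ne.symm hj]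
      · simp
    rw [ha, inner_opMatrix_offDiagonal, upperPart_stack, lowerPart_stack,
      inner_self_eq_ofReal] at hp
    have hn : ‖stack (-η) ξ‖ ^ 2 = 2 := by
      rw [norm_sq_eq_upper_add_lower, upperPart_stack, lowerPart_stack, norm_neg, hξ, hη]
      norm_num
    rw [hn, ← Complex.ofReal_mul, ← Complex.ofReal_add,
      Complex.zero_le_real, inner_neg_left, Complex.neg_re] at hp
    have h5 : RCLike.re (inner ℂ (opMatrix (x.map φ) ξ) η : ℂ) =
        (inner ℂ η (opMatrix (x.map φ) ξ) : ℂ).re := by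
      exact inner_re_symm (𝕜 := ℂ) _ _
    rw [h5]
    linarith
  · intro h
    refine ⟨hherm, ?_, fun ε hε β hβ hβ1 φ hφ => ?_⟩
    · rw [hsnd]
      exact Matrix.PosSemidef.one.smul (by exact_mod_cast ht.le)
    · rw [hone] at hβ1
      rw [hmap φ hφ, isPositive_iff_inner_nonneg]
      intro ζ
      rw [inner_opMatrix_scalarConj_add_one hβ.isHermitian hβ1, inner_opMatrix_offDiagonal,
        inner_self_eq_ofReal,
        ← Complex.ofReal_mul, ← Complex.ofReal_add, Complex.zero_le_real,
        norm_sq_eq_upper_add_lower]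
      set p := upperPart (ampl (EuclideanSpace ℂ (Fin (n + n))) β ζ)
      set q := lowerPart (ampl (EuclideanSpace ℂ (Fin (n + n))) β ζ)
      have h1 := (Complex.abs_re_le_norm _).trans (norm_inner_apply_le (opMatrix (x.map φ)) p q)
      have h2 : ‖opMatrix (x.map φ)‖ * ‖p‖ * ‖q‖ ≤ t * ‖p‖ * ‖q‖ := by
        gcongr
        exact h φ hφ
      have h3 := (abs_le.1 (h1.trans h2)).1
      -- The conclusion is `2 t ‖p‖ ‖q‖ ≤ (t + ε) (‖p‖² + ‖q‖²)`.
      nlinarith [sq_nonneg (‖p‖ - ‖q‖), sq_nonneg ‖p‖, sq_nonneg ‖q‖]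

theorem sharpNorm_eq_sInf {n : ℕ} (x : Matrix (Fin n) (Fin n) E) :
    sharpNorm E n (x.map fun a => (a, (0 : ℂ))) = sInf {t : ℝ | 0 < t ∧
      ∀ φ : E →ₗ[ℂ] (EuclideanSpace ℂ (Fin (n + n)) →L[ℂ] EuclideanSpace ℂ (Fin (n + n))),
        IsCCP φ → ‖opMatrix (x.map φ)‖ ≤ t} := by
  unfold sharpNorm
  congr 1
  ext t
  exact and_congr_right fun ht => block_mem_sharpCone_iff x ht

theorem sharpNorm_eq_of_forall {n : ℕ} (x : Matrix (Fin n) (Fin n) E) {C : ℝ} (hC : 0 ≤ C)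
    (h1 : ∀ φ : E →ₗ[ℂ] (EuclideanSpace ℂ (Fin (n + n)) →L[ℂ] EuclideanSpace ℂ (Fin (n + n))),
        IsCCP φ → ‖opMatrix (x.map φ)‖ ≤ C)
    (h2 : ∀ t : ℝ, 0 < t →
      (∀ φ : E →ₗ[ℂ] (EuclideanSpace ℂ (Fin (n + n)) →L[ℂ] EuclideanSpace ℂ (Fin (n + n))),
        IsCCP φ → ‖opMatrix (x.map φ)‖ ≤ t) → C ≤ t) :
    sharpNorm E n (x.map fun a => (a, (0 : ℂ))) = C := by
  rw [sharpNorm_eq_sInf]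
  refine le_antisymm (le_of_forall_pos_le_add fun ε hε => ?_)
    -- The infimum runs over strictly positive `t`, and `C` may be zero; hence `C + 1` here and `C +
    -- ε` below.
    (le_csInf ⟨C + 1, by positivity, fun φ hφ => (h1 φ hφ).trans (by linarith)⟩
      fun t ht => h2 t ht.1 ht.2)
  exact csInf_le ⟨0, fun t ht => ht.1.le⟩
    ⟨by positivity, fun φ hφ => (h1 φ hφ).trans (by linarith)⟩

/-- This is the usable form of the isometry axiom: bounds for all ccp maps into `M_{2n}` bound the
norm of `M_n(E)`. -/
theorem IsOperatorSystem.mnorm_le [StarModule ℂ E] (hE : IsOperatorSystem E) {n : ℕ}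
    (x : Matrix (Fin n) (Fin n) E) {C : ℝ} (hC : 0 ≤ C)
    (h : ∀ φ : E →ₗ[ℂ] (EuclideanSpace ℂ (Fin (n + n)) →L[ℂ] EuclideanSpace ℂ (Fin (n + n))),
        IsCCP φ → ‖opMatrix (x.map φ)‖ ≤ C) : MatrixNorm.mnorm n x ≤ C := by
  rw [← hE.inclusion_isometric, sharpNorm_eq_sInf]
  refine le_of_forall_pos_le_add fun ε hε => ?_
  exact csInf_le ⟨0, fun t ht => ht.1.le⟩
    ⟨by positivity, fun φ hφ => (h φ hφ).trans (by linarith)⟩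

end Sharp

/-! ### The weak* topology and uniform approximation -/

section WeakStar

variable {H : Type w} [NormedAddCommGroup H] [InnerProductSpace ℂ H]

theorem summable_norm_sq_add (ξ η : lp (fun _ : ℕ => H) 2) :
    Summable fun k => ‖ξ k‖ ^ 2 + ‖η k‖ ^ 2 := by
  have h1 : Summable fun k => ‖ξ k‖ ^ (2 : ℕ) := by
    simpa using (lp.memℓp ξ).summable (by norm_num)
  have h2 : Summable fun k => ‖η k‖ ^ (2 : ℕ) := by
    simpa using (lp.memℓp η).summable (by norm_num)
  exact h1.add h2

theorem norm_inner_apply_le_sq (T : H →L[ℂ] H) (ξ η : H) :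
    ‖(inner ℂ ξ (T η) : ℂ)‖ ≤ ‖T‖ * (‖ξ‖ ^ 2 + ‖η‖ ^ 2) := by
  refine (norm_inner_apply_le T ξ η).trans ?_
  rw [mul_assoc]
  refine mul_le_mul_of_nonneg_left ?_ (norm_nonneg _)
  nlinarith [sq_nonneg (‖ξ‖ - ‖η‖), sq_nonneg ‖ξ‖, sq_nonneg ‖η‖]

theorem norm_tsum_inner_apply_le (ξ η : lp (fun _ : ℕ => H) 2) (T : H →L[ℂ] H) :
    ‖∑' k, (inner ℂ (ξ k) (T (η k)) : ℂ)‖ ≤ ‖T‖ * ∑' k, (‖ξ k‖ ^ 2 + ‖η k‖ ^ 2) := by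
  rw [← tsum_mul_left]
  exact tsum_of_norm_bounded ((summable_norm_sq_add ξ η).mul_left _).hasSum
    fun k => norm_inner_apply_le_sq T _ _

/-- Every normal functional is norm bounded, so uniform norm approximation of `f` becomes uniform
approximation of the scalar functions that define the topology. -/
theorem continuous_weakStar_of_uniform_approx {X : Type v} [TopologicalSpace X]
    {f : X → H →L[ℂ] H} (h : ∀ ε : ℝ, 0 < ε → ∃ g : X → H →L[ℂ] H,
      @Continuous X _ _ (weakStarTopology H) g ∧ ∀ x, ‖f x - g x‖ ≤ ε) :
    @Continuous X _ _ (weakStarTopology H) f := by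
  refine (continuous_weakStar_iff f).2 fun ξ η => ?_
  refine continuous_of_uniform_approx_of_continuous fun U hU => ?_
  obtain ⟨ε, hε, hU⟩ := Metric.mem_uniformity_dist.1 hU
  set M := ∑' k, (‖ξ k‖ ^ 2 + ‖η k‖ ^ 2) with hM
  have hM0 : 0 ≤ M := tsum_nonneg fun k => by positivity
  obtain ⟨g, hg, hfg⟩ := h (ε / (M + 1)) (by positivity)
  refine ⟨_, (continuous_weakStar_iff g).1 hg ξ η, fun x => hU ?_⟩
  rw [dist_eq_norm, ← (summable_inner_apply ξ η (f x)).tsum_sub (summable_inner_apply ξ η (g x))]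
  have e : ∀ k, (inner ℂ (ξ k) (f x (η k)) : ℂ) - inner ℂ (ξ k) (g x (η k)) =
      inner ℂ (ξ k) ((f x - g x) (η k)) := fun k => by
    rw [_root_.sub_apply, inner_sub_right]
  simp only [e]
  refine (norm_tsum_inner_apply_le ξ η (f x - g x)).trans_lt ?_
  refine (mul_le_mul_of_nonneg_right (hfg x) hM0).trans_lt ?_
  rw [div_mul_eq_mul_div, div_lt_iff₀ (by positivity)]
  nlinarith

end WeakStar

/-! ### `A(K, z)` is an operator system -/

section Aff

variable {E : Type u} [AddCommGroup E] [Module ℂ E] {K : NCSet.{u, v} E} {z : K 1}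

/-- Evaluation at a point, as a linear map. -/
def evalAt {n : NZCard.{v}} (x : K n) : PointedAff K z →ₗ[ℂ] Op n where
  toFun a := a.1 n x
  map_add' _ _ := rfl
  map_smul' _ _ := rfl

theorem map_evalAt {k : ℕ} (a : Matrix (Fin k) (Fin k) (PointedAff K z)) {n : NZCard.{v}}
    (x : K n) : a.map (evalAt x) = evalMatrix a x := rfl

theorem evalMatrix_sub {k : ℕ} (a b : Matrix (Fin k) (Fin k) (PointedAff K z)) {n : NZCard.{v}}
    (x : K n) : evalMatrix (a - b) x = evalMatrix a x - evalMatrix b x := rfl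

theorem evalMatrix_conjTranspose {k : ℕ} (a : Matrix (Fin k) (Fin k) (PointedAff K z))
    {n : NZCard.{v}} (x : K n) : evalMatrix a.conjTranspose x = (evalMatrix a x).conjTranspose :=
  rfl

theorem evalMatrix_ext {k : ℕ} {a b : Matrix (Fin k) (Fin k) (PointedAff K z)}
    (h : ∀ (n : NZCard.{v}) (x : K n), evalMatrix a x = evalMatrix b x) : a = b := by
  ext i j : 2
  refine funext fun n => funext fun x => ?_
  exact congrFun (congrFun (h n x) i) j

theorem mnorm_aff_le {k : ℕ} {a : Matrix (Fin k) (Fin k) (PointedAff K z)} {C : ℝ} (hC : 0 ≤ C)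
    (h : ∀ (n : NZCard.{v}) (x : K n), ‖opMatrix (evalMatrix a x)‖ ≤ C) :
    MatrixNorm.mnorm k a ≤ C :=
  Real.iSup_le (fun p => h p.1 p.2) hC

theorem mnorm_aff_nonneg {k : ℕ} (a : Matrix (Fin k) (Fin k) (PointedAff K z)) :
    0 ≤ MatrixNorm.mnorm k a :=
  Real.iSup_nonneg fun _ => norm_nonneg _

/-- A real supremum bounds its terms only when the family is bounded above. Compactness of `K 1`,
through `bounded_of_isContAffineNCFun`, bounds each entry uniformly over all levels. -/
theorem norm_evalMatrix_le [MatrixNorm E] (hK : IsCompactNCConvex K) {k : ℕ}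
    (a : Matrix (Fin k) (Fin k) (PointedAff K z)) {n : NZCard.{v}} (x : K n) :
    ‖opMatrix (evalMatrix a x)‖ ≤ MatrixNorm.mnorm k a := by
  choose C hC using fun i j => bounded_of_isContAffineNCFun hK (a i j).2.1
  have hb : BddAbove (Set.range fun q : Σ n : NZCard.{v}, K n =>
      ‖opMatrix (evalMatrix a q.2)‖) := by
    refine ⟨∑ i, ∑ j, C i j, ?_⟩
    rintro _ ⟨q, rfl⟩
    exact (norm_opMatrix_le _).trans
      (Finset.sum_le_sum fun i _ => Finset.sum_le_sum fun j _ => hC i j q.1 q.2)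
  exact le_ciSup hb ⟨n, x⟩

theorem norm_eval_le [MatrixNorm E] (hK : IsCompactNCConvex K) (a : PointedAff K z)
    {n : NZCard.{v}} (x : K n) : ‖a.1 n x‖ ≤ norm₁ a := by
  rw [← norm_opMatrix_one]
  exact norm_evalMatrix_le hK (fun _ _ => a) x

theorem norm₁_aff_nonneg (a : PointedAff K z) : 0 ≤ norm₁ a := mnorm_aff_nonneg _

theorem norm₁_aff_le {a : PointedAff K z} {C : ℝ} (hC : 0 ≤ C)
    (h : ∀ (n : NZCard.{v}) (x : K n), ‖a.1 n x‖ ≤ C) : norm₁ a ≤ C := by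
  refine mnorm_aff_le hC fun n x => ?_
  have := norm_opMatrix_one (a.1 n x)
  exact this.trans_le (h n x)

theorem isCCP_evalAt [MatrixNorm E] (hK : IsCompactNCConvex K) {n : NZCard.{v}} (x : K n) :
    IsCCP (evalAt (z := z) x) where
  map_star _ := rfl
  contractive _ a := norm_evalMatrix_le hK a x
  positive _ _ ha := ha n x

open scoped Matrix.Norms.L2Operator in
theorem isOperatorSpace_aff [MatrixNorm E] (hK : IsCompactNCConvex K) :
    IsOperatorSpace (PointedAff K z) where
  eq_zero k a h := by
    refine evalMatrix_ext fun n x => opMatrix_injective ?_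
    have h1 := norm_evalMatrix_le hK a x
    rw [h] at h1
    rw [norm_le_zero_iff.1 h1]
    exact opMatrix_zero.symm
  add_le k a b := by
    refine mnorm_aff_le (add_nonneg (mnorm_aff_nonneg a) (mnorm_aff_nonneg b)) fun n x => ?_
    have e : evalMatrix (a + b) x = evalMatrix a x + evalMatrix b x := rfl
    rw [e, opMatrix_add]
    exact (norm_add_le _ _).trans
      (add_le_add (norm_evalMatrix_le hK a x) (norm_evalMatrix_le hK b x))
  smul_eq k c a := by
    change (⨆ p : Σ n : NZCard.{v}, K n, ‖opMatrix (evalMatrix (c • a) p.2)‖) =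
      ‖c‖ * ⨆ p : Σ n : NZCard.{v}, K n, ‖opMatrix (evalMatrix a p.2)‖
    rw [Real.mul_iSup_of_nonneg (norm_nonneg c)]
    refine iSup_congr fun p => ?_
    have e : evalMatrix (c • a) p.2 = c • evalMatrix a p.2 := rfl
    rw [e, opMatrix_smul, norm_smul]
  conj_le m k α a β := by
    refine mnorm_aff_le (mul_nonneg (mul_nonneg (norm_nonneg α) (mnorm_aff_nonneg a))
      (norm_nonneg β)) fun n x => ?_
    rw [← map_evalAt, map_scalarConj]
    refine (norm_opMatrix_scalarConj_le _ _ _).trans ?_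
    refine mul_le_mul_of_nonneg_right (mul_le_mul_of_nonneg_left ?_ (norm_nonneg α))
      (norm_nonneg β)
    exact norm_evalMatrix_le hK a x
  block_eq m k a b := by
    have e : ∀ (n : NZCard.{v}) (x : K n), ‖opMatrix (evalMatrix (blockMatrix a 0 0 b) x)‖ =
        max ‖opMatrix (evalMatrix a x)‖ ‖opMatrix (evalMatrix b x)‖ := fun n x => by
      rw [← norm_opMatrix_blockDiagonal, ← map_evalAt, blockMatrix_map]
      rfl
    refine le_antisymm (mnorm_aff_le (le_max_of_le_left (mnorm_aff_nonneg a)) fun n x => ?_)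
      (max_le (mnorm_aff_le (mnorm_aff_nonneg _) fun n x => ?_)
        (mnorm_aff_le (mnorm_aff_nonneg _) fun n x => ?_))
    · rw [e]
      exact max_le_max (norm_evalMatrix_le hK a x) (norm_evalMatrix_le hK b x)
    · exact ((le_max_left _ _).trans (e n x).ge).trans (norm_evalMatrix_le hK _ x)
    · exact ((le_max_right _ _).trans (e n x).ge).trans (norm_evalMatrix_le hK _ x)

theorem isMatrixOrderedOperatorSpace_aff [MatrixNorm E] (hK : IsCompactNCConvex K) :
    IsMatrixOrderedOperatorSpace (PointedAff K z) where
  toIsOperatorSpace := isOperatorSpace_aff hK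
  mnorm_star k a := by
    refine iSup_congr fun p => ?_
    rw [evalMatrix_conjTranspose, opMatrix_conjTranspose, LinearIsometryEquiv.norm_map]
  cone_isHermitian k a ha := by
    refine evalMatrix_ext fun n x => opMatrix_injective ?_
    rw [evalMatrix_conjTranspose, opMatrix_conjTranspose]
    exact (ha n x).isSelfAdjoint
  cone_closed k s a hs h n x := by
    rw [isPositive_iff_inner_nonneg]
    intro ξ
    have h1 : Filter.Tendsto (fun i => opMatrix (evalMatrix (s i) x)) Filter.atTop
        (nhds (opMatrix (evalMatrix a x))) := by
      rw [tendsto_iff_norm_sub_tendsto_zero]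
      refine squeeze_zero (fun _ => norm_nonneg _) (fun i => ?_) h
      rw [← opMatrix_sub, ← evalMatrix_sub]
      exact norm_evalMatrix_le hK _ x
    have h2 : Filter.Tendsto (fun i => (inner ℂ ξ (opMatrix (evalMatrix (s i) x) ξ) : ℂ))
        Filter.atTop (nhds (inner ℂ ξ (opMatrix (evalMatrix a x) ξ))) := by
      have hc : Continuous fun T : PiLp 2 (fun _ : Fin k => Hil n) →L[ℂ]
          PiLp 2 (fun _ : Fin k => Hil n) => (inner ℂ ξ (T ξ) : ℂ) := by fun_prop
      exact (hc.tendsto _).comp h1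
    exact ge_of_tendsto' h2 fun i => (isPositive_iff_inner_nonneg _).1 (hs i n x) ξ
  zero_mem_cone k n x := by
    have e : evalMatrix (0 : Matrix (Fin k) (Fin k) (PointedAff K z)) x = 0 := rfl
    rw [e, opMatrix_zero]
    exact ContinuousLinearMap.isPositive_zero
  add_mem_cone k a ha b hb n x := by
    have e : evalMatrix (a + b) x = evalMatrix a x + evalMatrix b x := rfl
    rw [e, opMatrix_add]
    exact (ha n x).add (hb n x)
  cone_pointed k a ha hna := by
    refine evalMatrix_ext fun n x => opMatrix_injective ?_
    have e : evalMatrix (0 : Matrix (Fin k) (Fin k) (PointedAff K z)) x = 0 := rfl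
    rw [e, opMatrix_zero]
    have h1 := (isPositive_iff_inner_nonneg _).1 (ha n x)
    have h2 := (isPositive_iff_inner_nonneg _).1 (hna n x)
    have e' : evalMatrix (-a) x = -evalMatrix a x := rfl
    rw [e', opMatrix_neg] at h2
    -- An operator that is both positive and negative has numerical radius zero.
    refine norm_le_zero_iff.1 ((opNorm_le_of_numericalRadius _ (fun ξ _ => ?_) le_rfl).trans
      (by simp))
    have h3 := h2 ξ
    rw [_root_.neg_apply, inner_neg_right, neg_nonneg] at h3
    rw [le_antisymm h3 (h1 ξ), norm_zero]
  conj_mem_cone m k α a ha n x := by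
    rw [← map_evalAt, map_scalarConj]
    exact isPositive_opMatrix_scalarConj α (ha n x)

/-- Direct sums, compressions and the value at `z` need only pointwise norm limits, the direct sums
after rewriting by `isOpSum_iff`. Uniformity enters for continuity alone. -/
theorem mem_pointedAff_of_uniform_limit {s : ℕ → PointedAff K z}
    {f : ∀ n : NZCard.{v}, K n → Op n}
    (h : ∀ ε : ℝ, 0 < ε → ∃ N, ∀ i ≥ N, ∀ (n : NZCard.{v}) (x : K n), ‖(s i).1 n x - f n x‖ ≤ ε) :
    f ∈ PointedAff K z := by
  have ht : ∀ (n : NZCard.{v}) (x : K n),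
      Filter.Tendsto (fun i => (s i).1 n x) Filter.atTop (nhds (f n x)) := by
    intro n x
    rw [Metric.tendsto_atTop]
    intro ε hε
    obtain ⟨N, hN⟩ := h (ε / 2) (by positivity)
    refine ⟨N, fun i hi => ?_⟩
    rw [dist_eq_norm]
    exact (hN i hi n x).trans_lt (by linarith)
  have hv : ∀ (n : NZCard.{v}) (x : K n) (ξ : Hil n),
      Filter.Tendsto (fun i => (s i).1 n x ξ) Filter.atTop (nhds (f n x ξ)) := fun n x ξ =>
    ((ContinuousLinearMap.apply ℂ (Hil n) ξ).continuous.tendsto _).comp (ht n x)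
  refine ⟨⟨fun I n m α x y hd => ?_, fun m n β x y hxy => ?_, fun n => ?_⟩, ?_⟩
  · rw [isOpSum_iff hd.sum_eq_one]
    intro i ξ
    refine tendsto_nhds_unique (hv n y (α i ξ)) ?_
    have h1 := fun j => (isOpSum_iff hd.sum_eq_one _ _).1
      ((s j).2.1.map_directSum I n m α x y hd) i ξ
    simp only [h1]
    exact ((α i).continuous.tendsto _).comp (hv (m i) (x i) ξ)
  · ext1 ξ
    refine tendsto_nhds_unique (hv m y ξ) ?_
    simp only [(s _).2.1.map_compress m n β x y hxy]
    exact (β.toContinuousLinearMap.adjoint.continuous.tendsto _).comp (hv n x (β ξ))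
  · let _ := componentTopology K n
    refine continuous_weakStar_of_uniform_approx fun ε hε => ?_
    obtain ⟨N, hN⟩ := h ε hε
    exact ⟨_, (s N).2.1.continuous n, fun x => by rw [norm_sub_rev]; exact hN N le_rfl n x⟩
  · refine tendsto_nhds_unique (ht 1 z) ?_
    simp only [(s _).2.2]
    exact tendsto_const_nhds

theorem isMatrixComplete_aff [MatrixNorm E] (hK : IsCompactNCConvex K) :
    IsMatrixComplete (PointedAff K z) := by
  intro s hs
  have hc : ∀ (n : NZCard.{v}) (x : K n), ∃ T, Filter.Tendsto (fun i => (s i).1 n x)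
      Filter.atTop (nhds T) := by
    intro n x
    refine cauchySeq_tendsto_of_complete (Metric.cauchySeq_iff.2 fun ε hε => ?_)
    obtain ⟨N, hN⟩ := hs ε hε
    refine ⟨N, fun i hi j hj => ?_⟩
    rw [dist_eq_norm]
    exact (norm_eval_le hK (s i - s j) x).trans_lt (hN i hi j hj)
  choose f hf using hc
  have hu : ∀ ε : ℝ, 0 < ε → ∃ N, ∀ i ≥ N, ∀ (n : NZCard.{v}) (x : K n),
      ‖(s i).1 n x - f n x‖ ≤ ε := by
    intro ε hε
    obtain ⟨N, hN⟩ := hs ε hε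
    refine ⟨N, fun i hi n x => ?_⟩
    have ht : Filter.Tendsto (fun j => ‖(s i).1 n x - (s j).1 n x‖) Filter.atTop
        (nhds ‖(s i).1 n x - f n x‖) := (tendsto_const_nhds.sub (hf n x)).norm
    refine le_of_tendsto ht (Filter.eventually_atTop.2 ⟨N, fun j hj => ?_⟩)
    exact (norm_eval_le hK (s i - s j) x).trans (hN i hi j hj).le
  obtain ⟨g, hg⟩ : ∃ g : PointedAff K z, g.1 = f := ⟨⟨f, mem_pointedAff_of_uniform_limit hu⟩, rfl⟩
  refine ⟨g, ?_⟩
  rw [Metric.tendsto_atTop]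
  intro ε hε
  obtain ⟨N, hN⟩ := hu (ε / 2) (by positivity)
  refine ⟨N, fun i hi => ?_⟩
  rw [dist_zero_right, Real.norm_of_nonneg (norm₁_aff_nonneg _)]
  have h : norm₁ (s i - g) ≤ ε / 2 := norm₁_aff_le (by positivity) fun n x => by
    have h1 := hN i hi n x
    rw [← hg] at h1
    exact h1
  linarith

/-- A coefficient `⟨ξ, φ(a) η⟩` involves only the `2k` entries of `ξ` and `η`. They lie in the range
of a contraction from `ℂ^{2k}`, and norm preserving preimages make the coefficient one of the
compressed map. The dimension `2k` is the one prescribed by the partial unitization. -/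
theorem norm_opMatrix_le_of_compressions {H : Type w} [NormedAddCommGroup H]
    [InnerProductSpace ℂ H] [CompleteSpace H] {F : Type*} [AddCommGroup F] [Module ℂ F] {k : ℕ}
    (φ : F →ₗ[ℂ] (H →L[ℂ] H)) (a : Matrix (Fin k) (Fin k) F) {t : ℝ} (ht : 0 ≤ t)
    (h : ∀ V : EuclideanSpace ℂ (Fin (k + k)) →L[ℂ] H, ‖V‖ ≤ 1 →
      ‖opMatrix (a.map (compressMap V φ))‖ ≤ t) : ‖opMatrix (a.map φ)‖ ≤ t := by
  refine opNorm_le_of_inner_le _ ht fun ξ η => ?_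
  obtain ⟨V, hV, hx⟩ := exists_contraction_covering (fun i => stack ξ η i)
  choose x hVx hx using hx
  have h1 : diagOp k V (WithLp.toLp 2 fun i => x (Fin.castAdd k i)) = ξ := by
    ext1 i
    rw [diagOp_apply, hVx]
    exact congrFun (congrArg WithLp.ofLp (upperPart_stack ξ η)) i
  have h2 : diagOp k V (WithLp.toLp 2 fun i => x (Fin.natAdd k i)) = η := by
    ext1 i
    rw [diagOp_apply, hVx]
    exact congrFun (congrArg WithLp.ofLp (lowerPart_stack ξ η)) i
  have n1 : ‖WithLp.toLp 2 fun i => x (Fin.castAdd k i)‖ = ‖ξ‖ := by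
    rw [← sq_eq_sq₀ (norm_nonneg _) (norm_nonneg _), PiLp.norm_sq_eq_of_L2, ← h1,
      PiLp.norm_sq_eq_of_L2]
    simp only [diagOp_apply, hVx, hx]
  have n2 : ‖WithLp.toLp 2 fun i => x (Fin.natAdd k i)‖ = ‖η‖ := by
    rw [← sq_eq_sq₀ (norm_nonneg _) (norm_nonneg _), PiLp.norm_sq_eq_of_L2, ← h2,
      PiLp.norm_sq_eq_of_L2]
    simp only [diagOp_apply, hVx, hx]
  rw [← n1, ← n2]
  nth_rw 1 [← h1, ← h2]
  rw [← inner_opMatrix_compressMap]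
  refine (norm_inner_apply_le _ _ _).trans ?_
  gcongr
  exact h V hV

/-- For the isometry axiom, every ccp map is bounded by the uniform norm by definition, and the
compressed evaluations at points of `K` attain it as a supremum. -/
theorem isOperatorSystem_aff [MatrixNorm E] (hK : IsCompactNCConvex K) :
    IsOperatorSystem (PointedAff K z) where
  toIsMatrixOrderedOperatorSpace := isMatrixOrderedOperatorSpace_aff hK
  complete := isMatrixComplete_aff hK
  inclusion_isometric k a := by
    refine sharpNorm_eq_of_forall a (mnorm_aff_nonneg a) (fun φ hφ => hφ.contractive k a)
      fun t ht h => mnorm_aff_le ht.le fun n x => ?_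
    exact norm_opMatrix_le_of_compressions (evalAt x) a ht.le
      fun V hV => h _ ((isCCP_evalAt hK x).compressMap hV)

end Aff

/-! ### Weak limits of bounded operators -/

section Limits

variable {H : Type w} [NormedAddCommGroup H] [InnerProductSpace ℂ H] [CompleteSpace H]

theorem exists_weak_limit_operator {X : Type v} {f : Filter X} [f.NeBot] {T : X → H →L[ℂ] H}
    {C : ℝ} (hC : ∀ᶠ x in f, ‖T x‖ ≤ C)
    (hl : ∀ ξ η : H, ∃ c : ℂ, Filter.Tendsto (fun x => (inner ℂ ξ (T x η) : ℂ)) f (nhds c)) :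
    ∃ S : H →L[ℂ] H, ∀ ξ η,
      Filter.Tendsto (fun x => (inner ℂ ξ (T x η) : ℂ)) f (nhds (inner ℂ ξ (S η))) := by
  choose c hc using hl
  have hc' : ∀ η ξ, Filter.Tendsto (fun x => (inner ℂ (T x η) ξ : ℂ)) f (nhds (star (c ξ η))) := by
    intro η ξ
    have := (hc ξ η).star
    refine this.congr fun x => ?_
    exact inner_conj_symm _ _
  -- The limit form is bounded and hence represented by an operator. The Riesz representation used
  -- expects `⟨T η, ξ⟩`, which accounts for the conjugate of `c`.
  let B : H →ₗ⋆[ℂ] H →ₗ[ℂ] ℂ := LinearMap.mk₂'ₛₗ (starRingEnd ℂ) (RingHom.id ℂ)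
    (fun η ξ => star (c ξ η))
    (fun η η' ξ => tendsto_nhds_unique (hc' (η + η') ξ)
      (((hc' η ξ).add (hc' η' ξ)).congr fun x => by rw [map_add, inner_add_left]))
    (fun a η ξ => tendsto_nhds_unique (hc' (a • η) ξ)
      (((hc' η ξ).const_mul (starRingEnd ℂ a)).congr fun x => by
        rw [map_smul, inner_smul_left]))
    (fun η ξ ξ' => tendsto_nhds_unique (hc' η (ξ + ξ'))
      (((hc' η ξ).add (hc' η ξ')).congr fun x => by rw [inner_add_right]))
    (fun a η ξ => tendsto_nhds_unique (hc' η (a • ξ))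
      (((hc' η ξ).const_mul a).congr fun x => by rw [inner_smul_right]))
  have hB : ∀ η ξ, ‖B η ξ‖ ≤ C * ‖η‖ * ‖ξ‖ := by
    intro η ξ
    refine le_of_tendsto (hc' η ξ).norm (hC.mono fun x hx => ?_)
    rw [norm_inner_symm]
    refine (norm_inner_apply_le _ _ _).trans ?_
    rw [mul_right_comm]
    gcongr
  refine ⟨InnerProductSpace.continuousLinearMapOfBilin (B.mkContinuous₂ C hB), fun ξ η => ?_⟩
  have h : (inner ℂ ξ (InnerProductSpace.continuousLinearMapOfBilin
      (B.mkContinuous₂ C hB) η) : ℂ) = c ξ η := by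
    rw [← inner_conj_symm, InnerProductSpace.continuousLinearMapOfBilin_apply]
    exact star_star (c ξ η)
  rw [h]
  exact hc ξ η

theorem exists_limit_of_bounded {X : Type v} (f : Ultrafilter X) {g : X → ℂ} {C : ℝ}
    (h : ∀ᶠ x in (f : Filter X), ‖g x‖ ≤ C) :
    ∃ c : ℂ, Filter.Tendsto g f (nhds c) := by
  have h1 : (f.map g : Filter ℂ) ≤ Filter.principal (Metric.closedBall 0 C) := by
    rw [Filter.le_principal_iff]
    exact Filter.mem_map.2 (h.mono fun x hx => by simpa using hx)
  obtain ⟨c, -, hc⟩ := (isCompact_closedBall (0 : ℂ) C).ultrafilter_le_nhds (f.map g) h1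
  exact ⟨c, hc⟩

end Limits

/-! ### Compactness of the set of ccp maps and stability under direct sums -/

section CCP

variable {H : Type w} [NormedAddCommGroup H] [InnerProductSpace ℂ H] [CompleteSpace H]
variable {E : Type u} [AddCommGroup E] [Module ℂ E] [StarAddMonoid E] [MatrixNorm E] [MatrixCone E]

theorem IsCCP.norm_le {φ : E →ₗ[ℂ] (H →L[ℂ] H)} (hφ : IsCCP φ) (e : E) : ‖φ e‖ ≤ norm₁ e := by
  rw [← norm_opMatrix_one]
  exact hφ.contractive 1 (fun _ _ => e)

/-- Along an ultrafilter the uniformly bounded matrix coefficients converge and define a limit map.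
The ccp conditions are closed under convergence of coefficients, and the uniform bound `‖φ e‖ ≤
norm₁ e` upgrades weak to weak* convergence. -/
theorem isCompact_setOf_isCCP :
    @IsCompact _ (pointWeakStarTopology E H) {φ : E →ₗ[ℂ] (H →L[ℂ] H) | IsCCP φ} := by
  let _ := pointWeakStarTopology E H
  rw [isCompact_iff_ultrafilter_le_nhds]
  intro f hf
  have hccp : ∀ᶠ φ in (f : Filter (E →ₗ[ℂ] (H →L[ℂ] H))), IsCCP φ :=
    Filter.le_principal_iff.1 hf
  have hS : ∀ e : E, ∃ S : H →L[ℂ] H, ∀ ξ η, Filter.Tendsto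
      (fun φ : E →ₗ[ℂ] (H →L[ℂ] H) => (inner ℂ ξ (φ e η) : ℂ)) f (nhds (inner ℂ ξ (S η))) := by
    intro e
    have hb : ∀ᶠ φ in (f : Filter (E →ₗ[ℂ] (H →L[ℂ] H))), ‖φ e‖ ≤ norm₁ e :=
      hccp.mono fun φ hφ => hφ.norm_le e
    refine exists_weak_limit_operator hb fun ξ η => ?_
    refine exists_limit_of_bounded (C := norm₁ e * ‖ξ‖ * ‖η‖) f (hb.mono fun φ hφ => ?_)
    refine (norm_inner_apply_le _ _ _).trans ?_
    gcongr
  choose S hS using hS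
  let y : E →ₗ[ℂ] (H →L[ℂ] H) :=
    { toFun := S
      map_add' := fun a b => by
        refine ContinuousLinearMap.ext fun η => ext_inner_left ℂ fun ξ => ?_
        refine tendsto_nhds_unique (hS (a + b) ξ η) ?_
        rw [_root_.add_apply, inner_add_right]
        refine ((hS a ξ η).add (hS b ξ η)).congr fun φ => ?_
        rw [map_add, _root_.add_apply, inner_add_right]
      map_smul' := fun c a => by
        refine ContinuousLinearMap.ext fun η => ext_inner_left ℂ fun ξ => ?_
        refine tendsto_nhds_unique (hS (c • a) ξ η) ?_
        rw [RingHom.id_apply, _root_.smul_apply, inner_smul_right]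
        refine ((hS a ξ η).const_mul c).congr fun φ => ?_
        rw [map_smul, _root_.smul_apply, inner_smul_right] }
  have hy : ∀ e ξ η, Filter.Tendsto
      (fun φ : E →ₗ[ℂ] (H →L[ℂ] H) => (inner ℂ ξ (φ e η) : ℂ)) f (nhds (inner ℂ ξ (y e η))) := hS
  have hmat : ∀ (k : ℕ) (x : Matrix (Fin k) (Fin k) E) (ξ η : PiLp 2 (fun _ : Fin k => H)),
      Filter.Tendsto (fun φ : E →ₗ[ℂ] (H →L[ℂ] H) => (inner ℂ ξ (opMatrix (x.map φ) η) : ℂ)) f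
        (nhds (inner ℂ ξ (opMatrix (x.map y) η))) := by
    intro k x ξ η
    simp only [inner_opMatrix]
    exact tendsto_finsetSum _ fun i _ => tendsto_finsetSum _ fun j _ => hy _ _ _
  have hyccp : IsCCP y := by
    refine ⟨fun e => ?_, fun k x => ?_, fun k x hx => ?_⟩
    · refine ContinuousLinearMap.ext fun η => ext_inner_left ℂ fun ξ => ?_
      refine tendsto_nhds_unique (hy (star e) ξ η) ?_
      rw [ContinuousLinearMap.star_eq_adjoint, ContinuousLinearMap.adjoint_inner_right,
        ← inner_conj_symm]
      refine (hy e η ξ).star.congr' (hccp.mono fun φ hφ => ?_)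
      change star (inner ℂ η (φ e ξ)) = inner ℂ ξ (φ (star e) η)
      rw [hφ.map_star, ContinuousLinearMap.star_eq_adjoint,
        ContinuousLinearMap.adjoint_inner_right]
      exact inner_conj_symm _ _
    -- No norm axioms are assumed for `E`; the matrix norm is nonnegative because it dominates the
    -- norm of a value of a ccp map.
    · obtain ⟨φ₀, hφ₀⟩ := hccp.exists
      have h0 : 0 ≤ MatrixNorm.mnorm k x := (norm_nonneg _).trans (hφ₀.contractive k x)
      refine opNorm_le_of_inner_le _ h0 fun ξ η => ?_
      refine le_of_tendsto (hmat k x ξ η).norm (hccp.mono fun φ hφ => ?_)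
      refine (norm_inner_apply_le _ _ _).trans ?_
      gcongr
      exact hφ.contractive k x
    · refine (isPositive_iff_inner_nonneg _).2 fun ξ => ?_
      exact ge_of_tendsto (hmat k x ξ ξ)
        (hccp.mono fun φ hφ => (isPositive_iff_inner_nonneg _).1 (hφ.positive k x hx) ξ)
  refine ⟨y, hyccp, ?_⟩
  rw [@nhds_induced _ _ (@Pi.topologicalSpace E (fun _ => H →L[ℂ] H) fun _ => weakStarTopology H),
    ← Filter.tendsto_iff_comap]
  refine (@tendsto_pi_nhds _ _ _ (fun _ => weakStarTopology H) _ _ _).2 fun e => ?_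
  rw [nhds_induced, Filter.tendsto_comap_iff]
  refine tendsto_pi_nhds.2 fun p => ?_
  -- Each summand of a normal functional converges, and the sums are dominated independently of `φ`.
  refine tendsto_tsum_of_dominated_convergence
    ((summable_norm_sq_add p.1 p.2).mul_left (norm₁ e)) (fun k => hy e _ _)
    (hccp.mono fun φ hφ k => ?_)
  refine (norm_inner_apply_le_sq _ _ _).trans ?_
  gcongr
  exact hφ.norm_le e

theorem hasSum_norm_sq_adjoint {I : Type v} {n : NZCard.{v}} {m : I → NZCard.{v}}
    {α : ∀ i, Hil (m i) →ₗᵢ[ℂ] Hil n} (h1 : IsOpSum α (fun _ => 1) 1) {k : ℕ}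
    (ξ : PiLp 2 (fun _ : Fin k => Hil n)) :
    HasSum (fun i => ‖diagOp k (α i).toContinuousLinearMap.adjoint ξ‖ ^ 2) (‖ξ‖ ^ 2) := by
  simp only [PiLp.norm_sq_eq_of_L2]
  refine hasSum_sum fun a _ => ?_
  have h := h1 (ξ a) (ξ a)
  have e : ∀ i, (inner ℂ (ξ a) (α i ((1 : Op (m i))
      ((α i).toContinuousLinearMap.adjoint (ξ a)))) : ℂ) =
      ((‖(α i).toContinuousLinearMap.adjoint (ξ a)‖ ^ 2 : ℝ) : ℂ) := by
    intro i
    have := ContinuousLinearMap.adjoint_inner_left (α i).toContinuousLinearMap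
      ((α i).toContinuousLinearMap.adjoint (ξ a)) (ξ a)
    rw [inner_self_eq_ofReal] at this
    exact this.symm
  simp only [e] at h
  rw [one_apply_eq_self, inner_self_eq_ofReal] at h
  have h' : HasSum (fun i => ‖(α i).toContinuousLinearMap.adjoint (ξ a)‖ ^ 2) (‖ξ a‖ ^ 2) := by
    exact_mod_cast h
  exact h'

theorem hasSum_inner_opMatrix {I : Type v} {n : NZCard.{v}} {m : I → NZCard.{v}}
    {α : ∀ i, Hil (m i) →ₗᵢ[ℂ] Hil n} {x : ∀ i, E →ₗ[ℂ] Op (m i)} {y : E →ₗ[ℂ] Op n}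
    (h : IsDirectSum α x y) {k : ℕ} (X : Matrix (Fin k) (Fin k) E)
    (ξ η : PiLp 2 (fun _ : Fin k => Hil n)) :
    HasSum (fun i => (inner ℂ (diagOp k (α i).toContinuousLinearMap.adjoint ξ)
      (opMatrix (X.map (x i)) (diagOp k (α i).toContinuousLinearMap.adjoint η)) : ℂ))
      (inner ℂ ξ (opMatrix (X.map y) η)) := by
  simp only [inner_opMatrix]
  refine hasSum_sum fun a _ => hasSum_sum fun b _ => ?_
  have h1 := h.sum_eq (X a b) (ξ a) (η b)
  refine HasSum.congr_fun h1 fun i => ?_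
  exact ContinuousLinearMap.adjoint_inner_left _ _ _

theorem isCCP_of_isDirectSum (hE : IsOperatorSpace E) {I : Type v}
    {n : NZCard.{v}} {m : I → NZCard.{v}}
    {α : ∀ i, Hil (m i) →ₗᵢ[ℂ] Hil n} {x : ∀ i, E →ₗ[ℂ] Op (m i)} {y : E →ₗ[ℂ] Op n}
    (h : IsDirectSum α x y) (hx : ∀ i, IsCCP (x i)) : IsCCP y := by
  refine ⟨fun e => ?_, fun k X => ?_, fun k X hX => ?_⟩
  · refine ContinuousLinearMap.ext fun η => ext_inner_left ℂ fun ξ => ?_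
    refine (h.sum_eq (star e) ξ η).unique ?_
    have h2 := isOpSum_star (h.sum_eq e) ξ η
    simpa only [(hx _).map_star] using h2
  · have h0 := mnorm_nonneg hE k X
    refine ContinuousLinearMap.opNorm_le_of_re_inner_le h0 fun ξ η hξ hη => ?_
    refine (RCLike.re_le_norm _).trans ?_
    rw [norm_inner_symm]
    have hs := hasSum_inner_opMatrix h X η ξ
    -- For unit columns, `a b ≤ (a² + b²) / 2` in each summand, together with Parseval for both
    -- columns, gives the total bound `mnorm k X`.
    have hb := ((hasSum_norm_sq_adjoint h.sum_eq_one η).add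
      (hasSum_norm_sq_adjoint h.sum_eq_one ξ)).mul_left (MatrixNorm.mnorm k X / 2)
    rw [hξ, hη] at hb
    rw [← hs.tsum_eq]
    refine (tsum_of_norm_bounded hb fun i => ?_).trans (by linarith)
    refine (norm_inner_apply_le _ _ _).trans ?_
    refine (mul_le_mul_of_nonneg_right (mul_le_mul_of_nonneg_right ((hx i).contractive k X)
      (norm_nonneg _)) (norm_nonneg _)).trans ?_
    nlinarith [mul_nonneg h0 (sq_nonneg (‖diagOp k (α i).toContinuousLinearMap.adjoint η‖ -
      ‖diagOp k (α i).toContinuousLinearMap.adjoint ξ‖))]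
  · refine (isPositive_iff_inner_nonneg _).2 fun ξ => ?_
    exact (hasSum_inner_opMatrix h X ξ ξ).nonneg fun i =>
      (isPositive_iff_inner_nonneg _).1 ((hx i).positive k X hX) _

end CCP

theorem isCompactNCConvex_quasistates (S : OpSys.{u}) :
    IsCompactNCConvex (quasistates.{u, v} S) where
  completelyBounded n x hx := ⟨1, fun k X => by rw [one_mul]; exact hx.contractive k X⟩
  directSum_mem I n m α x y hx _ h :=
    isCCP_of_isDirectSum S.isOperatorSystem.toIsOperatorSpace h hx
  compress_mem m n β x hx := IsCCP.compressMap (norm_isometry_le β) hx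
  compact n := isCompact_setOf_isCCP

/-! ### Functionals on `M_k(E)` and maps from `E` to `M_k` -/

section FunctionalMap

variable {E : Type u} [AddCommGroup E] [Module ℂ E] {k l : ℕ}

/-- The map `E → M_k` that corresponds to a functional on `M_k(E)`. -/
noncomputable def mapOfFunctional (F : Matrix (Fin k) (Fin k) E →ₗ[ℂ] ℂ) :
    E →ₗ[ℂ] (EuclideanSpace ℂ (Fin k) →L[ℂ] EuclideanSpace ℂ (Fin k)) where
  toFun e := Matrix.toEuclideanCLM (n := Fin k) (𝕜 := ℂ)
    (Matrix.of fun i j => F (Matrix.single i j e))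
  map_add' a b := by
    rw [← map_add]
    congr 1
    ext i j
    simp [Matrix.single_add]
  map_smul' c a := by
    rw [RingHom.id_apply, ← map_smul]
    congr 1
    ext i j
    simp [← Matrix.smul_single]

theorem inner_mapOfFunctional (F : Matrix (Fin k) (Fin k) E →ₗ[ℂ] ℂ) (e : E)
    (ξ η : EuclideanSpace ℂ (Fin k)) : (inner ℂ ξ (mapOfFunctional F e η) : ℂ) =
      ∑ i, ∑ j, (star (ξ i) * η j) * F (Matrix.single i j e) := by
  rw [PiLp.inner_apply]
  refine Finset.sum_congr rfl fun i _ => ?_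
  have h : (mapOfFunctional F e η) i = ∑ j, F (Matrix.single i j e) * η j := rfl
  rw [h, inner_sum]
  refine Finset.sum_congr rfl fun j _ => ?_
  rw [RCLike.inner_apply]
  change _ * (starRingEnd ℂ) _ = (starRingEnd ℂ) _ * _ * _
  ring

/-- The matrix of coefficients of a column of vectors. -/
def coeffMatrix (ξ : PiLp 2 (fun _ : Fin l => EuclideanSpace ℂ (Fin k))) :
    Matrix (Fin l) (Fin k) ℂ := fun a i => ξ a i

/-- The coefficients of the amplified map, at every matrix size `l`, are values of the single
functional `F` on scalar compressions of `X` to size `k`. Complete contractivity and complete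
positivity thus reduce to properties of `F`. -/
theorem inner_opMatrix_mapOfFunctional (F : Matrix (Fin k) (Fin k) E →ₗ[ℂ] ℂ)
    (X : Matrix (Fin l) (Fin l) E) (ξ η : PiLp 2 (fun _ : Fin l => EuclideanSpace ℂ (Fin k))) :
    (inner ℂ ξ (opMatrix (X.map (mapOfFunctional F)) η) : ℂ) =
      F (scalarConj (coeffMatrix ξ).conjTranspose X (coeffMatrix η)) := by
  rw [inner_opMatrix, Matrix.matrix_eq_sum_single (scalarConj _ X _)]
  simp only [Matrix.map_apply, inner_mapOfFunctional, map_sum]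
  have h : ∀ i j, F (Matrix.single i j (scalarConj (coeffMatrix ξ).conjTranspose X
      (coeffMatrix η) i j)) =
      ∑ a, ∑ b, (star (ξ a i) * η b j) * F (Matrix.single i j (X a b)) := by
    intro i j
    have h1 : Matrix.single i j (scalarConj (coeffMatrix ξ).conjTranspose X
        (coeffMatrix η) i j) =
        ∑ a, ∑ b, (star (ξ a i) * η b j) • Matrix.single i j (X a b) := by
      ext i' j'
      simp only [Matrix.sum_apply, Matrix.smul_apply, Matrix.single_apply, scalarConj]
      split_ifs <;> simp [coeffMatrix]
    rw [h1]
    simp only [map_sum, map_smul, smul_eq_mul]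
  simp only [h]
  rw [Finset.sum_congr rfl fun a _ => Finset.sum_comm, Finset.sum_comm]
  refine Finset.sum_congr rfl fun i _ => ?_
  rw [Finset.sum_congr rfl fun a _ => Finset.sum_comm, Finset.sum_comm]

open scoped Matrix.Norms.L2Operator in
-- The operator norm is at most the Hilbert–Schmidt norm, by Cauchy–Schwarz in each row.
theorem norm_coeffMatrix_le (ξ : PiLp 2 (fun _ : Fin l => EuclideanSpace ℂ (Fin k))) :
    ‖coeffMatrix ξ‖ ≤ ‖ξ‖ := by
  rw [Matrix.l2_opNorm_def]
  refine ContinuousLinearMap.opNorm_le_bound _ (norm_nonneg _) fun w => ?_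
  refine le_of_sq_le_sq ?_ (by positivity)
  rw [mul_pow, PiLp.norm_sq_eq_of_L2, PiLp.norm_sq_eq_of_L2, Finset.sum_mul]
  refine Finset.sum_le_sum fun a _ => ?_
  rw [← mul_pow]
  refine pow_le_pow_left₀ (norm_nonneg _) ?_ 2
  have h := norm_inner_le_norm (𝕜 := ℂ) (WithLp.toLp 2 fun i => star (ξ a i)) w
  have h1 : ‖WithLp.toLp 2 fun i => star (ξ a i)‖ = ‖ξ a‖ := by
    rw [EuclideanSpace.norm_eq, EuclideanSpace.norm_eq]
    simp
  rw [h1] at h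
  refine le_trans (le_of_eq (congrArg norm ?_)) h
  change ∑ i, ξ a i * w i = _
  rw [PiLp.inner_apply]
  refine Finset.sum_congr rfl fun i _ => ?_
  rw [RCLike.inner_apply]
  simp [mul_comm]

variable [StarAddMonoid E] [MatrixNorm E] [MatrixCone E]

open scoped Matrix.Norms.L2Operator in
theorem isCCP_mapOfFunctional [StarModule ℂ E] (hE : IsMatrixOrderedOperatorSpace E)
    {F : Matrix (Fin k) (Fin k) E →ₗ[ℂ] ℂ} (hF : ∀ x, ‖F x‖ ≤ MatrixNorm.mnorm k x)
    (hstar : ∀ x, F x.conjTranspose = star (F x))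
    (hpos : ∀ x ∈ MatrixCone.cone (E := E) k, 0 ≤ F x) : IsCCP (mapOfFunctional F) where
  map_star e := by
    change Matrix.toEuclideanCLM (n := Fin k) (𝕜 := ℂ) _ =
      star (Matrix.toEuclideanCLM (n := Fin k) (𝕜 := ℂ) _)
    rw [← map_star]
    congr 1
    ext i j
    rw [Matrix.star_apply, Matrix.of_apply, Matrix.of_apply, ← hstar, Matrix.conjTranspose_single]
  contractive n X := by
    have h0 := mnorm_nonneg hE.toIsOperatorSpace n X
    refine opNorm_le_of_inner_le _ h0 fun ξ η => ?_
    rw [inner_opMatrix_mapOfFunctional]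
    refine (hF _).trans ((hE.conj_le _ _ _ _ _).trans ?_)
    rw [Matrix.l2_opNorm_conjTranspose, mul_comm ‖coeffMatrix ξ‖]
    exact mul_le_mul (mul_le_mul_of_nonneg_left (norm_coeffMatrix_le ξ) h0)
      (norm_coeffMatrix_le η) (norm_nonneg (coeffMatrix η)) (mul_nonneg h0 (norm_nonneg _))
  positive n X hX := by
    refine (isPositive_iff_inner_nonneg _).2 fun ξ => ?_
    rw [inner_opMatrix_mapOfFunctional]
    refine hpos _ ?_
    have h := hE.conj_mem_cone k n (coeffMatrix ξ).conjTranspose X hX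
    rwa [Matrix.conjTranspose_conjTranspose] at h

end FunctionalMap

/-- Separation of a self-adjoint point from a closed convex cone of self-adjoint points. -/
theorem exists_positive_functional {M : Type u} [NormedAddCommGroup M] [NormedSpace ℂ M]
    {σ : M → M} (hσa : ∀ x y, σ (x + y) = σ x + σ y) (hσs : ∀ (c : ℂ) x, σ (c • x) = star c • σ x)
    (hσn : ∀ x, ‖σ x‖ = ‖x‖) (hσσ : ∀ x, σ (σ x) = x) {P : Set M} (hP : IsClosed P)
    (h0 : 0 ∈ P) (hadd : ∀ x ∈ P, ∀ y ∈ P, x + y ∈ P)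
    (hsmul : ∀ t : ℝ, 0 ≤ t → ∀ x ∈ P, (t : ℂ) • x ∈ P) (hσP : ∀ x ∈ P, σ x = x) {x : M}
    (hσx : σ x = x) (hx : x ∉ P) :
    ∃ F : M →ₗ[ℂ] ℂ, (∀ y, ‖F y‖ ≤ ‖y‖) ∧ (∀ y, F (σ y) = star (F y)) ∧ (∀ y ∈ P, 0 ≤ F y) ∧
      ¬ 0 ≤ F x := by
  have hconv : Convex ℝ P := by
    intro a ha b hb s t hs ht _
    exact hadd _ (hsmul s hs a ha) _ (hsmul t ht b hb)
  obtain ⟨f, r, hfx, hfP⟩ := geometric_hahn_banach_point_closed hconv hP hx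
  have hr : r < 0 := by simpa using hfP 0 h0
  have hfP0 : ∀ b ∈ P, 0 ≤ f b := by
    intro b hb
    by_contra hneg
    have hneg := not_le.1 hneg
    -- If `f b < 0`, the point `(r / f b) b` of the cone would have value exactly `r`, against the
    -- strict separation.
    have ht : 0 ≤ r / f b := div_nonneg_of_nonpos hr.le hneg.le
    have h := hfP _ (hsmul _ ht b hb)
    have e : f (((r / f b : ℝ) : ℂ) • b) = (r / f b) • f b := f.map_smul (r / f b) b
    rw [e, smul_eq_mul, div_mul_cancel₀ _ hneg.ne] at h
    exact lt_irrefl _ h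
  let G : M →L[ℂ] ℂ := StrongDual.extendRCLike f
  have hG : ∀ y, (G y).re = f y := fun y => StrongDual.re_extendRCLike_apply (𝕜 := ℂ) f y
  -- The factor makes the symmetrized functional contractive: its two summands are each at most
  -- `(‖G‖ + 1) ‖y‖`.
  let C : ℝ := (‖G‖ + 1)⁻¹ / 2
  have hC : 0 < C := by positivity
  -- Averaging with the involution makes the functional self-adjoint. On self-adjoint points it
  -- remains a positive multiple of `f`, so the separation persists.
  let F : M →ₗ[ℂ] ℂ :=
    { toFun := fun y => (C : ℂ) * (G y + star (G (σ y)))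
      map_add' := fun a b => by rw [hσa, map_add, map_add, star_add]; ring
      map_smul' := fun c a => by
        rw [hσs, map_smul, map_smul, smul_eq_mul, smul_eq_mul, star_mul, star_star,
          RingHom.id_apply, smul_eq_mul]
        ring }
  have hFapply : ∀ y, F y = (C : ℂ) * (G y + star (G (σ y))) := fun y => rfl
  have hself : ∀ y, σ y = y → F y = ((C * (2 * f y) : ℝ) : ℂ) := by
    intro y hy
    have h2 : G y + star (G y) = ((2 * (G y).re : ℝ) : ℂ) := Complex.add_conj _
    rw [hFapply, hy, h2, hG, ← Complex.ofReal_mul]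
  refine ⟨F, fun y => ?_, fun y => ?_, fun y hy => ?_, ?_⟩
  · rw [hFapply, norm_mul, Complex.norm_real, Real.norm_of_nonneg hC.le]
    have h1 : ‖G y + star (G (σ y))‖ ≤ 2 * ((‖G‖ + 1) * ‖y‖) := by
      refine (norm_add_le _ _).trans ?_
      rw [norm_star]
      have h2 := G.le_opNorm y
      have h3 := G.le_opNorm (σ y)
      rw [hσn] at h3
      nlinarith [norm_nonneg y]
    refine (mul_le_mul_of_nonneg_left h1 hC.le).trans (le_of_eq ?_)
    simp only [C]
    field_simp
  · rw [hFapply, hFapply, hσσ, star_mul, star_add, star_star]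
    have : star (C : ℂ) = C := Complex.conj_ofReal C
    rw [this]
    ring
  · rw [hself y (hσP y hy), Complex.zero_le_real]
    have := hfP0 y hy
    positivity
  · rw [hself x hσx, Complex.zero_le_real, not_le]
    exact mul_neg_of_pos_of_neg hC (by linarith)

theorem scalarConj_one {E : Type u} [AddCommGroup E] [Module ℂ E] {k : ℕ}
    (x : Matrix (Fin k) (Fin k) E) (c d : ℂ) :
    scalarConj (c • (1 : Matrix (Fin k) (Fin k) ℂ)) x (d • (1 : Matrix (Fin k) (Fin k) ℂ)) =
      (c * d) • x := by
  ext i j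
  rw [scalarConj, Finset.sum_eq_single i, Finset.sum_eq_single j]
  · simp
  · intro b _ hb
    simp [hb]
  · simp
  · intro a _ ha
    simp [Ne.symm ha]
  · simp

/-- A self-adjoint matrix over a matrix ordered operator space is positive if its images under
all ccp maps into matrix algebras are. -/
theorem IsMatrixOrderedOperatorSpace.mem_cone_of_forall_isCCP {E : Type u} [AddCommGroup E]
    [Module ℂ E] [StarAddMonoid E] [StarModule ℂ E] [MatrixNorm E] [MatrixCone E]
    (hE : IsMatrixOrderedOperatorSpace E) {k : ℕ} {x : Matrix (Fin k) (Fin k) E}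
    (hx : x.IsHermitian)
    (h : ∀ φ : E →ₗ[ℂ] (EuclideanSpace ℂ (Fin k) →L[ℂ] EuclideanSpace ℂ (Fin k)),
      IsCCP φ → (opMatrix (x.map φ)).IsPositive) : x ∈ MatrixCone.cone (E := E) k := by
  by_contra hmem
  let N : AddGroupNorm (Matrix (Fin k) (Fin k) E) :=
    { toFun := MatrixNorm.mnorm k
      map_zero' := by simpa using hE.smul_eq k 0 0
      add_le' := hE.add_le k
      neg' := fun a => by simpa using hE.smul_eq k (-1) a
      eq_zero_of_map_eq_zero' := hE.eq_zero k }
  let _ : NormedAddCommGroup (Matrix (Fin k) (Fin k) E) := N.toNormedAddCommGroup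
  let _ : NormedSpace ℂ (Matrix (Fin k) (Fin k) E) := ⟨fun c a => (hE.smul_eq k c a).le⟩
  obtain ⟨F, hF1, hF2, hF3, hF4⟩ := exists_positive_functional
    (M := Matrix (Fin k) (Fin k) E) (σ := Matrix.conjTranspose)
    (P := MatrixCone.cone (E := E) k) (x := x) Matrix.conjTranspose_add
    Matrix.conjTranspose_smul (hE.mnorm_star k) Matrix.conjTranspose_conjTranspose
    (IsSeqClosed.isClosed fun s y hs hy => hE.cone_closed k s y hs
      (tendsto_iff_norm_sub_tendsto_zero.1 hy))
    (hE.zero_mem_cone k) (hE.add_mem_cone k)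
    (fun t ht y hy => by
      -- Scaling by `t ≥ 0` is conjugation by `√t 1`.
      have h1 := hE.conj_mem_cone k k ((Real.sqrt t : ℂ) • 1) y hy
      rw [Matrix.conjTranspose_smul, Matrix.conjTranspose_one, scalarConj_one] at h1
      have e : (Real.sqrt t : ℂ) * star (Real.sqrt t : ℂ) = t := by
        have : star (Real.sqrt t : ℂ) = Real.sqrt t := Complex.conj_ofReal _
        rw [this, ← Complex.ofReal_mul, Real.mul_self_sqrt ht]
      rwa [e] at h1)
    (fun y hy => hE.cone_isHermitian k y hy) hx hmem
  have hp := (isPositive_iff_inner_nonneg _).1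
    (h _ (isCCP_mapOfFunctional hE hF1 hF2 hF3))
    -- The column of standard basis vectors has the identity as its coefficient matrix, so the form
    -- there returns `F x` itself.
    (WithLp.toLp 2 fun a => EuclideanSpace.single a (1 : ℂ))
  rw [inner_opMatrix_mapOfFunctional] at hp
  have e : coeffMatrix (WithLp.toLp 2 fun a : Fin k => EuclideanSpace.single a (1 : ℂ)) =
      (1 : ℂ) • 1 := by
    ext a i
    simp [coeffMatrix, Matrix.one_apply, eq_comm]
  rw [e, Matrix.conjTranspose_smul, Matrix.conjTranspose_one, scalarConj_one] at hp
  simp only [star_one, mul_one, one_smul] at hp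
  exact hF4 hp

/-! ### Quasistates determine norm and order -/

/-- The infinite countable dimension. -/
noncomputable def countableCard : NZCard.{v} := ⟨Cardinal.aleph0, Cardinal.aleph0_ne_zero⟩

theorem orthonormal_single {n : NZCard.{v}} [DecidableEq n.Index] :
    Orthonormal ℂ (fun i : n.Index => (lp.single 2 i (1 : ℂ) : Hil n)) := by
  rw [orthonormal_iff_ite]
  intro i j
  rw [lp.inner_single_left]
  simp [lp.single_apply, Pi.single_apply]

theorem exists_isometry_euclidean (k : ℕ) :
    Nonempty (EuclideanSpace ℂ (Fin k) →ₗᵢ[ℂ] Hil countableCard.{v}) := by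
  classical
  have : Infinite (countableCard.{v}).Index := by
    rw [Cardinal.infinite_iff, NZCard.mk_index]
    rfl
  let f : Fin k → (countableCard.{v}).Index :=
    fun i => Infinite.natEmbedding (countableCard.{v}).Index i
  have hf : Function.Injective f := fun i j h =>
    Fin.ext ((Infinite.natEmbedding (countableCard.{v}).Index).injective h)
  obtain ⟨J, -⟩ := exists_isometry_of_orthonormal (orthonormal_single.comp f hf)
  exact ⟨J⟩

/-- Operator systems are tested by maps into operators on Euclidean spaces, while quasistates act on
the spaces `H_n`. With an isometry `J` into `ℓ²(ℵ₀)`, one level serves for all `k`: `ψ = J φ J*` is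
a quasistate and `J* ψ J = φ`. -/
theorem exists_quasistate_dilation {E : Type u} [AddCommGroup E] [Module ℂ E] [StarAddMonoid E]
    [MatrixNorm E] [MatrixCone E] {k : ℕ}
    {φ : E →ₗ[ℂ] (EuclideanSpace ℂ (Fin k) →L[ℂ] EuclideanSpace ℂ (Fin k))} (hφ : IsCCP φ) :
    ∃ ψ : E →ₗ[ℂ] Op countableCard.{v}, IsCCP ψ ∧
      ∃ V : EuclideanSpace ℂ (Fin k) →L[ℂ] Hil countableCard.{v}, ‖V‖ ≤ 1 ∧
        φ = compressMap V ψ := by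
  obtain ⟨J⟩ := exists_isometry_euclidean.{v} k
  refine ⟨compressMap J.toContinuousLinearMap.adjoint φ,
    hφ.compressMap (norm_adjoint_isometry_le J), J.toContinuousLinearMap, norm_isometry_le J, ?_⟩
  refine LinearMap.ext fun e => ContinuousLinearMap.ext fun η => ext_inner_left ℂ fun ξ => ?_
  rw [inner_compressMap, inner_compressMap]
  change _ = inner ℂ (J.toContinuousLinearMap.adjoint (J ξ))
    (φ e (J.toContinuousLinearMap.adjoint (J η)))
  rw [adjoint_isometry_apply, adjoint_isometry_apply]

theorem mnorm_le_of_quasistates (S : OpSys.{u}) {k : ℕ} (x : Matrix (Fin k) (Fin k) S.carrier)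
    {C : ℝ} (hC : 0 ≤ C) (h : ∀ (n : NZCard.{v}), ∀ φ ∈ quasistates.{u, v} S n,
      ‖opMatrix (x.map φ)‖ ≤ C) : MatrixNorm.mnorm k x ≤ C := by
  refine S.isOperatorSystem.mnorm_le x hC fun φ hφ => ?_
  obtain ⟨ψ, hψ, V, hV, rfl⟩ := exists_quasistate_dilation.{u, v} hφ
  exact (norm_opMatrix_compressMap_le hV ψ x).trans (h _ ψ hψ)

theorem mem_cone_of_quasistates (S : OpSys.{u}) {k : ℕ} {x : Matrix (Fin k) (Fin k) S.carrier}
    (hx : x.IsHermitian) (h : ∀ (n : NZCard.{v}), ∀ φ ∈ quasistates.{u, v} S n,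
      (opMatrix (x.map φ)).IsPositive) : x ∈ MatrixCone.cone (E := S.carrier) k := by
  refine S.isOperatorSystem.mem_cone_of_forall_isCCP hx fun φ hφ => ?_
  obtain ⟨ψ, hψ, V, -, rfl⟩ := exists_quasistate_dilation.{u, v} hφ
  refine (isPositive_iff_inner_nonneg _).2 fun ξ => ?_
  rw [inner_opMatrix_compressMap]
  exact (isPositive_iff_inner_nonneg _).1 (h _ ψ hψ) _

/-! ### Reduction to the first level by vector states -/

section UnitVector

variable {e : Hil (1 : NZCard.{v})}

theorem unitIsometry_apply_self (he : ∀ w : Hil (1 : NZCard.{v}), ‖(inner ℂ e w : ℂ)‖ = ‖w‖)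
    (he1 : ‖e‖ = 1) {n : NZCard.{v}} (η : Hil n) (hη : ‖η‖ = 1) :
    unitIsometry e he η hη e = η := by
  change (inner ℂ e e : ℂ) • η = η
  rw [inner_self_eq_ofReal, he1]
  simp

theorem adjoint_unitIsometry_apply (he : ∀ w : Hil (1 : NZCard.{v}), ‖(inner ℂ e w : ℂ)‖ = ‖w‖)
    {n : NZCard.{v}} (η : Hil n) (hη : ‖η‖ = 1) (ξ : Hil n) :
    (unitIsometry e he η hη).toContinuousLinearMap.adjoint ξ = (inner ℂ η ξ : ℂ) • e := by
  refine ext_inner_left ℂ fun w => ?_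
  rw [ContinuousLinearMap.adjoint_inner_right]
  change inner ℂ ((inner ℂ e w : ℂ) • η) ξ = _
  rw [inner_smul_left, inner_smul_right, inner_conj_symm, mul_comm]

theorem op_one_eq_zero (he : ∀ w : Hil (1 : NZCard.{v}), ‖(inner ℂ e w : ℂ)‖ = ‖w‖)
    (he1 : ‖e‖ = 1) {T : Op (1 : NZCard.{v})} (hT : (inner ℂ e (T e) : ℂ) = 0) : T = 0 := by
  have h1 : T e = 0 := by
    rw [← norm_eq_zero, ← he, hT, norm_zero]
  ext1 w
  have h2 : w = (inner ℂ e w : ℂ) • e := by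
    rw [← sub_eq_zero, ← norm_eq_zero, ← he, inner_sub_right, inner_smul_right,
      inner_self_eq_ofReal, he1]
    simp
  rw [h2, map_smul, h1, smul_zero, _root_.zero_apply]

variable {E : Type u} [AddCommGroup E] [Module ℂ E] [MatrixNorm E] {K : NCSet.{u, v} E} {z : K 1}

/-- Every vector state of a point of `K` comes from a point of the first level. -/
theorem exists_vector_point (he : ∀ w : Hil (1 : NZCard.{v}), ‖(inner ℂ e w : ℂ)‖ = ‖w‖)
    (he1 : ‖e‖ = 1) (hK : IsCompactNCConvex K) {n : NZCard.{v}} (x : K n) {η : Hil n}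
    (hη : ‖η‖ = 1) : ∃ y : K 1, (∀ s, (inner ℂ e (y.1 s e) : ℂ) = inner ℂ η (x.1 s η)) ∧
      ∀ a : PointedAff K z, (inner ℂ e (a.1 1 y e) : ℂ) = inner ℂ η (a.1 n x η) := by
  have hc : ∀ T : Op n, (inner ℂ e (compressOp (unitIsometry e he η hη) T e) : ℂ) =
      inner ℂ η (T η) := by
    intro T
    simp only [compressOp, ContinuousLinearMap.comp_apply]
    rw [ContinuousLinearMap.adjoint_inner_right]
    change (inner ℂ (unitIsometry e he η hη e) (T (unitIsometry e he η hη e)) : ℂ) = _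
    rw [unitIsometry_apply_self he he1]
  refine ⟨⟨compressPoint (unitIsometry e he η hη) x.1, hK.compress_mem _ _ _ _ x.2⟩,
    fun s => hc _, fun a => ?_⟩
  rw [a.2.1.map_compress _ _ (unitIsometry e he η hη) x _ rfl]
  exact hc _

/-- A function in `A(K, z)` is determined by its values on the first level. -/
theorem pointedAff_eq_zero (he : ∀ w : Hil (1 : NZCard.{v}), ‖(inner ℂ e w : ℂ)‖ = ‖w‖)
    (he1 : ‖e‖ = 1) (hK : IsCompactNCConvex K) {a : PointedAff K z}
    (h : ∀ x : K 1, (inner ℂ e (a.1 1 x e) : ℂ) = 0) : a = 0 := by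
  refine Subtype.ext (funext fun n => funext fun x => ?_)
  refine norm_le_zero_iff.1 ((opNorm_le_of_numericalRadius _ (fun η hη => ?_) le_rfl).trans
    (by simp))
  obtain ⟨y, -, hy⟩ := exists_vector_point (z := z) he he1 hK x hη
  rw [← hy, h, norm_zero]

end UnitVector

/-! ### Convexity of the first level -/

section Convexity

variable {e : Hil (1 : NZCard.{v})}

theorem isOpSum_unitIsometry_one (he : ∀ w : Hil (1 : NZCard.{v}), ‖(inner ℂ e w : ℂ)‖ = ‖w‖)
    (he1 : ‖e‖ = 1) {n : NZCard.{v}} [DecidableEq n.Index] :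
    IsOpSum (m := fun _ : n.Index => 1)
      (fun k => unitIsometry e he (lp.single 2 k 1) (orthonormal_single.norm_eq_one k))
      (fun _ => 1) 1 := by
  intro ξ η
  refine HasSum.congr_fun (lp.hasSum_inner ξ η) fun k => ?_
  rw [adjoint_unitIsometry_apply, one_apply_eq_self, map_smul, unitIsometry_apply_self he he1,
    inner_smul_right, lp.inner_single_left, lp.inner_single_right]
  simp [mul_comm]

/-- In a direct sum of one-dimensional pieces along the standard basis, the form at `η` averages the
pieces with weights `|η k|²`. -/
theorem hasSum_of_isOpSum_unitIsometry
    (he : ∀ w : Hil (1 : NZCard.{v}), ‖(inner ℂ e w : ℂ)‖ = ‖w‖) {n : NZCard.{v}}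
    [DecidableEq n.Index] {T : n.Index → Op (1 : NZCard.{v})} {S : Op n}
    (h : IsOpSum (m := fun _ : n.Index => 1)
      (fun k => unitIsometry e he (lp.single 2 k 1) (orthonormal_single.norm_eq_one k)) T S)
    (η : Hil n) :
    HasSum (fun k => ((‖η k‖ ^ 2 : ℝ) : ℂ) * inner ℂ e (T k e)) (inner ℂ η (S η)) := by
  refine HasSum.congr_fun (h η η) fun k => ?_
  rw [adjoint_unitIsometry_apply, map_smul, map_smul, inner_smul_right, lp.inner_single_left]
  change _ = _ * inner ℂ η ((inner ℂ e (T k e) : ℂ) • (lp.single 2 k 1 : Hil n))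
  rw [inner_smul_right, lp.inner_single_right]
  have h1 : ((‖η k‖ ^ 2 : ℝ) : ℂ) = η k * star (η k) := by
    rw [Complex.ofReal_pow]
    exact (Complex.mul_conj' _).symm
  rw [h1]
  simp
  ring

/-- Convex combinations are compressions of direct sums: put `x ⊕ y` on `ℓ²(2)` and compress to the
vector with coordinates `√p` and `√q`. Both operations are respected by nc functions, so one point
`w` works for all `s` and all `a`. -/
theorem convex_combination_quasistates
    (he : ∀ w : Hil (1 : NZCard.{v}), ‖(inner ℂ e w : ℂ)‖ = ‖w‖) (he1 : ‖e‖ = 1) (S : OpSys.{u})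
    {z : quasistates.{u, v} S 1} (x y : quasistates.{u, v} S 1) {p q : ℝ} (hp : 0 ≤ p)
    (hq : 0 ≤ q) (hpq : p + q = 1) : ∃ w : quasistates.{u, v} S 1,
      (∀ s, (inner ℂ e (w.1 s e) : ℂ) = p * inner ℂ e (x.1 s e) + q * inner ℂ e (y.1 s e)) ∧
      ∀ a : PointedAff (quasistates.{u, v} S) z, (inner ℂ e (a.1 1 w e) : ℂ) =
        p * inner ℂ e (a.1 1 x e) + q * inner ℂ e (a.1 1 y e) := by
  classical
  have hK := isCompactNCConvex_quasistates.{u, v} S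
  let n : NZCard.{v} := ⟨2, two_ne_zero⟩
  obtain ⟨i, j, hij, huniv⟩ := Cardinal.mk_eq_two_iff.1 (NZCard.mk_index n)
  have hall : ∀ k : n.Index, k = i ∨ k = j := fun k => by
    have : k ∈ ({i, j} : Set n.Index) := huniv ▸ Set.mem_univ k
    simpa using this
  let _ : Fintype n.Index := ⟨{i, j}, fun k => by simpa using hall k⟩
  have hsum : ∀ f : n.Index → ℂ, ∑ k, f k = f i + f j := fun f => Finset.sum_pair hij
  let P : n.Index → quasistates.{u, v} S 1 := fun k => if k = i then x else y
  have hPi : P i = x := if_pos rfl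
  have hPj : P j = y := if_neg hij.symm
  let α : n.Index → (Hil (1 : NZCard.{v}) →ₗᵢ[ℂ] Hil n) := fun k =>
    unitIsometry e he (lp.single 2 k 1) (orthonormal_single.norm_eq_one k)
  let Y : S.carrier →ₗ[ℂ] Op n :=
    { toFun := fun s => ∑ k, (α k).toContinuousLinearMap ∘L (P k).1 s ∘L
        (α k).toContinuousLinearMap.adjoint
      map_add' := fun a b => by
        simp only [map_add, ContinuousLinearMap.add_comp, ContinuousLinearMap.comp_add,
          Finset.sum_add_distrib]
      map_smul' := fun c a => by
        simp only [map_smul, ContinuousLinearMap.smul_comp, ContinuousLinearMap.comp_smul,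
          Finset.smul_sum, RingHom.id_apply] }
  have hY : IsDirectSum (m := fun _ : n.Index => 1) α (fun k => (P k).1) Y := by
    refine ⟨isOpSum_unitIsometry_one he he1, fun s ξ η => ?_⟩
    have h : (inner ℂ ξ (Y s η) : ℂ) = ∑ k, inner ℂ ξ
        (α k ((P k).1 s ((α k).toContinuousLinearMap.adjoint η))) := by
      change inner ℂ ξ ((∑ k, (α k).toContinuousLinearMap ∘L (P k).1 s ∘L
        (α k).toContinuousLinearMap.adjoint) η) = _
      rw [_root_.sum_apply, inner_sum]
      rfl
    rw [h]
    exact hasSum_fintype _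
  have hYK : Y ∈ quasistates.{u, v} S n := hK.directSum_mem _ n _ α _ Y (fun k => (P k).2)
    ⟨1, fun k m X => by rw [one_mul]; exact (P k).2.contractive m X⟩ hY
  let η : Hil n := (Real.sqrt p : ℂ) • lp.single 2 i 1 + (Real.sqrt q : ℂ) • lp.single 2 j 1
  have hηk : ∀ k, η k = (Real.sqrt p : ℂ) * (lp.single 2 i (1 : ℂ) : Hil n) k +
      (Real.sqrt q : ℂ) * (lp.single 2 j (1 : ℂ) : Hil n) k := fun k => rfl
  have hηi : η i = Real.sqrt p := by
    rw [hηk]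
    simp [lp.single_apply, hij]
  have hηj : η j = Real.sqrt q := by
    rw [hηk]
    simp [lp.single_apply, hij.symm]
  have hni : ‖η i‖ ^ 2 = p := by
    rw [hηi, Complex.norm_real, Real.norm_of_nonneg (Real.sqrt_nonneg _), Real.sq_sqrt hp]
  have hnj : ‖η j‖ ^ 2 = q := by
    rw [hηj, Complex.norm_real, Real.norm_of_nonneg (Real.sqrt_nonneg _), Real.sq_sqrt hq]
  have hη : ‖η‖ = 1 := by
    have h1 := (lp.hasSum_norm (p := 2) (by norm_num) η)
    have h2 := h1.unique (hasSum_fintype _)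
    have h3 : ‖η‖ ^ 2 = 1 := by
      have : ∀ f : n.Index → ℝ, ∑ k, f k = f i + f j := fun f => Finset.sum_pair hij
      simp only [ENNReal.toReal_ofNat, Real.rpow_ofNat] at h2
      rw [h2, this, hni, hnj, hpq]
    exact (pow_eq_one_iff_of_nonneg (norm_nonneg η) two_ne_zero).1 h3
  have key : ∀ (T : n.Index → Op (1 : NZCard.{v})) (R : Op n),
      IsOpSum (m := fun _ : n.Index => 1) α T R →
      (inner ℂ η (R η) : ℂ) = p * inner ℂ e (T i e) + q * inner ℂ e (T j e) := by
    intro T R h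
    rw [(hasSum_of_isOpSum_unitIsometry he h η).unique (hasSum_fintype _), hsum, hni, hnj]
  obtain ⟨w, hw1, hw2⟩ := exists_vector_point (z := z) he he1 hK ⟨Y, hYK⟩ hη
  refine ⟨w, fun s => ?_, fun a => ?_⟩
  · rw [hw1, key _ _ (hY.sum_eq s), hPi, hPj]
  · rw [hw2, key _ _ (a.2.1.map_directSum _ n _ α P ⟨Y, hYK⟩ hY), hPi, hPj]

end Convexity

/-! ### Kadison representation: `S` is all of `A(K, 0)` -/

section Kadison

/-- The product topology is the weak topology of the coordinates, so a continuous functional lies in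
their span. -/
theorem exists_finite_representation {ι : Type u} (l : (ι → ℝ) →L[ℝ] ℝ) :
    ∃ c : ι →₀ ℝ, ∀ g, l g = c.sum fun i t => t * g i := by
  have h : l.toLinearMap ∈ Submodule.span ℝ (Set.range fun i : ι =>
      (LinearMap.proj i : (ι → ℝ) →ₗ[ℝ] ℝ)) :=
    (LinearMap.mem_span_iff_continuous _).2 l.continuous
  obtain ⟨c, hc⟩ := Finsupp.mem_span_range_iff_exists_finsupp.1 h
  refine ⟨c, fun g => ?_⟩
  have h1 := LinearMap.congr_fun hc g
  rw [Finsupp.sum, LinearMap.sum_apply] at h1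
  exact h1.symm

variable (S : OpSys.{u})

/-- The canonical map `s ↦ ŝ` of `S` into the functions on its nc quasistate space. -/
noncomputable def hatMap :
    S.carrier →ₗ[ℂ] PointedAff (quasistates.{u, v} S) (zeroQuasistate S) where
  toFun s := ⟨fun _ x => x.1 s, ⟨⟨fun _ _ _ _ _ _ h => h.sum_eq s,
    fun _ _ _ _ _ h => LinearMap.congr_fun h s, fun n => by
      let _ := weakStarTopology (Hil n)
      let _ := pointWeakStarTopology S.carrier (Hil n)
      have h : Continuous fun x : S.carrier →ₗ[ℂ] Op n => x s :=
        (continuous_apply s).comp continuous_induced_dom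
      exact h.comp continuous_subtype_val⟩, rfl⟩⟩
  map_add' a b := Subtype.ext (funext fun _ => funext fun x => x.1.map_add a b)
  map_smul' c a := Subtype.ext (funext fun _ => funext fun x => x.1.map_smul c a)

theorem mnorm_map_hatMap {k : ℕ} (s : Matrix (Fin k) (Fin k) S.carrier) :
    MatrixNorm.mnorm k (s.map (hatMap.{u, v} S)) = MatrixNorm.mnorm k s := by
  refine le_antisymm (mnorm_aff_le (mnorm_nonneg S.isOperatorSystem.toIsOperatorSpace k s)
    fun n x => x.2.contractive k s) ?_
  exact mnorm_le_of_quasistates.{u, v} S s (mnorm_aff_nonneg _) fun n x hx =>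
    norm_evalMatrix_le (isCompactNCConvex_quasistates S) (s.map (hatMap.{u, v} S)) ⟨x, hx⟩

theorem hatMap_injective : Function.Injective (hatMap.{u, v} S) := by
  rw [injective_iff_map_eq_zero]
  intro s hs
  have h := mnorm_map_hatMap.{u, v} S (fun _ _ => s : Matrix (Fin 1) (Fin 1) S.carrier)
  have e : Matrix.map (fun _ _ => s : Matrix (Fin 1) (Fin 1) S.carrier) (hatMap.{u, v} S) = 0 := by
    ext1 i j
    exact hs
  have h0 : MatrixNorm.mnorm 1 (0 : Matrix (Fin 1) (Fin 1)
      (PointedAff (quasistates.{u, v} S) (zeroQuasistate S))) = 0 := by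
    simpa using (isOperatorSpace_aff (isCompactNCConvex_quasistates.{u, v} S)).smul_eq 1 0 0
  rw [e, h0] at h
  exact congrFun (congrFun (S.isOperatorSystem.eq_zero 1 _ h.symm) 0) 0

theorem isCCP_hatMap : IsCCP (hatMap.{u, v} S) where
  map_star s := Subtype.ext (funext fun _ => funext fun x => x.2.map_star s)
  contractive _ s := (mnorm_map_hatMap S s).le
  positive k s hs _ x := x.2.positive k s hs

theorem mem_cone_of_map_hatMap {k : ℕ} {s : Matrix (Fin k) (Fin k) S.carrier}
    (hs : s.map (hatMap.{u, v} S) ∈ MatrixCone.cone (E := PointedAff (quasistates.{u, v} S)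
      (zeroQuasistate S)) k) : s ∈ MatrixCone.cone (E := S.carrier) k := by
  refine mem_cone_of_quasistates.{u, v} S ?_ fun n φ hφ => hs n ⟨φ, hφ⟩
  have h := (isMatrixOrderedOperatorSpace_aff
    (isCompactNCConvex_quasistates.{u, v} S)).cone_isHermitian k _ hs
  ext i j
  refine hatMap_injective.{u, v} S ?_
  rw [Matrix.conjTranspose_apply, (isCCP_hatMap.{u, v} S).map_star]
  exact congrFun (congrFun h i) j

variable {S} {e : Hil (1 : NZCard.{v})}

/-- Values on the first level give the numerical radii of all `φ s`; the factor 2 is the price of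
passing to norms. -/
theorem norm₁_le_of_level_one (he : ∀ w : Hil (1 : NZCard.{v}), ‖(inner ℂ e w : ℂ)‖ = ‖w‖)
    (he1 : ‖e‖ = 1) {s : S.carrier} {C : ℝ} (hC : 0 ≤ C)
    (h : ∀ x : quasistates.{u, v} S 1, ‖(inner ℂ e (x.1 s e) : ℂ)‖ ≤ C) : norm₁ s ≤ 2 * C := by
  refine mnorm_le_of_quasistates.{u, v} S _ (by positivity) fun n φ hφ => ?_
  refine (norm_opMatrix_one (φ s)).trans_le (opNorm_le_of_numericalRadius _ (fun η hη => ?_) hC)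
  obtain ⟨y, hy, -⟩ := exists_vector_point (z := zeroQuasistate S) he he1
    (isCompactNCConvex_quasistates.{u, v} S) ⟨φ, hφ⟩ hη
  rw [← hy]
  exact h y

/-- Real parts of functions in `A(K, 0)` are uniformly approximated on the first level by the
real parts of the elements of `S`. -/
theorem exists_approx_re (he : ∀ w : Hil (1 : NZCard.{v}), ‖(inner ℂ e w : ℂ)‖ = ‖w‖)
    (he1 : ‖e‖ = 1) (a : PointedAff (quasistates.{u, v} S) (zeroQuasistate S)) {ε : ℝ}
    (hε : 0 < ε) : ∃ s : S.carrier, ∀ x : quasistates.{u, v} S 1,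
      |(inner ℂ e (a.1 1 x e) : ℂ).re - (inner ℂ e (x.1 s e) : ℂ).re| ≤ ε := by
  have hK := isCompactNCConvex_quasistates.{u, v} S
  let _ : TopologicalSpace (quasistates.{u, v} S 1) := componentTopology (quasistates S) 1
  have hcomp : CompactSpace (quasistates.{u, v} S 1) := by
    let _ := pointWeakStarTopology S.carrier (Hil (1 : NZCard.{v}))
    exact isCompact_iff_compactSpace.1 (hK.compact 1)
  let A : quasistates.{u, v} S 1 → ℝ := fun x => (inner ℂ e (a.1 1 x e) : ℂ).re
  let ρ : quasistates.{u, v} S 1 → S.carrier → ℝ := fun x s => (inner ℂ e (x.1 s e) : ℂ).re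
  have hA : Continuous A :=
    Complex.continuous_re.comp (continuous_inner_of_weakStar (a.2.1.continuous 1) e e)
  have hρ : Continuous ρ := continuous_pi fun s => Complex.continuous_re.comp
    (continuous_inner_of_weakStar ((hatMap.{u, v} S s).2.1.continuous 1) e e)
  have hconv : ∀ δ : ℝ, Convex ℝ (Set.range fun x => (ρ x, A x + δ)) := by
    rintro δ _ ⟨x, rfl⟩ _ ⟨y, rfl⟩ p q hp hq hpq
    obtain ⟨w, hw1, hw2⟩ := convex_combination_quasistates (z := zeroQuasistate S) he he1 S x y
      hp hq hpq
    refine ⟨w, Prod.ext (funext fun s => ?_) ?_⟩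
    · change (inner ℂ e (w.1 s e) : ℂ).re = p * (inner ℂ e (x.1 s e) : ℂ).re +
        q * (inner ℂ e (y.1 s e) : ℂ).re
      rw [hw1, Complex.add_re, Complex.re_ofReal_mul, Complex.re_ofReal_mul]
    · change (inner ℂ e (a.1 1 w e) : ℂ).re + δ = p * ((inner ℂ e (a.1 1 x e) : ℂ).re + δ) +
        q * ((inner ℂ e (a.1 1 y e) : ℂ).re + δ)
      rw [hw2, Complex.add_re, Complex.re_ofReal_mul, Complex.re_ofReal_mul]
      linear_combination (-δ) * hpq
  have hcpt : ∀ δ : ℝ, IsCompact (Set.range fun x => (ρ x, A x + δ)) := fun δ =>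
    isCompact_range (hρ.prodMk (hA.add continuous_const))
  -- Real parts suffice, since the imaginary part of a value at `s` is read off at `i s`.
  -- Injectivity makes the two sets below genuine graphs over the same base, hence disjoint.
  have hinj : Function.Injective ρ := by
    intro x y hxy
    refine Subtype.ext (LinearMap.ext fun s => ?_)
    rw [← sub_eq_zero]
    refine op_one_eq_zero he he1 ?_
    rw [_root_.sub_apply, inner_sub_right, sub_eq_zero]
    refine Complex.ext (congrFun hxy s) ?_
    have h := congrFun hxy (Complex.I • s)
    simp only [ρ, map_smul, _root_.smul_apply, inner_smul_right, Complex.I_mul_re] at h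
    exact neg_injective h
  have hdisj : Disjoint (Set.range fun x => (ρ x, A x + 0)) (Set.range fun x => (ρ x, A x + ε)) := by
    rw [Set.disjoint_left]
    rintro _ ⟨x, rfl⟩ ⟨y, hy⟩
    have h1 := hinj (congrArg Prod.fst hy)
    have h2 : A y + ε = A x + 0 := congrArg Prod.snd hy
    rw [h1] at h2
    linarith
  obtain ⟨f, r, t, hf1, hrt, hf2⟩ := geometric_hahn_banach_compact_closed (hconv 0) (hcpt 0)
    (hconv ε) (hcpt ε).isClosed hdisj
  have hsplit : ∀ g c, f (g, c) = f (g, 0) + c * f (0, 1) := by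
    intro g c
    have : (g, c) = (g, (0 : ℝ)) + c • ((0 : S.carrier → ℝ), (1 : ℝ)) := by simp
    rw [this, map_add, map_smul, smul_eq_mul]
  obtain ⟨c, hc⟩ := exists_finite_representation
    (f.comp (ContinuousLinearMap.inl ℝ (S.carrier → ℝ) ℝ))
  have hc' : ∀ g, f (g, 0) = c.sum fun i t => t * g i := hc
  set l := f ((0 : S.carrier → ℝ), (1 : ℝ)) with hl
  have hu1 : ∀ x, f (ρ x, 0) + A x * l < r := fun x => by
    have h := hf1 _ ⟨x, rfl⟩
    rw [hsplit, add_zero] at h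
    exact h
  have hu2 : ∀ x, t < f (ρ x, 0) + (A x + ε) * l := fun x => by
    have h := hf2 _ ⟨x, rfl⟩
    rw [hsplit] at h
    exact h
  -- At the base point the separating inequalities become `0 < r` and `t < ε l`. This makes `l`
  -- positive and places `r` and `t` between `0` and `ε l`, so no additive constant is needed.
  have hA0 : A (zeroQuasistate S) = 0 := by
    have h := a.2.2
    simp only [A, h]
    simp
  have hρ0 : ρ (zeroQuasistate S) = 0 := by
    funext s
    have h : (zeroQuasistate.{u, v} S).1 s = 0 := rfl
    simp only [ρ, h]
    simp
  have h01 := hu1 (zeroQuasistate S)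
  have h02 := hu2 (zeroQuasistate S)
  have hf0 : f ((0 : S.carrier → ℝ), (0 : ℝ)) = 0 := map_zero f
  rw [hρ0, hA0, hf0] at h01 h02
  have hlε : 0 < ε * l := by linarith
  have hl0 : 0 < l := (mul_pos_iff_of_pos_left hε).1 hlε
  -- Solving `f (ρ x, 0) + A x * l ≈ 0` for `A x` gives this finite combination of elements of `S`.
  refine ⟨c.sum fun s t => ((-t / l : ℝ) : ℂ) • s, fun x => ?_⟩
  have hx : (inner ℂ e (x.1 (c.sum fun s t => ((-t / l : ℝ) : ℂ) • s) e) : ℂ).re =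
      -(f (ρ x, 0)) / l := by
    rw [hc', Finsupp.sum, Finsupp.sum, map_sum, _root_.sum_apply, inner_sum, Complex.re_sum,
      ← Finset.sum_neg_distrib, Finset.sum_div]
    refine Finset.sum_congr rfl fun s _ => ?_
    rw [map_smul, _root_.smul_apply, inner_smul_right, Complex.re_ofReal_mul]
    simp only [ρ]
    ring
  rw [hx]
  change |A x - _| ≤ ε
  have e1 : A x - -(f (ρ x, 0)) / l = (f (ρ x, 0) + A x * l) / l := by
    field_simp
    ring
  rw [e1, abs_le]
  have h1 := hu1 x
  have h2 := hu2 x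
  constructor
  · rw [le_div_iff₀ hl0]
    nlinarith
  · rw [div_le_iff₀ hl0]
    nlinarith

theorem exists_approx (he : ∀ w : Hil (1 : NZCard.{v}), ‖(inner ℂ e w : ℂ)‖ = ‖w‖)
    (he1 : ‖e‖ = 1) (a : PointedAff (quasistates.{u, v} S) (zeroQuasistate S)) {ε : ℝ}
    (hε : 0 < ε) : ∃ s : S.carrier, ∀ x : quasistates.{u, v} S 1,
      ‖(inner ℂ e (a.1 1 x e) : ℂ) - inner ℂ e (x.1 s e)‖ ≤ ε := by
  obtain ⟨s, hs⟩ := exists_approx_re he he1 a (half_pos hε)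
  -- The real part of `-i a` is the imaginary part of `a`. Self-adjoint parts of `s` and `t` are
  -- taken below so that their values are real and the two approximations do not mix.
  obtain ⟨t, ht⟩ := exists_approx_re he he1 ((-Complex.I) • a) (half_pos hε)
  have hreal : ∀ (r : S.carrier) (x : quasistates.{u, v} S 1),
      (inner ℂ e (x.1 ((2⁻¹ : ℂ) • (r + star r)) e) : ℂ) =
        (((inner ℂ e (x.1 r e) : ℂ).re : ℝ) : ℂ) := by
    intro r x
    rw [map_smul, map_add, x.2.map_star, _root_.smul_apply, _root_.add_apply, inner_smul_right,
      inner_add_right, ContinuousLinearMap.star_eq_adjoint,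
      ContinuousLinearMap.adjoint_inner_right, ← inner_conj_symm (x.1 r e), Complex.add_conj]
    push_cast
    ring
  refine ⟨(2⁻¹ : ℂ) • (s + star s) + Complex.I • ((2⁻¹ : ℂ) • (t + star t)), fun x => ?_⟩
  rw [map_add, map_smul _ Complex.I, _root_.add_apply, _root_.smul_apply, inner_add_right,
    inner_smul_right, hreal, hreal]
  have h1 := hs x
  have h2 := ht x
  have e2 : (inner ℂ e (((-Complex.I) • a).1 1 x e) : ℂ).re = (inner ℂ e (a.1 1 x e) : ℂ).im := by
    change (inner ℂ e ((-Complex.I) • (a.1 1 x e)) : ℂ).re = _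
    rw [inner_smul_right]
    simp
  rw [e2] at h2
  refine (Complex.norm_le_abs_re_add_abs_im _).trans ?_
  simp only [Complex.sub_re, Complex.sub_im, Complex.add_re, Complex.add_im, Complex.ofReal_re,
    Complex.ofReal_im, Complex.I_mul_re, Complex.I_mul_im, neg_zero, add_zero, zero_add]
  linarith

/-- First-level approximants are Cauchy in `S` by `norm₁_le_of_level_one`. The function of their
limit agrees with `a` on the first level, which determines it. -/
theorem hatMap_surjective : Function.Surjective (hatMap.{u, v} S) := by
  intro a
  obtain ⟨e, he1, he⟩ := exists_unit_hil_one.{v}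
  have hpos : ∀ i : ℕ, (0 : ℝ) < 1 / ((i : ℝ) + 1) := fun i => by positivity
  choose s hs using fun i : ℕ => exists_approx he he1 a (hpos i)
  have hlim := tendsto_one_div_add_atTop_nhds_zero_nat (𝕜 := ℝ)
  have hcauchy : ∀ ε > (0 : ℝ), ∃ N, ∀ i ≥ N, ∀ j ≥ N, norm₁ (s i - s j) < ε := by
    intro ε hε
    -- Two errors below `ε / 8` give `ε / 4` on the first level, and the numerical radius doubles
    -- this to `ε / 2`.
    obtain ⟨N, hN⟩ := (Metric.tendsto_atTop.1 hlim) (ε / 8) (by positivity)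
    have hN' : ∀ i ≥ N, 1 / ((i : ℝ) + 1) < ε / 8 := fun i hi => by
      have := hN i hi
      rwa [dist_zero_right, Real.norm_of_nonneg (hpos i).le] at this
    refine ⟨N, fun i hi j hj => ?_⟩
    have h : norm₁ (s i - s j) ≤ 2 * (ε / 4) := by
      refine norm₁_le_of_level_one.{u, v} he he1 (by positivity) fun x => ?_
      rw [map_sub, _root_.sub_apply, inner_sub_right]
      have h1 := hs i x
      have h2 := hs j x
      have h3 := norm_sub_le ((inner ℂ e (a.1 1 x e) : ℂ) - inner ℂ e (x.1 (s j) e))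
        ((inner ℂ e (a.1 1 x e) : ℂ) - inner ℂ e (x.1 (s i) e))
      rw [sub_sub_sub_cancel_left] at h3
      have h4 := hN' i hi
      have h5 := hN' j hj
      linarith
    linarith
  obtain ⟨t, ht⟩ := S.isOperatorSystem.complete s hcauchy
  refine ⟨t, ?_⟩
  rw [← sub_eq_zero]
  refine pointedAff_eq_zero he he1 (isCompactNCConvex_quasistates.{u, v} S) fun x => ?_
  have e1 : (inner ℂ e ((hatMap.{u, v} S t - a).1 1 x e) : ℂ) =
      inner ℂ e (x.1 t e) - inner ℂ e (a.1 1 x e) := by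
    change inner ℂ e (x.1 t e - a.1 1 x e) = _
    rw [inner_sub_right]
  rw [e1, sub_eq_zero]
  have l1 : Filter.Tendsto (fun i => (inner ℂ e (x.1 (s i) e) : ℂ)) Filter.atTop
      (nhds (inner ℂ e (x.1 t e))) := by
    rw [tendsto_iff_norm_sub_tendsto_zero]
    refine squeeze_zero (fun _ => norm_nonneg _) (fun i => ?_) ht
    rw [← inner_sub_right, ← _root_.sub_apply, ← map_sub]
    refine (norm_inner_apply_le _ _ _).trans ?_
    rw [he1, mul_one, mul_one]
    exact x.2.norm_le _
  have l2 : Filter.Tendsto (fun i => (inner ℂ e (x.1 (s i) e) : ℂ)) Filter.atTop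
      (nhds (inner ℂ e (a.1 1 x e))) := by
    rw [tendsto_iff_norm_sub_tendsto_zero]
    refine squeeze_zero (fun _ => norm_nonneg _) (fun i => ?_) hlim
    rw [norm_sub_rev]
    exact hs i x
  exact tendsto_nhds_unique l1 l2

/-- The canonical map `s ↦ ŝ` as an isomorphism of vector spaces. -/
noncomputable def hatEquiv (S : OpSys.{u}) :
    S.carrier ≃ₗ[ℂ] PointedAff (quasistates.{u, v} S) (zeroQuasistate S) :=
  LinearEquiv.ofBijective (hatMap S) ⟨hatMap_injective S, hatMap_surjective⟩

theorem hatMap_hatEquiv_symm (S : OpSys.{u})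
    (a : PointedAff (quasistates.{u, v} S) (zeroQuasistate S)) :
    hatMap S ((hatEquiv S).symm a) = a := (hatEquiv S).apply_symm_apply a

theorem isCCP_hatEquiv_symm (S : OpSys.{u}) :
    IsCCP (hatEquiv.{u, v} S).symm.toLinearMap := by
  have hm : ∀ (k : ℕ) (a : Matrix (Fin k) (Fin k)
      (PointedAff (quasistates.{u, v} S) (zeroQuasistate S))),
      (a.map (hatEquiv.{u, v} S).symm.toLinearMap).map (hatMap.{u, v} S) = a := fun k a => by
    ext1 i j
    exact hatMap_hatEquiv_symm S (a i j)
  refine ⟨fun a => ?_, fun k a => ?_, fun k a ha => ?_⟩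
  · refine hatMap_injective.{u, v} S ?_
    rw [(isCCP_hatMap.{u, v} S).map_star]
    change hatMap S ((hatEquiv S).symm (star a)) =
      star (hatMap.{u, v} S ((hatEquiv.{u, v} S).symm a))
    rw [hatMap_hatEquiv_symm, hatMap_hatEquiv_symm]
  · rw [← mnorm_map_hatMap.{u, v}, hm]
  · refine mem_cone_of_map_hatMap.{u, v} S ?_
    rwa [hm]

/-- The representing point is the pullback of `φ` to `S`; since every function is some `ŝ`,
evaluation there recovers `φ`. -/
theorem isPointed_quasistates (S : OpSys.{u}) :
    IsPointed (quasistates.{u, v} S) (zeroQuasistate S) := by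
  intro n φ hφ
  refine ⟨⟨φ ∘ₗ hatMap S, ?_⟩, fun a => ?_⟩
  · refine ⟨fun s => ?_, fun k s => ?_, fun k s hs => ?_⟩
    · exact (congrArg φ ((isCCP_hatMap.{u, v} S).map_star s)).trans (hφ.map_star _)
    · exact (hφ.contractive k (s.map (hatMap S))).trans ((isCCP_hatMap.{u, v} S).contractive k s)
    · exact hφ.positive k _ ((isCCP_hatMap.{u, v} S).positive k s hs)
  · obtain ⟨s, rfl⟩ := hatMap_surjective a
    rfl

end Kadison

/-! ### Functions in `A(K, z)` separate the points of `K` -/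

section Points

variable {E : Type u} [AddCommGroup E] [Module ℂ E] {K : NCSet.{u, v} E}

theorem compressOp_one {m n : NZCard.{v}} (β : Hil m →ₗᵢ[ℂ] Hil n) :
    compressOp β (1 : Op n) = 1 :=
  ContinuousLinearMap.ext fun η => adjoint_isometry_apply β η

/-- The values of `x ↦ x(e)` differ from those of a function in `A(K, z)` by a scalar. -/
theorem exists_coordinate_function (z : K 1) (e : E) :
    ∃ (c : ℂ) (a : PointedAff K z), ∀ (n : NZCard.{v}) (x : K n), x.1 e = a.1 n x + c • 1 := by
  obtain ⟨ω, hω1, hω⟩ := exists_unit_hil_one.{v}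
  -- `c` is the value of the coordinate at `z`. Subtracting the constant `c 1` keeps the function nc
  -- affine because the isometries of a direct sum resolve the identity.
  let c : ℂ := inner ℂ ω (z.1 e ω)
  have hsub : ∀ {n : NZCard.{v}} (T : Op n), T + (-c) • 1 + c • 1 = T := by
    intro n T
    rw [add_assoc, ← add_smul, neg_add_cancel, zero_smul, add_zero]
  refine ⟨c, ⟨fun n x => x.1 e + (-c) • 1, ⟨⟨fun I n m α x y h =>
      isOpSum_add (h.sum_eq e) (isOpSum_smul (-c) h.sum_eq_one), fun m n β x y h => ?_,
      fun n => ?_⟩, ?_⟩⟩, fun n x => (hsub _).symm⟩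
  · rw [compressOp_add, compressOp_smul, compressOp_one, h]
    rfl
  · let _ := componentTopology K n
    refine continuous_weakStar_add ?_ (@continuous_const _ _ _ (weakStarTopology (Hil n)) _)
    let _ := weakStarTopology (Hil n)
    let _ := pointWeakStarTopology E (Hil n)
    have h : Continuous fun x : E →ₗ[ℂ] Op n => x e :=
      (continuous_apply e).comp continuous_induced_dom
    exact h.comp continuous_subtype_val
  · refine op_one_eq_zero hω hω1 ?_
    change inner ℂ ω (z.1 e ω + (-c) • ω) = _
    rw [inner_add_right, inner_smul_right, inner_self_eq_ofReal, hω1]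
    simp [c]

theorem eq_of_forall_pointedAff {z : K 1} {n : NZCard.{v}} {x y : K n}
    (h : ∀ a : PointedAff K z, a.1 n x = a.1 n y) : x = y := by
  refine Subtype.ext (LinearMap.ext fun e => ?_)
  obtain ⟨c, a, ha⟩ := exists_coordinate_function z e
  rw [ha, ha, h]

end Points

/-! ### `(K, z)` as the quasistate space of `A(K, z)` -/

namespace PoNCConv

variable (X : PoNCConv.{u, v}) (hA : IsOperatorSystem (PointedAff X.K X.z))

/-- The canonical map `x ↦ (a ↦ a(x))`. -/
def pointEval (n : NZCard.{v}) (x : X.K n) : quasistates.{max u (v + 1), v} (affSystem X hA) n :=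
  ⟨evalAt x, isCCP_evalAt X.isCompactNCConvex x⟩

/-- The point at which a quasistate of `A(K, z)` is the evaluation. -/
noncomputable def representingPoint (n : NZCard.{v})
    (φ : quasistates.{max u (v + 1), v} (affSystem X hA) n) : X.K n :=
  (X.isPointed n φ.1 φ.2).choose

theorem representingPoint_spec (n : NZCard.{v})
    (φ : quasistates.{max u (v + 1), v} (affSystem X hA) n) (a : PointedAff X.K X.z) :
    φ.1 a = a.1 n (X.representingPoint hA n φ) :=
  (X.isPointed n φ.1 φ.2).choose_spec a

theorem representingPoint_pointEval (n : NZCard.{v}) (x : X.K n) :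
    X.representingPoint hA n (X.pointEval hA n x) = x :=
  eq_of_forall_pointedAff (z := X.z) fun a =>
    (X.representingPoint_spec hA n (X.pointEval hA n x) a).symm

theorem pointEval_representingPoint (n : NZCard.{v})
    (φ : quasistates.{max u (v + 1), v} (affSystem X hA) n) :
    X.pointEval hA n (X.representingPoint hA n φ) = φ :=
  Subtype.ext (LinearMap.ext fun a => (X.representingPoint_spec hA n φ a).symm)

/-- Up to a constant, each coordinate of the inverse map is evaluation of quasistates at a fixed
`a`. This makes the inverse affine and continuous on every level, with no appeal to compactness. -/
theorem exists_representingPoint_apply (e : X.E) : ∃ (c : ℂ) (a : PointedAff X.K X.z),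
    ∀ (n : NZCard.{v}) (φ : quasistates.{max u (v + 1), v} (affSystem X hA) n),
      (X.representingPoint hA n φ).1 e = φ.1 a + c • 1 := by
  obtain ⟨c, a, ha⟩ := exists_coordinate_function X.z e
  exact ⟨c, a, fun n φ => by rw [ha, representingPoint_spec]⟩

theorem isContAffineNCMap_pointEval : IsContAffineNCMap X.K
    (quasistates.{max u (v + 1), v} (affSystem X hA)) (X.pointEval hA) where
  map_directSum I n m α x y h (a : PointedAff X.K X.z) := a.2.1.map_directSum I n m α x y h
  map_compress m n β x y h := LinearMap.ext fun a => a.2.1.map_compress m n β x y h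
  continuous n := by
    let _ := componentTopology X.K n
    exact continuous_induced_rng.2 (continuous_induced_rng.2
      (@continuous_pi _ _ _ _ (fun _ => weakStarTopology (Hil n)) _ fun a => a.2.1.continuous n))

theorem isContAffineNCMap_representingPoint : IsContAffineNCMap
    (quasistates.{max u (v + 1), v} (affSystem X hA)) X.K (X.representingPoint hA) where
  map_directSum I n m α x y h e := by
    obtain ⟨c, a, ha⟩ := X.exists_representingPoint_apply hA e
    simp only [ha]
    exact isOpSum_add (h.sum_eq a) (isOpSum_smul c h.sum_eq_one)
  map_compress m n β x y h := LinearMap.ext fun e => by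
    obtain ⟨c, a, ha⟩ := X.exists_representingPoint_apply hA e
    change _ = compressOp β ((X.representingPoint hA n x).1 e)
    rw [ha, ha, compressOp_add, compressOp_smul, compressOp_one, h]
    rfl
  continuous n := by
    let _ := componentTopology (quasistates.{max u (v + 1), v} (affSystem X hA)) n
    refine continuous_induced_rng.2 (continuous_induced_rng.2
      (@continuous_pi _ _ _ _ (fun _ => weakStarTopology (Hil n)) _ fun e => ?_))
    obtain ⟨c, a, ha⟩ := X.exists_representingPoint_apply hA e
    simp only [Function.comp_apply, ha]
    refine continuous_weakStar_add ?_ (@continuous_const _ _ _ (weakStarTopology (Hil n)) _)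
    let _ := weakStarTopology (Hil n)
    let _ := pointWeakStarTopology (affSystem X hA).carrier (Hil n)
    have h : Continuous fun x : (affSystem X hA).carrier →ₗ[ℂ] Op n => x a :=
      (continuous_apply a).comp continuous_induced_dom
    exact h.comp continuous_subtype_val

theorem pointEval_point : X.pointEval hA 1 X.z = zeroQuasistate (affSystem X hA) :=
  Subtype.ext (LinearMap.ext fun a => a.2.2)

theorem representingPoint_zero :
    X.representingPoint hA 1 (zeroQuasistate (affSystem X hA)) = X.z := by
  rw [← pointEval_point, representingPoint_pointEval]

end PoNCConv

/-! ### Natural isomorphisms and the equivalence -/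

section Functors

variable (hQ : ∀ S : OpSys.{max u (v + 1)},
    IsCompactNCConvex (quasistates.{max u (v + 1), v} S) ∧
      IsPointed (quasistates.{max u (v + 1), v} S) (zeroQuasistate S))
  (hA : ∀ X : PoNCConv.{max u (v + 1), v}, IsOperatorSystem (PointedAff X.K X.z))

/-- `S` is isomorphic to the system of functions on its nc quasistate space. -/
noncomputable def hatIso (S : OpSys.{max u (v + 1)}) :
    S ≅ affSystem (quasistateSpace.{max u (v + 1), v} S (hQ S)) (hA _) where
  hom := ⟨hatMap.{max u (v + 1), v} S, isCCP_hatMap S⟩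
  inv := ⟨(hatEquiv.{max u (v + 1), v} S).symm.toLinearMap, isCCP_hatEquiv_symm S⟩
  hom_inv_id := OpSys.Hom.ext (LinearMap.ext fun s => (hatEquiv S).symm_apply_apply s)
  inv_hom_id := OpSys.Hom.ext (LinearMap.ext fun a => hatMap_hatEquiv_symm S a)

/-- `(K, z)` is isomorphic to the nc quasistate space of `A(K, z)`. -/
noncomputable def pointIso (X : PoNCConv.{max u (v + 1), v}) :
    X ≅ quasistateSpace.{max u (v + 1), v} (affSystem X (hA X)) (hQ _) where
  hom := ⟨X.pointEval (hA X), X.isContAffineNCMap_pointEval (hA X), X.pointEval_point (hA X)⟩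
  inv := ⟨X.representingPoint (hA X), X.isContAffineNCMap_representingPoint (hA X),
    X.representingPoint_zero (hA X)⟩
  hom_inv_id := PoNCConv.Hom.ext (funext fun n => funext fun x =>
    X.representingPoint_pointEval (hA X) n x)
  inv_hom_id := PoNCConv.Hom.ext (funext fun n => funext fun φ =>
    X.pointEval_representingPoint (hA X) n φ)

/-- The maps `s ↦ ŝ` are a natural isomorphism. -/
noncomputable def hatNatIso : 𝟭 OpSys.{max u (v + 1)}ᵒᵖ ≅
    quasistateFunctor.{max u (v + 1), v} hQ ⋙ (affFunctor.{max u (v + 1), v} hA).rightOp :=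
  -- The isomorphism is built in the direction whose components are the explicit maps `s ↦ ŝ`, for
  -- which naturality holds by definition, and then reversed.
  (NatIso.ofComponents (F := quasistateFunctor.{max u (v + 1), v} hQ ⋙
      (affFunctor.{max u (v + 1), v} hA).rightOp) (G := 𝟭 OpSys.{max u (v + 1)}ᵒᵖ)
    (fun S => (hatIso hQ hA S.unop).op) fun _ => rfl).symm

/-- The evaluation maps are a natural isomorphism. -/
noncomputable def pointNatIso : (affFunctor.{max u (v + 1), v} hA).rightOp ⋙
    quasistateFunctor.{max u (v + 1), v} hQ ≅ 𝟭 PoNCConv.{max u (v + 1), v} :=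
  (NatIso.ofComponents (F := 𝟭 PoNCConv.{max u (v + 1), v})
    (G := (affFunctor.{max u (v + 1), v} hA).rightOp ⋙ quasistateFunctor.{max u (v + 1), v} hQ)
    (fun X => pointIso hQ hA X) fun _ => rfl).symm

end Functors

theorem mainTheorem2 :
    ∃ (hQ : ∀ S : OpSys.{max u (v + 1)}, IsCompactNCConvex (quasistates.{max u (v + 1), v} S) ∧
        IsPointed (quasistates.{max u (v + 1), v} S) (zeroQuasistate S))
      (hA : ∀ X : PoNCConv.{max u (v + 1), v}, IsOperatorSystem (PointedAff X.K X.z)),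
      (∃ (η : 𝟭 OpSys.{max u (v + 1)}ᵒᵖ ≅
            quasistateFunctor.{max u (v + 1), v} hQ ⋙
              (affFunctor.{max u (v + 1), v} hA).rightOp)
          (ε : (affFunctor.{max u (v + 1), v} hA).rightOp ⋙
            quasistateFunctor.{max u (v + 1), v} hQ ≅ 𝟭 PoNCConv.{max u (v + 1), v}),
        (∀ (S : OpSys.{max u (v + 1)}) (s : S.carrier) (n : NZCard.{v})
          (x : quasistates.{max u (v + 1), v} S n),
          ((η.inv.app (op S)).unop.toLinearMap s : PointedAff (quasistates S) _).1 n x = x.1 s) ∧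
        (∀ (X : PoNCConv.{max u (v + 1), v}) (n : NZCard.{v}) (x : X.K n)
          (a : PointedAff X.K X.z),
          ((ε.inv.app X).toFun n x).1 a = a.1 n x)) ∧
      ∃ e : OpSys.{max u (v + 1)}ᵒᵖ ≌ PoNCConv.{max u (v + 1), v},
        e.functor = quasistateFunctor.{max u (v + 1), v} hQ ∧
        e.inverse = (affFunctor.{max u (v + 1), v} hA).rightOp := by
  have hQ := fun S : OpSys.{max u (v + 1)} =>
    And.intro (isCompactNCConvex_quasistates.{max u (v + 1), v} S) (isPointed_quasistates S)
  have hA := fun X : PoNCConv.{max u (v + 1), v} =>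
    isOperatorSystem_aff (z := X.z) X.isCompactNCConvex
  exact ⟨hQ, hA, ⟨hatNatIso hQ hA, pointNatIso hQ hA, fun _ _ _ _ => rfl, fun _ _ _ _ => rfl⟩,
    -- `Equivalence.mk` may adjust the unit to satisfy the triangle identity, but it leaves both
    -- functors unchanged.
    CategoryTheory.Equivalence.mk _ _ (hatNatIso hQ hA) (pointNatIso hQ hA), rfl, rfl⟩
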